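/- Throughout, $n\ge 1$ and all function spaces consist of complex-valued functions on $\mathbb R^n$. Definitions. For complex Banach spaces $X_0,X_1$ contained in a common vector space (so that $X_0+X_1$, normed by $\|v\|_{X_0+X_1}=\inf\{\|a\|_{X_0}+\|b\|_{X_1}: a+b=v\}$, is a Banach space) let $\mathcal F(X_0,X_1)$ be the space of bounded continuous functions $f:\{0\le \operatorname{Re} z\le 1\}\to X_0+X_1$ that are holomorphic in $\{0<\operatorname{Re} z<1\}$ and for which $y\mapsto f(j+iy)$ belongs to $C_0(\mathbb R,X_j)$ for $j=0,1$, with the norm $\|f\|_{\mathcal F}=\sup_{j=0,1;\,y\in\mathbb R}\|f(j+iy)\|_{X_j}$. For $0<\theta<1$ let $[X_0,X_1]_\theta=\{f(\theta): f\in\mathcal F(X_0,X_1)\}$ with the norm $\|v\|_{[X_0,X_1]_\theta}=\inf\{\|f\|_{\mathcal F}: f\in\mathcal F(X_0,X_1),\ f(\theta)=v\}$. $\mathrm{BMO}$ is the space of measurable functions $f$, integrable over every ball, with $\|f\|_{\mathrm{BMO}}=\sup_B\frac1{|B|}\int_B\bigl|f-\frac1{|B|}\int_B f\bigr|<\infty$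 (supremum over all balls $B$), modulo constants, and $\mathrm{VMO}$ is the closure in $\mathrm{BMO}$ of the space of continuous functions with compact support. For fixed $b>1$ and $K>0$, $H^1$ is the space of locally integrable functions $f$ with $\|f\|_{H^1}=\|\mathcal Mf\|_{L^1}<\infty$, where $\mathcal Mf(x)=\sup|f*\phi_t(y)|$, $\phi_t=t^{-n}\phi(\cdot/t)$, the supremum being taken over all $t>0$, all $y$ with $|y-x|<bt$ and all smooth functions $\phi$ with support in the open unit ball and $|\nabla\phi|\le K$. In a pair with $\mathrm{BMO}$ or $\mathrm{VMO}$, the space $L^p$ ($1<p<\infty$) is regarded as a space of functions modulo constants, via the injection $f\mapsto f+\mathbb C$. Theorem. Let $1<p<\infty$, $0<\theta<1$ and $1/p_\theta=(1-\theta)/p$. Then, with equality of spaces and equivalence of norms, $$[L^p,\mathrm{VMO}]_\theta=L^{p_\theta},\qquad [L^p,\mathrm{BMO}]_\theta=L^{p_\theta},$$ and, for the conjugate exponents $p'$ of $p$ and $p_\theta'$ of $p_\theta$, $$[L^{p'},H^1]_\theta=L^{p_\theta'}.$$ -/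

import Mathlib

open MeasureTheory Filter Topology
open scoped ENNReal NNReal ContDiff CompactlySupported

noncomputable section

namespace ComplexInterp

/-! ### Calderon's complex method

A normed space `X` contained in a complex vector space `V` is given by its extended norm
`N : V → ℝ≥0∞`, the norm of `X` on `X` and `∞` outside of `X`; thus `v ∈ X` iff `N v < ∞`. -/

section Abstract

variable {V : Type*} [AddCommGroup V] [Module ℂ V]

/-- The norm of `X₀ + X₁`: the infimum of `‖a‖ + ‖b‖` over all `a ∈ X₀`, `b ∈ X₁` with
`a + b = v` (it is `∞` if there is no such decomposition). -/
def sumNorm (N₀ N₁ : V → ℝ≥0∞) (v : V) : ℝ≥0∞ :=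
  ⨅ (a : V) (b : V) (_ : a + b = v), N₀ a + N₁ b

/-- The supremum of `‖f (j + iy)‖_{X_j}` over `j = 0, 1` and real `y`. -/
def boundaryNorm (N₀ N₁ : V → ℝ≥0∞) (f : ℂ → V) : ℝ≥0∞ :=
  (⨆ y : ℝ, N₀ (f (y * Complex.I))) ⊔ ⨆ y : ℝ, N₁ (f (1 + y * Complex.I))

/-- The curve `g` belongs to `C₀(ℝ, X)`: it has values in `X`, is continuous with respect to the
norm of `X` and tends to zero at infinity. -/
structure IsC0Curve (N : V → ℝ≥0∞) (g : ℝ → V) : Prop where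
  mem : ∀ y, N (g y) < ⊤
  continuous : ∀ y, Tendsto (fun s => N (g s - g y)) (𝓝 y) (𝓝 0)
  zero_at_infty : Tendsto (fun s => N (g s)) (cocompact ℝ) (𝓝 0)

/-- The space `ℱ(X₀, X₁)`: the functions `f` on the closed strip `0 ≤ Re z ≤ 1` with values
in `X₀ + X₁` that are bounded and continuous there and holomorphic in the open strip, with respect
to the norm of `X₀ + X₁`, and such that `y ↦ f (j + iy)` is in `C₀(ℝ, X_j)` for `j = 0, 1`.
(The values of `f` outside of the closed strip play no role.) -/
structure IsAdmissible (N₀ N₁ : V → ℝ≥0∞) (f : ℂ → V) : Prop where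
  bounded : ∃ M : ℝ≥0, ∀ z : ℂ, 0 ≤ z.re → z.re ≤ 1 → sumNorm N₀ N₁ (f z) ≤ M
  continuousOn : ∀ z : ℂ, 0 ≤ z.re → z.re ≤ 1 →
    Tendsto (fun w => sumNorm N₀ N₁ (f w - f z)) (𝓝[{w : ℂ | 0 ≤ w.re ∧ w.re ≤ 1}] z) (𝓝 0)
  holomorphic : ∀ z : ℂ, 0 < z.re → z.re < 1 → ∃ d : V,
    Tendsto (fun w => sumNorm N₀ N₁ ((w - z)⁻¹ • (f w - f z) - d)) (𝓝[≠] z) (𝓝 0)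
  left_boundary : IsC0Curve N₀ (fun y : ℝ => f (y * Complex.I))
  right_boundary : IsC0Curve N₁ (fun y : ℝ => f (1 + y * Complex.I))
  norm_lt_top : boundaryNorm N₀ N₁ f < ⊤

/-- The norm of the complex interpolation space `[X₀, X₁]_θ`: the infimum of the norms in
`ℱ(X₀, X₁)` of all `f ∈ ℱ(X₀, X₁)` with `f θ = v`. It is finite iff there is such an `f`, that is,
iff `v` belongs to `[X₀, X₁]_θ`. -/
def interpNorm (N₀ N₁ : V → ℝ≥0∞) (θ : ℝ) (v : V) : ℝ≥0∞ :=
  ⨅ (f : ℂ → V) (_ : IsAdmissible N₀ N₁ f) (_ : f (θ : ℂ) = v), boundaryNorm N₀ N₁ f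

/-- Two normed spaces contained in `V` are equal up to equivalence of norms. As an extended norm is
`∞` exactly outside of the space, the inequalities include the equality of the two sets. -/
def EqUpToEquivNorm (N N' : V → ℝ≥0∞) : Prop :=
  ∃ C : ℝ≥0, ∀ v, N v ≤ C * N' v ∧ N' v ≤ C * N v

end Abstract

/-! ### Function spaces on `ℝⁿ` -/

/-- Complex measurable functions on `ℝⁿ` modulo equality almost everywhere. -/
abbrev Fun (n : ℕ) : Type := EuclideanSpace ℝ (Fin n) →ₘ[volume] ℂ

/-- The (almost everywhere) constant functions. -/
def constants (n : ℕ) : Submodule ℂ (Fun n) := Submodule.span ℂ {1}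

/-- Measurable functions modulo constants. -/
abbrev FunModConst (n : ℕ) : Type := Fun n ⧸ constants n

/-- The norm that a normed space of functions induces on its image in the space of functions modulo
constants: the infimum of the norms of all representatives. -/
def modConst {n : ℕ} (N : Fun n → ℝ≥0∞) (v : FunModConst n) : ℝ≥0∞ :=
  ⨅ (f : Fun n) (_ : (constants n).mkQ f = v), N f

/-- The norm of `L^p(ℝⁿ)`. -/
def lpNorm (n : ℕ) (p : ℝ) (f : Fun n) : ℝ≥0∞ := eLpNorm f (ENNReal.ofReal p) volume

/-- The seminorm of `BMO(ℝⁿ)`: the supremum over all balls `B` of the mean over `B` of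
`|f - f_B|`, where `f_B` is the mean of `f` over `B`. If `f` is not integrable over some ball then
the value is `∞`. -/
def bmoNorm (n : ℕ) (f : Fun n) : ℝ≥0∞ :=
  ⨆ (c : EuclideanSpace ℝ (Fin n)) (r : ℝ) (_ : 0 < r),
    ⨍⁻ x in Metric.ball c r, ‖f x - ⨍ y in Metric.ball c r, f y ∂volume‖ₑ ∂volume

/-- The (semi)norm of `VMO(ℝⁿ)`, the closure in `BMO(ℝⁿ)` of the continuous functions with compact
support: the norm of `BMO` if `f` is in this closure, and `∞` otherwise. -/
def vmoNorm (n : ℕ) (f : Fun n) : ℝ≥0∞ :=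
  ⨅ (_ : ∀ ε : ℝ≥0∞, 0 < ε → ∃ g : C_c(EuclideanSpace ℝ (Fin n), ℂ),
      bmoNorm n (f - g.toContinuousMap.toAEEqFun volume) < ε),
    bmoNorm n f

/-- The test functions of the grand maximal function: smooth, supported in the open unit ball, with
`|∇φ| ≤ K`. -/
def testFunctions (n : ℕ) (K : ℝ) : Set (EuclideanSpace ℝ (Fin n) → ℂ) :=
  {φ | ContDiff ℝ ∞ φ ∧ tsupport φ ⊆ Metric.ball 0 1 ∧ ∀ x, ‖fderiv ℝ φ x‖ ≤ K}

/-- The non-tangential grand maximal function: the supremum of `|f * φ_t (y)|` over all test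
functions `φ`, all `t > 0` and all `y` with `|y - x| < b t`, where `φ_t = t⁻ⁿ φ (· / t)`. -/
def grandMaximal (n : ℕ) (b K : ℝ) (f : Fun n) (x : EuclideanSpace ℝ (Fin n)) : ℝ≥0∞ :=
  ⨆ (φ ∈ testFunctions n K) (t : ℝ) (_ : 0 < t) (y : EuclideanSpace ℝ (Fin n))
    (_ : dist y x < b * t), ‖∫ w, f w * (((t ^ n)⁻¹ : ℝ) • φ (t⁻¹ • (y - w)))‖ₑ

/-- The norm of the Hardy space `H¹(ℝⁿ)`: the `L¹` norm of the grand maximal function of the locally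
integrable function `f` (and `∞` if `f` is not locally integrable). -/
def h1Norm (n : ℕ) (b K : ℝ) (f : Fun n) : ℝ≥0∞ :=
  ⨅ (_ : LocallyIntegrable f volume), ∫⁻ x, grandMaximal n b K f x

end ComplexInterp

end

/-! All inclusions rest on one device. Let g be a finite sum of pieces a_i, with numbers λ_i > 0
such that for all |ε_i| ≤ 1 the sums of ε_i λ_i^(-θ) a_i and of ε_i λ_i^(1-θ) a_i are bounded in the
first and in the second endpoint space. Then exp(z² - θ²) Σ λ_i^(z-θ) a_i is an admissible function
with value g at θ: the phases λ_i^(iy) are absorbed in the ε_i, and the Gaussian supplies the decay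
on the boundary. A series of such sums puts a general element into the interpolation space
(`interpNorm_le_of_series`). Read on the dual side, the same pieces test an arbitrary admissible F:
the three lines theorem for Σ λ_i^(z-θ) ⟨F(z), a_i⟩ bounds ⟨F(θ), g⟩
(`enorm_sum_apply_le_interpNorm`).

Two decompositions feed this device. The first cuts g according to the size of |g|, which gives
control in L^∞ at the second endpoint. With continuous cutoffs the pieces lie in C₀, hence in VMO,
so that L^{p_θ} ⊆ [L^p, VMO]_θ (`exists_tent_decomposition`). Cutting a step function into its level
sets tests [L^{p'}, H¹]_θ from the dual side; there H¹ enters only through its embedding in L¹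
(`exists_lintegral_enorm_le_h1Norm`).

The second is an atomic decomposition (`exists_atoms`): the Calderón–Zygmund decompositions of a
dyadic step function of mean zero at all heights 2^k are subtracted from one another. The atoms have
mean zero and size about 2^k, live on the maximal cubes Q where the mean of |g| exceeds 2^k, and Σ
2^(kr) |Q| is at most a multiple of ∫ |g|^r. Pairing an atom with a BMO function costs its height
times its volume, whence [L^p, BMO]_θ ⊆ L^{p_θ} (`modConst_lpNorm_le_interpNorm_bmo`). The H¹ norm
of an atom is at most a multiple of the same quantity, because its averages decay like |x|^(-n-1),
whence L^{p_θ'} ⊆ [L^{p'}, H¹]_θ (`interpNorm_hardy_le`).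

VMO sits in BMO with the same norm, so the upper bound for VMO and the lower bound for BMO settle
both equalities. Test functions of mean zero see a function only modulo constants on each cube; the
constants of growing cubes converge, and a single one works on the whole space
(`exists_eLpNorm_sub_const_le`). The series are summed in C₀ and in a space ℓ¹ of atomic
coefficients instead of VMO and H¹, so that completeness of the latter two is not needed. -/

namespace ComplexInterp

/-! ### Testing an interpolation space with functionals: the three lines theorem -/

section LowerBound

variable {V : Type*} [AddCommGroup V] [Module ℂ V] {N₀ N₁ : V → ℝ≥0∞}

/-- A linear functional bounded on both spaces of a couple is bounded on their sum. -/
theorem exists_enorm_apply_le_sumNorm {ℓ : V →ₗ[ℂ] ℂ}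
    (h : ∃ A : ℝ≥0, ∀ v, ‖ℓ v‖ₑ ≤ A * N₀ v ∧ ‖ℓ v‖ₑ ≤ A * N₁ v) :
    ∃ A : ℝ≥0, ∀ v, ‖ℓ v‖ₑ ≤ A * sumNorm N₀ N₁ v := by
  obtain ⟨A, hA⟩ := h
  refine ⟨A + 1, fun v => ?_⟩
  have h0 : ((A + 1 : ℝ≥0) : ℝ≥0∞) ≠ 0 := by simp
  have hA' : (A : ℝ≥0∞) ≤ (A + 1 : ℝ≥0) := by simp
  unfold sumNorm
  rw [mul_comm, ← ENNReal.div_le_iff h0 ENNReal.coe_ne_top]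
  refine le_iInf fun a => le_iInf fun b => le_iInf fun hab => ?_
  rw [ENNReal.div_le_iff h0 ENNReal.coe_ne_top, mul_comm, ← hab, map_add, mul_add]
  exact (enorm_add_le _ _).trans (add_le_add ((hA a).1.trans (by gcongr))
    ((hA b).2.trans (by gcongr)))

theorem IsAdmissible.continuousOn_apply {F : ℂ → V} (hF : IsAdmissible N₀ N₁ F) {ℓ : V →ₗ[ℂ] ℂ}
    {A : ℝ≥0} (hA : ∀ v, ‖ℓ v‖ₑ ≤ A * sumNorm N₀ N₁ v) :
    ContinuousOn (fun z => ℓ (F z)) {w : ℂ | 0 ≤ w.re ∧ w.re ≤ 1} := by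
  intro z hz
  rw [ContinuousWithinAt, tendsto_iff_edist_tendsto_0]
  have h := ENNReal.Tendsto.const_mul (a := (A : ℝ≥0∞)) (hF.continuousOn z hz.1 hz.2)
    (Or.inr ENNReal.coe_ne_top)
  rw [mul_zero] at h
  refine tendsto_of_tendsto_of_tendsto_of_le_of_le tendsto_const_nhds h (fun _ => zero_le)
    fun w => ?_
  simp only [edist_eq_enorm_sub, ← map_sub]
  exact hA _

theorem IsAdmissible.differentiableAt_apply {F : ℂ → V} (hF : IsAdmissible N₀ N₁ F)
    {ℓ : V →ₗ[ℂ] ℂ} {A : ℝ≥0} (hA : ∀ v, ‖ℓ v‖ₑ ≤ A * sumNorm N₀ N₁ v) {z : ℂ} (h0 : 0 < z.re)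
    (h1 : z.re < 1) : DifferentiableAt ℂ (fun z => ℓ (F z)) z := by
  obtain ⟨d, hd⟩ := hF.holomorphic z h0 h1
  have : HasDerivAt (fun z => ℓ (F z)) (ℓ d) z := by
    rw [hasDerivAt_iff_tendsto_slope, tendsto_iff_edist_tendsto_0]
    have h := ENNReal.Tendsto.const_mul (a := (A : ℝ≥0∞)) hd (Or.inr ENNReal.coe_ne_top)
    rw [mul_zero] at h
    refine tendsto_of_tendsto_of_tendsto_of_le_of_le tendsto_const_nhds h (fun _ => zero_le)
      fun w => ?_
    rw [slope_def_module, edist_eq_enorm_sub, ← map_sub, ← map_smul, ← map_sub]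
    exact hA _
  exact this.differentiableAt

/-- Interpolation of the bounds of a family of functionals, by the three lines theorem. -/
theorem IsAdmissible.enorm_sum_apply_le {F : ℂ → V} (hF : IsAdmissible N₀ N₁ F) {θ : ℝ}
    (hθ₀ : 0 < θ) (hθ₁ : θ < 1) {ι : Type*} (I : Finset ι) (lam : ι → ℝ) (hlam : ∀ i ∈ I, 0 < lam i)
    (ℓ : ι → V →ₗ[ℂ] ℂ)
    (hℓ : ∀ i ∈ I, ∃ A : ℝ≥0, ∀ v, ‖ℓ i v‖ₑ ≤ A * N₀ v ∧ ‖ℓ i v‖ₑ ≤ A * N₁ v) (C : ℝ≥0)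
    (h₀ : ∀ ε : ι → ℂ, (∀ i, ‖ε i‖ ≤ 1) → ∀ v,
      ‖∑ i ∈ I, (ε i * (lam i ^ (-θ) : ℝ)) * ℓ i v‖ₑ ≤ C * N₀ v)
    (h₁ : ∀ ε : ι → ℂ, (∀ i, ‖ε i‖ ≤ 1) → ∀ v,
      ‖∑ i ∈ I, (ε i * (lam i ^ (1 - θ) : ℝ)) * ℓ i v‖ₑ ≤ C * N₁ v) :
    ‖∑ i ∈ I, ℓ i (F θ)‖ₑ ≤ C * boundaryNorm N₀ N₁ F := by
  classical
  have hℓ' : ∀ i ∈ I, ∃ A : ℝ≥0, ∀ v, ‖ℓ i v‖ₑ ≤ A * sumNorm N₀ N₁ v :=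
    fun i hi => exists_enorm_apply_le_sumNorm (hℓ i hi)
  obtain ⟨M, hM⟩ := hF.bounded
  set S := {w : ℂ | 0 ≤ w.re ∧ w.re ≤ 1} with hS
  have hSeq : Complex.HadamardThreeLines.verticalClosedStrip 0 1 = S := by
    ext w; simp [Complex.HadamardThreeLines.verticalClosedStrip, hS]
  -- All factors equal 1 at z = θ, while on the lines Re z = 0 and Re z = 1 their moduli are the
  -- weights of `h₀` and `h₁`.
  set Φ : ℂ → ℂ := fun z => ∑ i ∈ I, (lam i : ℂ) ^ (z - θ) * ℓ i (F z) with hΦ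
  have hcpow : ∀ i ∈ I, Differentiable ℂ (fun z : ℂ => (lam i : ℂ) ^ (z - θ)) := fun i hi =>
    Differentiable.const_cpow (by fun_prop)
      (Or.inl (by exact_mod_cast (hlam i hi).ne'))
  have hcont : ContinuousOn Φ S := by
    refine continuousOn_finsetSum _ fun i hi => ?_
    obtain ⟨A, hA⟩ := hℓ' i hi
    exact (hcpow i hi).continuous.continuousOn.mul (hF.continuousOn_apply hA)
  have hdiff : DiffContOnCl ℂ Φ (Complex.HadamardThreeLines.verticalStrip 0 1) := by
    refine ⟨?_, ?_⟩
    · intro z hz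
      refine DifferentiableAt.differentiableWithinAt ?_
      refine DifferentiableAt.fun_sum fun i hi => ?_
      obtain ⟨A, hA⟩ := hℓ' i hi
      exact (hcpow i hi z).mul (hF.differentiableAt_apply hA hz.1 hz.2)
    · refine hcont.mono ?_
      rw [← hSeq]
      have : IsClosed (Complex.HadamardThreeLines.verticalClosedStrip 0 1) :=
        isClosed_Icc.preimage Complex.continuous_re
      exact closure_minimal (fun z hz => ⟨hz.1.le, hz.2.le⟩) this
  have hnorm : ∀ i ∈ I, ∀ z : ℂ, ‖(lam i : ℂ) ^ (z - θ)‖ = lam i ^ (z.re - θ) := by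
    intro i hi z
    rw [Complex.norm_cpow_eq_rpow_re_of_pos (hlam i hi)]; simp
  -- The three lines theorem asks for some bound inside the strip, which does not enter the
  -- conclusion. This is why the constants in `hℓ` may depend on i.
  have hbdd : BddAbove ((norm ∘ Φ) '' S) := by
    choose! A hA using hℓ'
    refine ⟨∑ i ∈ I, (lam i ^ (-θ) + lam i ^ (1 - θ)) * (A i * M), ?_⟩
    rintro _ ⟨z, hz, rfl⟩
    refine (norm_sum_le _ _).trans (Finset.sum_le_sum fun i hi => ?_)
    rw [norm_mul, hnorm i hi]
    have hb : ‖ℓ i (F z)‖ ≤ A i * M := by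
      have := (hA i hi (F z)).trans (mul_le_mul_right (hM z hz.1 hz.2) _)
      rw [enorm_eq_nnnorm] at this
      exact_mod_cast this
    have hl := hlam i hi
    refine mul_le_mul ?_ hb (norm_nonneg _) (by positivity)
    rcases le_total 1 (lam i) with h | h
    · exact (Real.rpow_le_rpow_of_exponent_le h (by linarith [hz.2])).trans
        (le_add_of_nonneg_left (by positivity))
    · exact (Real.rpow_le_rpow_of_exponent_ge hl h (by linarith [hz.1])).trans
        (le_add_of_nonneg_right (by positivity))
  set B := (boundaryNorm N₀ N₁ F).toReal with hB
  have hBtop := hF.norm_lt_top.ne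
  have hBe : ENNReal.ofReal B = boundaryNorm N₀ N₁ F := ENNReal.ofReal_toReal hBtop
  have key : ∀ s : ℝ, ∀ N : V → ℝ≥0∞, (∀ ε : ι → ℂ, (∀ i, ‖ε i‖ ≤ 1) → ∀ v,
      ‖∑ i ∈ I, (ε i * (lam i ^ (s - θ) : ℝ)) * ℓ i v‖ₑ ≤ C * N v) →
      (∀ y : ℝ, N (F (s + y * Complex.I)) ≤ boundaryNorm N₀ N₁ F) →
      ∀ z ∈ Complex.re ⁻¹' {s}, ‖Φ z‖ ≤ C * B := by
    intro s N hN hb z hz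
    have hz' : z = s + z.im * Complex.I := by
      rw [← (show z.re = s from hz)]; exact (Complex.re_add_im z).symm
    -- The unimodular phases λ_i^(i Im z) serve as ε_i. Off I they are set to 0, since nothing is
    -- known about λ_i there.
    have h1 := hN (fun i => if i ∈ I then (lam i : ℂ) ^ (z.im * Complex.I) else 0) (fun i => ?_)
      (F z)
    · have h2 : ‖Φ z‖ₑ ≤ C * boundaryNorm N₀ N₁ F := by
        refine le_trans (le_of_eq ?_) (h1.trans (by rw [hz']; gcongr; simpa using hb z.im))
        congr 1
        refine Finset.sum_congr rfl fun i hi => ?_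
        have hne : (lam i : ℂ) ≠ 0 := by exact_mod_cast (hlam i hi).ne'
        rw [if_pos hi, Complex.ofReal_cpow (hlam i hi).le, ← Complex.cpow_add _ _ hne]
        congr 2
        nth_rw 1 [hz']
        push_cast
        ring
      rw [← hBe, ← ofReal_norm, ← ENNReal.ofReal_coe_nnreal, ← ENNReal.ofReal_mul (by positivity),
        ENNReal.ofReal_le_ofReal_iff (by positivity)] at h2
      exact h2
    · split_ifs with hi
      · rw [Complex.norm_cpow_eq_rpow_re_of_pos (hlam i hi)]; simp
      · simp
  have hk0 := key 0 N₀ (by simpa using h₀) (fun y => by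
    refine le_sup_of_le_left (le_iSup_of_le y ?_); simp)
  have hk1 := key 1 N₁ (by simpa using h₁) (fun y => by
    refine le_sup_of_le_right (le_iSup_of_le y ?_); simp)
  have hθS : (θ : ℂ) ∈ Complex.HadamardThreeLines.verticalClosedStrip 0 1 := by
    rw [hSeq]; exact ⟨by simpa using hθ₀.le, by simpa using hθ₁.le⟩
  have h3 := Complex.HadamardThreeLines.norm_le_interp_of_mem_verticalClosedStrip₀₁' Φ hθS hdiff
    (by rw [hSeq]; exact hbdd) hk0 hk1
  -- The exponents add up to 1 ≠ 0, so the power law also covers C * B = 0.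
  have hCB : (C * B : ℝ) ^ (1 - (θ : ℂ).re) * (C * B : ℝ) ^ (θ : ℂ).re = C * B := by
    rw [← Real.rpow_add' (by positivity) (by simp)]; simp
  rw [hCB] at h3
  have hΦθ : Φ θ = ∑ i ∈ I, ℓ i (F θ) := by simp [hΦ]
  rw [← hBe, ← ENNReal.ofReal_coe_nnreal, ← ENNReal.ofReal_mul (by positivity), ← hΦθ,
    ← ofReal_norm]
  exact ENNReal.ofReal_le_ofReal h3

theorem enorm_sum_apply_le_interpNorm {θ : ℝ} (hθ₀ : 0 < θ) (hθ₁ : θ < 1) {ι : Type*} (I : Finset ι)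
    (lam : ι → ℝ) (hlam : ∀ i ∈ I, 0 < lam i) (ℓ : ι → V →ₗ[ℂ] ℂ)
    (hℓ : ∀ i ∈ I, ∃ A : ℝ≥0, ∀ v, ‖ℓ i v‖ₑ ≤ A * N₀ v ∧ ‖ℓ i v‖ₑ ≤ A * N₁ v) (C : ℝ≥0)
    (hC : C ≠ 0)
    (h₀ : ∀ ε : ι → ℂ, (∀ i, ‖ε i‖ ≤ 1) → ∀ v,
      ‖∑ i ∈ I, (ε i * (lam i ^ (-θ) : ℝ)) * ℓ i v‖ₑ ≤ C * N₀ v)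
    (h₁ : ∀ ε : ι → ℂ, (∀ i, ‖ε i‖ ≤ 1) → ∀ v,
      ‖∑ i ∈ I, (ε i * (lam i ^ (1 - θ) : ℝ)) * ℓ i v‖ₑ ≤ C * N₁ v) (v : V) :
    ‖∑ i ∈ I, ℓ i v‖ₑ ≤ C * interpNorm N₀ N₁ θ v := by
  have h0 : (C : ℝ≥0∞) ≠ 0 := by exact_mod_cast hC
  unfold interpNorm
  rw [mul_comm, ← ENNReal.div_le_iff h0 ENNReal.coe_ne_top]
  refine le_iInf fun F => le_iInf fun hF => le_iInf fun hv => ?_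
  rw [ENNReal.div_le_iff h0 ENNReal.coe_ne_top, mul_comm, ← hv]
  exact hF.enorm_sum_apply_le hθ₀ hθ₁ I lam hlam ℓ hℓ C h₀ h₁

/-- This supplies a decomposition into elements of the two endpoint spaces, from which local
integrability is read off before any pairing is written as an integral. -/
theorem sumNorm_lt_top_of_interpNorm_lt_top {θ : ℝ} (hθ₀ : 0 < θ) (hθ₁ : θ < 1) {v : V}
    (hv : interpNorm N₀ N₁ θ v < ⊤) : sumNorm N₀ N₁ v < ⊤ := by
  simp only [interpNorm, iInf_lt_top] at hv
  obtain ⟨F, hF, rfl, -⟩ := hv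
  obtain ⟨M, hM⟩ := hF.bounded
  exact (hM θ (by simpa using hθ₀.le) (by simpa using hθ₁.le)).trans_lt ENNReal.coe_lt_top

end LowerBound

/-! ### Constructing admissible functions from series -/

section UpperBound

variable {V : Type*} [AddCommGroup V] [Module ℂ V] {N₀ N₁ : V → ℝ≥0∞}

omit [Module ℂ V] in
theorem sumNorm_add_le (a b : V) : sumNorm N₀ N₁ (a + b) ≤ N₀ a + N₁ b :=
  iInf_le_of_le (f := fun a' => ⨅ (b' : V) (_ : a' + b' = a + b), N₀ a' + N₁ b') a
    (iInf_le_of_le b (iInf_le_of_le rfl le_rfl))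

theorem interpNorm_le {θ : ℝ} {F : ℂ → V} (hF : IsAdmissible N₀ N₁ F) {v : V} (hv : F θ = v) :
    interpNorm N₀ N₁ θ v ≤ boundaryNorm N₀ N₁ F := by
  unfold interpNorm
  exact iInf_le_of_le F (iInf_le_of_le hF (iInf_le _ hv))

/-- The factor exp(z² - θ²) is 1 at θ and forces the decay along vertical lines that boundary values
in C₀ require. The constant 3 bounds e. -/
theorem norm_exp_sq_sub_le {θ : ℝ} {z : ℂ} (hz : |z.re| ≤ 1) :
    ‖Complex.exp (z ^ 2 - θ ^ 2)‖ ≤ 3 * Real.exp (-z.im ^ 2) := by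
  have h : (z ^ 2 - (θ : ℂ) ^ 2).re = z.re ^ 2 - z.im ^ 2 - θ ^ 2 := by
    simp [pow_two]
  rw [Complex.norm_exp, h]
  have h1 : z.re ^ 2 ≤ 1 := (sq_le_one_iff_abs_le_one _).2 hz
  calc Real.exp (z.re ^ 2 - z.im ^ 2 - θ ^ 2) ≤ Real.exp (1 + -z.im ^ 2) :=
        Real.exp_le_exp.2 (by nlinarith [sq_nonneg θ])
    _ ≤ 3 * Real.exp (-z.im ^ 2) := by
        rw [Real.exp_add]
        have := Real.exp_one_lt_d9
        gcongr
        linarith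

/-- Multiplication by the Gaussian turns bounded continuous boundary values in B into a curve in
C₀(ℝ, B), and the bounded map j carries it to the space with norm N. -/
theorem isC0Curve_of_continuousOn {B : Type*} [NormedAddCommGroup B] [NormedSpace ℂ B]
    {N : V → ℝ≥0∞} {j : B →ₗ[ℂ] V} {c : ℝ≥0} (hj : ∀ b, N (j b) ≤ c * ‖b‖ₑ) {s : ℝ} (hs : |s| ≤ 1)
    (θ : ℝ) {K : ℂ → B} (hK : ContinuousOn K {z | z.re = s}) {T : ℝ}
    (hT : ∀ z : ℂ, z.re = s → ‖K z‖ ≤ T) {F : ℂ → V}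
    (hF : ∀ z : ℂ, z.re = s → F z = j (Complex.exp (z ^ 2 - θ ^ 2) • K z)) :
    IsC0Curve N (fun y : ℝ => F (s + y * Complex.I)) ∧
      ∀ y : ℝ, N (F (s + y * Complex.I)) ≤ c * ENNReal.ofReal (3 * T) := by
  have hre : ∀ y : ℝ, ((s : ℂ) + y * Complex.I).re = s := by simp
  have him : ∀ y : ℝ, ((s : ℂ) + y * Complex.I).im = y := by simp
  set H : ℝ → B := fun y => Complex.exp (((s : ℂ) + y * Complex.I) ^ 2 - θ ^ 2) •
    K (s + y * Complex.I) with hH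
  have hFH : ∀ y : ℝ, F (s + y * Complex.I) = j (H y) := fun y => hF _ (hre y)
  have hHc : Continuous H := by
    refine Continuous.smul (by fun_prop) ?_
    exact hK.comp_continuous (by fun_prop) hre
  have hT0 : 0 ≤ T := (norm_nonneg _).trans (hT _ (hre 0))
  have hHn : ∀ y : ℝ, ‖H y‖ ≤ 3 * Real.exp (-y ^ 2) * T := by
    intro y
    rw [hH, norm_smul]
    have h1 := norm_exp_sq_sub_le (θ := θ) (z := s + y * Complex.I) (by rw [hre]; exact hs)
    rw [him] at h1
    exact mul_le_mul h1 (hT _ (hre y)) (norm_nonneg _) (by positivity)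
  have hNH : ∀ y : ℝ, N (F (s + y * Complex.I)) ≤ c * ENNReal.ofReal ‖H y‖ := fun y => by
    rw [hFH, ofReal_norm]; exact hj _
  refine ⟨⟨fun y => ?_, fun y => ?_, ?_⟩, fun y => ?_⟩
  · exact (hNH y).trans_lt (ENNReal.mul_lt_top ENNReal.coe_lt_top ENNReal.ofReal_lt_top)
  · have h := ENNReal.Tendsto.const_mul (a := (c : ℝ≥0∞))
      (tendsto_iff_edist_tendsto_0.1 (hHc.tendsto y)) (Or.inr ENNReal.coe_ne_top)
    rw [mul_zero] at h
    refine tendsto_of_tendsto_of_tendsto_of_le_of_le tendsto_const_nhds h (fun _ => zero_le)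
      fun w => ?_
    simp only [hFH, edist_eq_enorm_sub, ← map_sub]
    exact hj _
  · have h1 : Tendsto (fun y : ℝ => 3 * Real.exp (-y ^ 2) * T) (cocompact ℝ) (𝓝 (3 * 0 * T)) := by
      refine ((Real.tendsto_exp_atBot.comp ?_).const_mul 3).mul_const T
      refine tendsto_neg_atTop_atBot.comp ?_
      have := (tendsto_pow_atTop (α := ℝ) two_ne_zero).comp (tendsto_norm_cocompact_atTop (E := ℝ))
      refine this.congr fun y => by simp
    have h2 := squeeze_zero (fun y => norm_nonneg (H y)) hHn (by rwa [mul_zero, zero_mul] at h1)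
    have h := ENNReal.Tendsto.const_mul (a := (c : ℝ≥0∞)) (ENNReal.tendsto_ofReal h2)
      (Or.inr ENNReal.coe_ne_top)
    rw [ENNReal.ofReal_zero, mul_zero] at h
    exact tendsto_of_tendsto_of_tendsto_of_le_of_le tendsto_const_nhds h (fun _ => zero_le) hNH
  · refine (hNH y).trans ?_
    gcongr
    refine (hHn y).trans ?_
    have : Real.exp (-y ^ 2) ≤ 1 := Real.exp_le_one_iff.2 (by nlinarith [sq_nonneg y])
    nlinarith

/-- Any c_i with |c_i| ≤ w_i has the form ε_i w_i with |ε_i| ≤ 1, so unconditional bounds are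
monotone in the moduli of the coefficients. -/
theorem norm_sum_smul_le_of_norm_le {B ι : Type*} [NormedAddCommGroup B] [NormedSpace ℂ B]
    {I : Finset ι} {w : ι → ℝ} (hw : ∀ i ∈ I, 0 < w i) {x : ι → B} {A : ℝ}
    (h : ∀ ε : ι → ℂ, (∀ i, ‖ε i‖ ≤ 1) → ‖∑ i ∈ I, (ε i * (w i : ℝ)) • x i‖ ≤ A) {c : ι → ℂ}
    (hc : ∀ i ∈ I, ‖c i‖ ≤ w i) : ‖∑ i ∈ I, c i • x i‖ ≤ A := by
  classical
  refine le_trans (le_of_eq ?_) (h (fun i => if i ∈ I then c i / w i else 0) fun i => ?_)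
  · congr 1
    refine Finset.sum_congr rfl fun i hi => ?_
    have : (w i : ℂ) ≠ 0 := by exact_mod_cast (hw i hi).ne'
    rw [if_pos hi, div_mul_cancel₀ _ this]
  · split_ifs with hi
    · rw [norm_div, Complex.norm_real, Real.norm_of_nonneg (hw i hi).le]
      exact (div_le_one (hw i hi)).2 (hc i hi)
    · simp

theorem rpow_le_one_add {l x : ℝ} (hl : 0 < l) (h0 : 0 ≤ x) (h1 : x ≤ 1) : l ^ x ≤ 1 + l := by
  rcases le_total 1 l with h | h
  · have := Real.rpow_le_rpow_of_exponent_le h h1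
    rw [Real.rpow_one] at this; linarith
  · have := Real.rpow_le_one hl.le h h0
    linarith

/-- The complex interpolation norm of the sum of a series, from unconditional bounds of its terms
in the two end point spaces. -/
theorem interpNorm_le_of_series {B₀ B₁ Br : Type*}
    [NormedAddCommGroup B₀] [NormedSpace ℂ B₀] [CompleteSpace B₀]
    [NormedAddCommGroup B₁] [NormedSpace ℂ B₁] [CompleteSpace B₁]
    [NormedAddCommGroup Br] [NormedSpace ℂ Br]
    (j₀ : B₀ →ₗ[ℂ] V) (j₁ : B₁ →ₗ[ℂ] V) (jr : Br →ₗ[ℂ] V) {c : ℝ≥0}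
    (hj₀ : ∀ b, N₀ (j₀ b) ≤ c * ‖b‖ₑ) (hj₁ : ∀ b, N₁ (j₁ b) ≤ c * ‖b‖ₑ)
    (hclosed : IsClosed {x : B₀ × B₁ × Br | j₀ x.1 + j₁ x.2.1 = jr x.2.2})
    {θ : ℝ} (hθ₀ : 0 < θ) (hθ₁ : θ < 1)
    {ι : Type*} (I : ℕ → Finset ι) (lam : ℕ → ι → ℝ) (hlam : ∀ m, ∀ i ∈ I m, 0 < lam m i)
    (x : ℕ → ι → B₀) (y : ℕ → ι → B₁) (hxy : ∀ m, ∀ i ∈ I m, j₀ (x m i) = j₁ (y m i))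
    (A : ℕ → ℝ) (hA : Summable A)
    (h₀ : ∀ m, ∀ ε : ι → ℂ, (∀ i, ‖ε i‖ ≤ 1) →
      ‖∑ i ∈ I m, (ε i * (lam m i ^ (-θ) : ℝ)) • x m i‖ ≤ A m)
    (h₁ : ∀ m, ∀ ε : ι → ℂ, (∀ i, ‖ε i‖ ≤ 1) →
      ‖∑ i ∈ I m, (ε i * (lam m i ^ (1 - θ) : ℝ)) • y m i‖ ≤ A m)
    (fm : ℕ → Br) (f : Br) (hf : HasSum fm f) (hfm : ∀ m, jr (fm m) = j₀ (∑ i ∈ I m, x m i)) :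
    interpNorm N₀ N₁ θ (jr f) ≤ c * ENNReal.ofReal (3 * ∑' m, A m) := by
  set S := {w : ℂ | 0 ≤ w.re ∧ w.re ≤ 1} with hS
  set U := {w : ℂ | 0 < w.re ∧ w.re < 1} with hU
  have hUo : IsOpen U := (isOpen_lt continuous_const Complex.continuous_re).inter
    (isOpen_lt Complex.continuous_re continuous_const)
  have hUS : U ⊆ S := fun z hz => ⟨hz.1.le, hz.2.le⟩
  let p : ℕ → ι → ℂ → ℂ := fun m i z => (lam m i : ℂ) ^ (z - θ)
  let k₀ : ℕ → ℂ → B₀ := fun m z => ∑ i ∈ I m, p m i z • x m i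
  let k₁ : ℕ → ℂ → B₁ := fun m z => ∑ i ∈ I m, p m i z • y m i
  -- Inside the strip each term is divided between the two spaces in the proportion 1/(1+λ) to
  -- λ/(1+λ). As |λ^(z-θ)| ≤ λ^(-θ) (1+λ), the two parts are dominated by the endpoint weights
  -- λ^(-θ) and λ^(1-θ), and both series converge uniformly on the closed strip.
  let g₀ : ℕ → ℂ → B₀ := fun m z => ∑ i ∈ I m, (p m i z * ((1 + lam m i : ℝ) : ℂ)⁻¹) • x m i
  let g₁ : ℕ → ℂ → B₁ := fun m z =>
    ∑ i ∈ I m, (p m i z * ((lam m i / (1 + lam m i) : ℝ) : ℂ)) • y m i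
  have hp : ∀ m, ∀ i ∈ I m, Differentiable ℂ (p m i) := fun m i hi =>
    Differentiable.const_cpow (by fun_prop) (Or.inl (by exact_mod_cast (hlam m i hi).ne'))
  have hpn : ∀ m, ∀ i ∈ I m, ∀ z : ℂ, ‖p m i z‖ = lam m i ^ (z.re - θ) := by
    intro m i hi z
    rw [Complex.norm_cpow_eq_rpow_re_of_pos (hlam m i hi)]; simp
  have dk₀ : ∀ m, Differentiable ℂ (k₀ m) := fun m => Differentiable.fun_sum fun i hi =>
    (hp m i hi).smul_const _
  have dk₁ : ∀ m, Differentiable ℂ (k₁ m) := fun m => Differentiable.fun_sum fun i hi =>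
    (hp m i hi).smul_const _
  have dg₀ : ∀ m, Differentiable ℂ (g₀ m) := fun m => Differentiable.fun_sum fun i hi =>
    ((hp m i hi).mul_const _).smul_const _
  have dg₁ : ∀ m, Differentiable ℂ (g₁ m) := fun m => Differentiable.fun_sum fun i hi =>
    ((hp m i hi).mul_const _).smul_const _
  have bk₀ : ∀ m z, z ∈ {z : ℂ | z.re = 0} → ‖k₀ m z‖ ≤ A m := fun m z hz =>
    norm_sum_smul_le_of_norm_le (fun i hi => Real.rpow_pos_of_pos (hlam m i hi) _) (h₀ m)
      fun i hi => by rw [hpn m i hi, show z.re = 0 from hz, zero_sub]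
  have bk₁ : ∀ m z, z ∈ {z : ℂ | z.re = 1} → ‖k₁ m z‖ ≤ A m := fun m z hz =>
    norm_sum_smul_le_of_norm_le (fun i hi => Real.rpow_pos_of_pos (hlam m i hi) _) (h₁ m)
      fun i hi => by rw [hpn m i hi, show z.re = 1 from hz]
  have bg₀ : ∀ m z, z ∈ S → ‖g₀ m z‖ ≤ A m := fun m z hz =>
    norm_sum_smul_le_of_norm_le (fun i hi => Real.rpow_pos_of_pos (hlam m i hi) _) (h₀ m)
      fun i hi => by
        have hl := hlam m i hi
        rw [norm_mul, hpn m i hi, norm_inv, Complex.norm_real, Real.norm_of_nonneg (by positivity),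
          ← div_eq_mul_inv, div_le_iff₀ (by positivity), sub_eq_add_neg, Real.rpow_add hl, mul_comm]
        gcongr
        exact rpow_le_one_add hl hz.1 hz.2
  have bg₁ : ∀ m z, z ∈ S → ‖g₁ m z‖ ≤ A m := fun m z hz =>
    norm_sum_smul_le_of_norm_le (fun i hi => Real.rpow_pos_of_pos (hlam m i hi) _) (h₁ m)
      fun i hi => by
        have hl := hlam m i hi
        rw [norm_mul, hpn m i hi, Complex.norm_real, Real.norm_of_nonneg (by positivity),
          ← mul_div_assoc, div_le_iff₀ (by positivity), sub_eq_add_neg, sub_eq_add_neg,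
          Real.rpow_add hl, Real.rpow_add hl, Real.rpow_one]
        have h2 := rpow_le_one_add hl hz.1 hz.2
        calc lam m i ^ z.re * lam m i ^ (-θ) * lam m i
            = (lam m i * lam m i ^ (-θ)) * lam m i ^ z.re := by ring
          _ ≤ _ := by gcongr
  have hpart : ∀ m z, j₀ (k₀ m z) = j₀ (g₀ m z) + j₁ (g₁ m z) ∧
      j₁ (k₁ m z) = j₀ (g₀ m z) + j₁ (g₁ m z) := by
    intro m z
    have e1 : j₀ (k₀ m z) = j₁ (k₁ m z) := by
      simp only [k₀, k₁, map_sum, map_smul]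
      exact Finset.sum_congr rfl fun i hi => by rw [hxy m i hi]
    rw [← e1]
    have e2 : j₀ (k₀ m z) = j₀ (g₀ m z) + j₁ (g₁ m z) := by
      simp only [k₀, g₀, g₁, map_sum, map_smul, ← Finset.sum_add_distrib]
      refine Finset.sum_congr rfl fun i hi => ?_
      rw [← hxy m i hi, ← add_smul, ← mul_add]
      have hl := hlam m i hi
      have : ((1 + lam m i : ℝ) : ℂ)⁻¹ + ((lam m i / (1 + lam m i) : ℝ) : ℂ) = 1 := by
        rw [← Complex.ofReal_inv, ← Complex.ofReal_add, ← Complex.ofReal_one]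
        congr 1
        field_simp
      rw [this, mul_one]
    exact ⟨e2, e2⟩
  set G₀ : ℂ → B₀ := fun z => ∑' m, g₀ m z with hG₀
  set G₁ : ℂ → B₁ := fun z => ∑' m, g₁ m z with hG₁
  set K₀ : ℂ → B₀ := fun z => ∑' m, k₀ m z with hK₀
  set K₁ : ℂ → B₁ := fun z => ∑' m, k₁ m z with hK₁
  set e : ℂ → ℂ := fun z => Complex.exp (z ^ 2 - θ ^ 2) with he
  have hed : Differentiable ℂ e := by simp only [he]; fun_prop
  have sG₀ : ∀ z ∈ S, HasSum (fun m => g₀ m z) (G₀ z) := fun z hz =>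
    (hA.of_norm_bounded fun m => bg₀ m z hz).hasSum
  have sG₁ : ∀ z ∈ S, HasSum (fun m => g₁ m z) (G₁ z) := fun z hz =>
    (hA.of_norm_bounded fun m => bg₁ m z hz).hasSum
  set F : ℂ → V := fun z => j₀ (e z • G₀ z) + j₁ (e z • G₁ z) with hF
  have hFsub : ∀ z w, F z - F w = j₀ (e z • G₀ z - e w • G₀ w) + j₁ (e z • G₁ z - e w • G₁ w) := by
    intro z w
    simp only [hF, map_sub]; abel
  have hsum : ∀ b₀ b₁, sumNorm N₀ N₁ (j₀ b₀ + j₁ b₁) ≤ c * ‖b₀‖ₑ + c * ‖b₁‖ₑ := fun b₀ b₁ =>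
    (sumNorm_add_le _ _).trans (add_le_add (hj₀ b₀) (hj₁ b₁))
  have hlim : ∀ {α : Type} {l : Filter α} {u : α → B₀} {v : α → B₁}, Tendsto u l (𝓝 0) →
      Tendsto v l (𝓝 0) → Tendsto (fun a => sumNorm N₀ N₁ (j₀ (u a) + j₁ (v a))) l (𝓝 0) := by
    intro α l u v hu hv
    have h1 := ENNReal.Tendsto.const_mul (a := (c : ℝ≥0∞)) (hu.enorm) (Or.inr ENNReal.coe_ne_top)
    have h2 := ENNReal.Tendsto.const_mul (a := (c : ℝ≥0∞)) (hv.enorm) (Or.inr ENNReal.coe_ne_top)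
    have h := h1.add h2
    rw [enorm_zero, enorm_zero, mul_zero, add_zero] at h
    exact tendsto_of_tendsto_of_tendsto_of_le_of_le tendsto_const_nhds h (fun _ => zero_le)
      fun a => hsum _ _
  have cG₀ : ContinuousOn (fun z => e z • G₀ z) S := hed.continuous.continuousOn.smul
    (continuousOn_tsum (fun m => (dg₀ m).continuous.continuousOn) hA bg₀)
  have cG₁ : ContinuousOn (fun z => e z • G₁ z) S := hed.continuous.continuousOn.smul
    (continuousOn_tsum (fun m => (dg₁ m).continuous.continuousOn) hA bg₁)
  have dG₀ : DifferentiableOn ℂ (fun z => e z • G₀ z) U := hed.differentiableOn.smul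
    (Complex.differentiableOn_tsum_of_summable_norm hA (fun m => (dg₀ m).differentiableOn) hUo
      fun m w hw => bg₀ m w (hUS hw))
  have dG₁ : DifferentiableOn ℂ (fun z => e z • G₁ z) U := hed.differentiableOn.smul
    (Complex.differentiableOn_tsum_of_summable_norm hA (fun m => (dg₁ m).differentiableOn) hUo
      fun m w hw => bg₁ m w (hUS hw))
  -- On the left line the undivided series converges in B₀ already. The partial sums of the two
  -- representations agree, and `hclosed`, with third coordinate 0, passes the equality to the
  -- limit.
  have hFK₀ : ∀ z : ℂ, z.re = 0 → F z = j₀ (e z • K₀ z) := by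
    intro z hz
    have hzS : z ∈ S := by simp [hS, hz]
    have s1 : HasSum (fun m => k₀ m z) (K₀ z) := (hA.of_norm_bounded fun m => bk₀ m z hz).hasSum
    have s2 : HasSum (fun m => (g₀ m z - k₀ m z, g₁ m z, (0 : Br))) (G₀ z - K₀ z, G₁ z, 0) :=
      ((sG₀ z hzS).sub s1).prodMk ((sG₁ z hzS).prodMk hasSum_zero)
    have h3 := hclosed.mem_of_tendsto s2 (Eventually.of_forall fun t => by
      simp only [Set.mem_ofPred_eq, Prod.fst_sum, Prod.snd_sum, map_sum, map_sub, map_zero,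
        ← Finset.sum_add_distrib, (hpart _ z).1]
      simp)
    simp only [Set.mem_ofPred_eq, map_sub, map_zero] at h3
    simp only [hF, map_smul, ← smul_add]
    congr 1
    rw [← sub_eq_zero, ← h3]; abel
  have hFK₁ : ∀ z : ℂ, z.re = 1 → F z = j₁ (e z • K₁ z) := by
    intro z hz
    have hzS : z ∈ S := by simp [hS, hz]
    have s1 : HasSum (fun m => k₁ m z) (K₁ z) := (hA.of_norm_bounded fun m => bk₁ m z hz).hasSum
    have s2 : HasSum (fun m => (g₀ m z, g₁ m z - k₁ m z, (0 : Br))) (G₀ z, G₁ z - K₁ z, 0) :=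
      (sG₀ z hzS).prodMk (((sG₁ z hzS).sub s1).prodMk hasSum_zero)
    have h3 := hclosed.mem_of_tendsto s2 (Eventually.of_forall fun t => by
      simp only [Set.mem_ofPred_eq, Prod.fst_sum, Prod.snd_sum, map_sum, map_sub, map_zero,
        ← Finset.sum_add_distrib, (hpart _ z).2]
      simp)
    simp only [Set.mem_ofPred_eq, map_sub, map_zero] at h3
    simp only [hF, map_smul, ← smul_add]
    congr 1
    rw [← sub_eq_zero, ← h3]; abel
  have hθS : (θ : ℂ) ∈ S := ⟨by simpa using hθ₀.le, by simpa using hθ₁.le⟩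
  -- The third coordinate of `hclosed` now carries the series of f itself, which identifies the
  -- limits of three series taken in three different norms.
  have hFθ : F θ = jr f := by
    have s2 : HasSum (fun m => (g₀ m θ, g₁ m θ, fm m)) (G₀ θ, G₁ θ, f) :=
      (sG₀ _ hθS).prodMk ((sG₁ _ hθS).prodMk hf)
    have hk : ∀ m, k₀ m θ = ∑ i ∈ I m, x m i := fun m =>
      Finset.sum_congr rfl fun i hi => by simp [p]
    have h3 := hclosed.mem_of_tendsto s2 (Eventually.of_forall fun t => by
      simp only [Set.mem_ofPred_eq, Prod.fst_sum, Prod.snd_sum, map_sum]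
      rw [← Finset.sum_add_distrib]
      refine Finset.sum_congr rfl fun m _ => ?_
      rw [hfm, ← hk, (hpart m θ).1])
    have he1 : e θ = 1 := by simp [he]
    simp only [hF, he1, one_smul]
    exact h3
  have bK₀ : ∀ z : ℂ, z.re = 0 → ‖K₀ z‖ ≤ ∑' m, A m := fun z hz =>
    tsum_of_norm_bounded hA.hasSum fun m => bk₀ m z hz
  have bK₁ : ∀ z : ℂ, z.re = 1 → ‖K₁ z‖ ≤ ∑' m, A m := fun z hz =>
    tsum_of_norm_bounded hA.hasSum fun m => bk₁ m z hz
  obtain ⟨left, hleft⟩ := isC0Curve_of_continuousOn hj₀ (s := 0) (by simp) θ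
    (continuousOn_tsum (fun m => (dk₀ m).continuous.continuousOn) hA bk₀) bK₀ hFK₀
  obtain ⟨right, hright⟩ := isC0Curve_of_continuousOn hj₁ (s := 1) (by simp) θ
    (continuousOn_tsum (fun m => (dk₁ m).continuous.continuousOn) hA bk₁) bK₁ hFK₁
  simp only [Complex.ofReal_zero, zero_add, Complex.ofReal_one] at left hleft right hright
  have hbn : boundaryNorm N₀ N₁ F ≤ c * ENNReal.ofReal (3 * ∑' m, A m) :=
    sup_le (iSup_le hleft) (iSup_le hright)
  have hadm : IsAdmissible N₀ N₁ F := by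
    refine ⟨⟨c * Real.toNNReal (3 * ∑' m, A m) + c * Real.toNNReal (3 * ∑' m, A m),
      fun z h0 h1 => ?_⟩, fun z h0 h1 => ?_, fun z h0 h1 => ?_, left, right, hbn.trans_lt
      (ENNReal.mul_lt_top ENNReal.coe_lt_top ENNReal.ofReal_lt_top)⟩
    · have hz : z ∈ S := ⟨h0, h1⟩
      have he3 : ‖e z‖ ≤ 3 := by
        have h := norm_exp_sq_sub_le (θ := θ) (z := z) (abs_le.2 ⟨by linarith, h1⟩)
        have : Real.exp (-z.im ^ 2) ≤ 1 := Real.exp_le_one_iff.2 (by nlinarith [sq_nonneg z.im])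
        simp only [he]
        linarith
      refine (hsum _ _).trans ?_
      push_cast
      have n₀ : ‖G₀ z‖ ≤ ∑' m, A m := tsum_of_norm_bounded hA.hasSum fun m => bg₀ m z hz
      have n₁ : ‖G₁ z‖ ≤ ∑' m, A m := tsum_of_norm_bounded hA.hasSum fun m => bg₁ m z hz
      gcongr
      · rw [← ofReal_norm, norm_smul]
        exact ENNReal.ofReal_le_ofReal (mul_le_mul he3 n₀ (norm_nonneg _) (by norm_num))
      · rw [← ofReal_norm, norm_smul]
        exact ENNReal.ofReal_le_ofReal (mul_le_mul he3 n₁ (norm_nonneg _) (by norm_num))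
    · simp only [hFsub]
      refine hlim ?_ ?_
      · exact tendsto_sub_nhds_zero_iff.2 (cG₀ z ⟨h0, h1⟩)
      · exact tendsto_sub_nhds_zero_iff.2 (cG₁ z ⟨h0, h1⟩)
    · have hz : z ∈ U := ⟨h0, h1⟩
      have h2 := (dG₀.differentiableAt (hUo.mem_nhds hz)).hasDerivAt
      have h3 := (dG₁.differentiableAt (hUo.mem_nhds hz)).hasDerivAt
      rw [hasDerivAt_iff_tendsto_slope] at h2 h3
      refine ⟨j₀ (deriv (fun z => e z • G₀ z) z) + j₁ (deriv (fun z => e z • G₁ z) z),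
        Tendsto.congr (fun w => ?_) (hlim (tendsto_sub_nhds_zero_iff.2 h2)
        (tendsto_sub_nhds_zero_iff.2 h3))⟩
      · rw [hFsub, smul_add]
        simp only [slope_def_module, map_sub, map_smul]
        congr 1
        abel
  exact (interpNorm_le hadm hFθ).trans hbn

end UpperBound

/-! ### Functoriality of the complex method -/

section Transfer

variable {V W : Type*} [AddCommGroup V] [Module ℂ V] [AddCommGroup W] [Module ℂ W]
  {N₀ N₁ : V → ℝ≥0∞} {N₀' N₁' : W → ℝ≥0∞}

theorem sumNorm_map_le {T : V →ₗ[ℂ] W} (h₀ : ∀ v, N₀' (T v) ≤ N₀ v)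
    (h₁ : ∀ v, N₁' (T v) ≤ N₁ v) (v : V) : sumNorm N₀' N₁' (T v) ≤ sumNorm N₀ N₁ v := by
  refine le_iInf fun a => le_iInf fun b => le_iInf fun hab => ?_
  rw [← hab, map_add]
  exact (sumNorm_add_le _ _).trans (add_le_add (h₀ a) (h₁ b))

theorem boundaryNorm_map_le {T : V →ₗ[ℂ] W} (h₀ : ∀ v, N₀' (T v) ≤ N₀ v)
    (h₁ : ∀ v, N₁' (T v) ≤ N₁ v) (F : ℂ → V) :
    boundaryNorm N₀' N₁' (fun z => T (F z)) ≤ boundaryNorm N₀ N₁ F :=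
  sup_le_sup (iSup_mono fun _ => h₀ _) (iSup_mono fun _ => h₁ _)

theorem IsC0Curve.map {N : V → ℝ≥0∞} {N' : W → ℝ≥0∞} {T : V →ₗ[ℂ] W} (h : ∀ v, N' (T v) ≤ N v)
    {g : ℝ → V} (hg : IsC0Curve N g) : IsC0Curve N' (fun y => T (g y)) where
  mem y := (h _).trans_lt (hg.mem y)
  continuous y := tendsto_of_tendsto_of_tendsto_of_le_of_le tendsto_const_nhds (hg.continuous y)
    (fun _ => zero_le) fun s => by simpa only [map_sub] using h (g s - g y)
  zero_at_infty := tendsto_of_tendsto_of_tendsto_of_le_of_le tendsto_const_nhds hg.zero_at_infty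
    (fun _ => zero_le) fun s => h (g s)

theorem IsAdmissible.map {T : V →ₗ[ℂ] W} (h₀ : ∀ v, N₀' (T v) ≤ N₀ v)
    (h₁ : ∀ v, N₁' (T v) ≤ N₁ v) {F : ℂ → V} (hF : IsAdmissible N₀ N₁ F) :
    IsAdmissible N₀' N₁' (fun z => T (F z)) where
  bounded := by
    obtain ⟨M, hM⟩ := hF.bounded
    exact ⟨M, fun z h h' => (sumNorm_map_le h₀ h₁ _).trans (hM z h h')⟩
  continuousOn z h h' := tendsto_of_tendsto_of_tendsto_of_le_of_le tendsto_const_nhds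
    (hF.continuousOn z h h') (fun _ => zero_le) fun w => by
      simpa only [map_sub] using sumNorm_map_le h₀ h₁ (F w - F z)
  holomorphic z h h' := by
    obtain ⟨d, hd⟩ := hF.holomorphic z h h'
    exact ⟨T d, tendsto_of_tendsto_of_tendsto_of_le_of_le tendsto_const_nhds hd
      (fun _ => zero_le) fun w => by
        simpa only [map_sub, map_smul] using sumNorm_map_le h₀ h₁ ((w - z)⁻¹ • (F w - F z) - d)⟩
  left_boundary := hF.left_boundary.map h₀
  right_boundary := hF.right_boundary.map h₁
  norm_lt_top := (boundaryNorm_map_le h₀ h₁ F).trans_lt hF.norm_lt_top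

/-- Composition with a contraction of couples preserves admissibility. It is applied to the quotient
map by the constants and to the identity, as a map of couples from VMO to BMO. -/
theorem interpNorm_map_le {T : V →ₗ[ℂ] W} (h₀ : ∀ v, N₀' (T v) ≤ N₀ v)
    (h₁ : ∀ v, N₁' (T v) ≤ N₁ v) (θ : ℝ) (v : V) :
    interpNorm N₀' N₁' θ (T v) ≤ interpNorm N₀ N₁ θ v :=
  le_iInf fun F => le_iInf fun hF => le_iInf fun hv =>
    (interpNorm_le (hF.map h₀ h₁) (by rw [hv])).trans (boundaryNorm_map_le h₀ h₁ F)

end Transfer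

/-! ### Norms modulo constants; series expansions along a dense set -/

theorem modConst_mkQ_le {n : ℕ} (N : Fun n → ℝ≥0∞) (f : Fun n) :
    modConst N ((constants n).mkQ f) ≤ N f :=
  iInf_le_of_le f (iInf_le _ rfl)

theorem le_mul_modConst {n : ℕ} {N : Fun n → ℝ≥0∞} {C : ℝ≥0} (hC : C ≠ 0) {v : FunModConst n}
    {a : ℝ≥0∞} (h : ∀ f, (constants n).mkQ f = v → a ≤ C * N f) : a ≤ C * modConst N v := by
  have h0 : (C : ℝ≥0∞) ≠ 0 := by exact_mod_cast hC
  unfold modConst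
  rw [mul_comm, ← ENNReal.div_le_iff h0 ENNReal.coe_ne_top]
  refine le_iInf fun f => le_iInf fun hf => ?_
  rw [ENNReal.div_le_iff h0 ENNReal.coe_ne_top, mul_comm]
  exact h f hf

/-- Every element of a complete space is a series of multiples of elements of the unit ball of a
dense subspace. -/
theorem exists_series_of_dense {E : Type*} [NormedAddCommGroup E] [NormedSpace ℂ E]
    {D : Set E} (hsmul : ∀ (c : ℂ), ∀ x ∈ D, c • x ∈ D) (hD : Dense D) (f : E) :
    ∃ (h : ℕ → E) (a : ℕ → ℝ), (∀ m, h m ∈ D) ∧ (∀ m, ‖h m‖ ≤ 1) ∧ (∀ m, 0 ≤ a m) ∧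
      HasSum a (4 * ‖f‖) ∧ HasSum (fun m => (a m : ℂ) • h m) f := by
  rcases eq_or_ne f 0 with rfl | hf
  · obtain ⟨x, hx⟩ := hD.nonempty
    have h0 : (0 : E) ∈ D := by simpa using hsmul 0 x hx
    exact ⟨fun _ => 0, fun _ => 0, fun _ => h0, by simp, by simp, by simp, by simp⟩
  have hA : 0 < ‖f‖ := norm_pos_iff.2 hf
  have hpos : ∀ m : ℕ, 0 < 2 * ‖f‖ * (1 / 2) ^ m := fun m => by positivity
  -- The greedy choice: φ g m approximates g with error ‖f‖ / 2^(m+1), and r m is the remainder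
  -- after m subtractions. Elements of D are never added to each other, so D need only be stable
  -- under scalars.
  choose φ hφD hφ using fun (g : E) (m : ℕ) =>
    Metric.dense_iff.1 hD g (‖f‖ * (1 / 2) ^ (m + 1)) (by positivity)
  let r : ℕ → E := fun m => Nat.rec f (fun k g => g - φ g k) m
  have hr : ∀ m, ‖r m‖ ≤ ‖f‖ * (1 / 2) ^ m := by
    rintro (_ | m)
    · simp [r]
    · have := hφD (r m) m
      rw [Metric.mem_ball, dist_comm, dist_eq_norm] at this
      exact this.le
  let v : ℕ → E := fun m => φ (r m) m
  have hv : ∀ m, v m = r m - r (m + 1) := fun m => (sub_sub_cancel _ _).symm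
  have hva : ∀ m, ‖v m‖ ≤ 2 * ‖f‖ * (1 / 2) ^ m := fun m => by
    have h1 : (0 : ℝ) < ‖f‖ * (1 / 2) ^ m := by positivity
    have h2 := norm_sub_le (r m) (r (m + 1))
    have h3 := hr (m + 1)
    rw [pow_succ] at h3
    rw [hv]
    linarith [hr m]
  have hsum : HasSum (fun m : ℕ => 2 * ‖f‖ * (1 / 2) ^ m) (4 * ‖f‖) := by
    have := hasSum_geometric_two.mul_left (2 * ‖f‖)
    rwa [show 2 * ‖f‖ * 2 = 4 * ‖f‖ by ring] at this
  refine ⟨fun m => ((2 * ‖f‖ * (1 / 2) ^ m : ℝ) : ℂ)⁻¹ • v m, fun m => 2 * ‖f‖ * (1 / 2) ^ m,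
    fun m => hsmul _ _ (hφ (r m) m), fun m => ?_, fun m => (hpos m).le, hsum, ?_⟩
  · rw [norm_smul, norm_inv, Complex.norm_real, Real.norm_of_nonneg (hpos m).le,
      inv_mul_le_iff₀ (hpos m), mul_one]
    exact hva m
  · have e : (fun m : ℕ => ((2 * ‖f‖ * (1 / 2) ^ m : ℝ) : ℂ) •
        ((2 * ‖f‖ * (1 / 2) ^ m : ℝ) : ℂ)⁻¹ • v m) = v := by
      ext m
      exact smul_inv_smul₀ (by exact_mod_cast (hpos m).ne') _
    rw [e]
    have hr0 : Tendsto r atTop (𝓝 0) := by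
      refine squeeze_zero_norm hr ?_
      simpa using (tendsto_pow_atTop_nhds_zero_of_lt_one (r := (1 / 2 : ℝ)) (by norm_num)
        (by norm_num)).const_mul ‖f‖
    refine (hasSum_iff_tendsto_nat_of_summable_norm
      (hsum.summable.of_nonneg_of_le (fun _ => norm_nonneg _) hva)).2 ?_
    have e2 : ∀ m, ∑ i ∈ Finset.range m, v i = f - r m := fun m => by
      simp_rw [hv]
      exact Finset.sum_range_sub' r m
    simp_rw [e2]
    simpa using hr0.const_sub f

/-! ### Local integrability and compatibility of the function spaces -/

section Embeddings

variable {n : ℕ}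

/-- A map into the measurable functions is locally bounded if the `L¹` norms on balls are
controlled. -/
def LocallyBounded {B : Type*} [NormedAddCommGroup B] (j : B → Fun n) : Prop :=
  ∀ R : ℝ, ∃ C : ℝ≥0, ∀ b, ∫⁻ x in Metric.ball 0 R, ‖j b x‖ₑ ≤ C * ‖b‖ₑ

theorem eq_zero_of_forall_ball {f : Fun n}
    (h : ∀ R : ℝ, ∫⁻ x in Metric.ball 0 R, ‖f x‖ₑ = 0) : f = 0 := by
  refine AEEqFun.ext_iff.2 ?_
  refine EventuallyEq.trans ?_ AEEqFun.coeFn_zero.symm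
  have h1 : ∀ k : ℕ, ∀ᵐ x ∂volume, x ∈ Metric.ball 0 (k : ℝ) → f x = 0 := by
    intro k
    have := (lintegral_eq_zero_iff' (f.aestronglyMeasurable.enorm.restrict)).1 (h k)
    rw [Filter.EventuallyEq, ae_restrict_iff' measurableSet_ball] at this
    filter_upwards [this] with x hx hxk
    simpa using hx hxk
  filter_upwards [ae_all_iff.2 h1] with x hx
  obtain ⟨k, hk⟩ := exists_nat_gt ‖x‖
  exact hx k (by simpa using hk)

theorem tendsto_enorm_sub {B : Type*} [NormedAddCommGroup B] {v : ℕ → B} {b : B}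
    (hv : Tendsto v atTop (𝓝 b)) : Tendsto (fun k => ‖b - v k‖ₑ) atTop (𝓝 0) := by
  simpa only [edist_comm _ b, edist_eq_enorm_sub b] using tendsto_iff_edist_tendsto_0.1 hv

/-- Convergence in each of the three spaces implies convergence in L¹ of every ball, where limits
are unique. This verifies the hypothesis `hclosed` of `interpNorm_le_of_series`. -/
theorem isClosed_setOf_add_eq {B₀ B₁ Br : Type*} [NormedAddCommGroup B₀] [NormedSpace ℂ B₀]
    [NormedAddCommGroup B₁] [NormedSpace ℂ B₁] [NormedAddCommGroup Br] [NormedSpace ℂ Br]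
    {j₀ : B₀ →ₗ[ℂ] Fun n} {j₁ : B₁ →ₗ[ℂ] Fun n} {jr : Br →ₗ[ℂ] Fun n} (h₀ : LocallyBounded j₀)
    (h₁ : LocallyBounded j₁) (hr : LocallyBounded jr) :
    IsClosed {x : B₀ × B₁ × Br | j₀ x.1 + j₁ x.2.1 = jr x.2.2} := by
  refine isClosed_of_closure_subset fun x hx => ?_
  rw [Set.mem_ofPred_eq, ← sub_eq_zero]
  refine eq_zero_of_forall_ball fun R => ?_
  obtain ⟨C₀, hC₀⟩ := h₀ R
  obtain ⟨C₁, hC₁⟩ := h₁ R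
  obtain ⟨Cr, hCr⟩ := hr R
  obtain ⟨u, hu, hux⟩ := mem_closure_iff_seq_limit.1 hx
  have hb : ∀ k, ∫⁻ y in Metric.ball 0 R, ‖(j₀ x.1 + j₁ x.2.1 - jr x.2.2 : Fun n) y‖ₑ ≤
      C₀ * ‖x.1 - (u k).1‖ₑ + C₁ * ‖x.2.1 - (u k).2.1‖ₑ + Cr * ‖x.2.2 - (u k).2.2‖ₑ := by
    intro k
    have e : j₀ x.1 + j₁ x.2.1 - jr x.2.2 =
        j₀ (x.1 - (u k).1) + j₁ (x.2.1 - (u k).2.1) - jr (x.2.2 - (u k).2.2) := by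
      have := hu k
      rw [Set.mem_ofPred_eq] at this
      simp only [map_sub, ← this]; abel
    rw [e]
    refine le_trans ?_ (add_le_add (add_le_add (hC₀ _) (hC₁ _)) (hCr _))
    rw [← lintegral_add_left' (by fun_prop), ← lintegral_add_left' (by fun_prop)]
    refine lintegral_mono_ae (ae_restrict_of_ae ?_)
    filter_upwards [AEEqFun.coeFn_sub (j₀ (x.1 - (u k).1) + j₁ (x.2.1 - (u k).2.1))
      (jr (x.2.2 - (u k).2.2)), AEEqFun.coeFn_add (j₀ (x.1 - (u k).1)) (j₁ (x.2.1 - (u k).2.1))]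
      with y h1 h2
    rw [h1, Pi.sub_apply, h2, Pi.add_apply]
    exact (enorm_sub_le).trans (add_le_add_left (enorm_add_le _ _) _)
  have hlim : Tendsto (fun k => C₀ * ‖x.1 - (u k).1‖ₑ + C₁ * ‖x.2.1 - (u k).2.1‖ₑ +
      Cr * ‖x.2.2 - (u k).2.2‖ₑ) atTop (𝓝 (C₀ * 0 + C₁ * 0 + Cr * 0)) := by
    have l₀ := ENNReal.Tendsto.const_mul (a := (C₀ : ℝ≥0∞)) (tendsto_enorm_sub
      ((continuous_fst.tendsto x).comp hux)) (Or.inr ENNReal.coe_ne_top)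
    have l₁ := ENNReal.Tendsto.const_mul (a := (C₁ : ℝ≥0∞)) (tendsto_enorm_sub
      (((continuous_fst.comp continuous_snd).tendsto x).comp hux)) (Or.inr ENNReal.coe_ne_top)
    have lr := ENNReal.Tendsto.const_mul (a := (Cr : ℝ≥0∞)) (tendsto_enorm_sub
      (((continuous_snd.comp continuous_snd).tendsto x).comp hux)) (Or.inr ENNReal.coe_ne_top)
    exact (l₀.add l₁).add lr
  simpa using ge_of_tendsto' hlim hb

/-- The inclusion of `L^p` into the measurable functions. -/
noncomputable def lpInclusion (n : ℕ) (p : ℝ≥0∞) :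
    Lp ℂ p (volume : Measure (EuclideanSpace ℝ (Fin n))) →ₗ[ℂ] Fun n where
  toFun f := f
  map_add' _ _ := rfl
  map_smul' _ _ := rfl

theorem lpNorm_lpInclusion {p : ℝ} (f : Lp ℂ (ENNReal.ofReal p) volume) :
    lpNorm n p (lpInclusion n _ f) = ‖f‖ₑ :=
  (Lp.enorm_def f).symm

theorem exists_lintegral_ball_le (p : ℝ≥0∞) (hp : 1 ≤ p) (R : ℝ) : ∃ C : ℝ≥0, ∀ f : Fun n,
    ∫⁻ x in Metric.ball 0 R, ‖f x‖ₑ ≤ C * eLpNorm f p volume := by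
  have hfin : volume (Metric.ball (0 : EuclideanSpace ℝ (Fin n)) R) ≠ ⊤ := measure_ball_lt_top.ne
  refine ⟨(volume (Metric.ball (0 : EuclideanSpace ℝ (Fin n)) R) ^
    (1 / (1 : ℝ≥0∞).toReal - 1 / p.toReal)).toNNReal, fun f => ?_⟩
  have hexp : 0 ≤ 1 / (1 : ℝ≥0∞).toReal - 1 / p.toReal := by
    rcases eq_or_ne p ⊤ with rfl | hpt
    · simp
    · have : 1 ≤ p.toReal := by
        simpa using (ENNReal.toReal_le_toReal ENNReal.one_ne_top hpt).2 hp
      simp only [ENNReal.toReal_one, div_one, one_div, sub_nonneg]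
      exact inv_le_one_of_one_le₀ this
  rw [ENNReal.coe_toNNReal (ENNReal.rpow_ne_top_of_nonneg hexp hfin),
    ← eLpNorm_one_eq_lintegral_enorm]
  have h := eLpNorm_le_eLpNorm_mul_rpow_measure_univ (μ := volume.restrict (Metric.ball 0 R)) hp
    f.aestronglyMeasurable.restrict
  rw [Measure.restrict_apply_univ, mul_comm] at h
  refine h.trans ?_
  gcongr
  exact Measure.restrict_le_self

theorem locallyBounded_lpInclusion (p : ℝ≥0∞) [hp : Fact (1 ≤ p)] :
    LocallyBounded (lpInclusion n p) := fun R => by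
  obtain ⟨C, hC⟩ := exists_lintegral_ball_le (n := n) p hp.out R
  exact ⟨C, fun f => (hC _).trans_eq (by rw [Lp.enorm_def]; rfl)⟩

theorem locallyIntegrable_of_ball {f : Fun n}
    (h : ∀ R : ℝ, ∫⁻ x in Metric.ball 0 R, ‖f x‖ₑ < ⊤) : LocallyIntegrable f volume := by
  refine locallyIntegrable_iff.2 fun k hk => ?_
  obtain ⟨R, hR⟩ := hk.isBounded.subset_ball 0
  refine IntegrableOn.mono_set ?_ hR
  exact ⟨f.aestronglyMeasurable.restrict, h R⟩

theorem locallyIntegrable_of_lpNorm {p : ℝ} (hp : 1 ≤ p) {f : Fun n} (hf : lpNorm n p f < ⊤) :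
    LocallyIntegrable f volume := locallyIntegrable_of_ball fun R => by
  obtain ⟨C, hC⟩ := exists_lintegral_ball_le (n := n) (ENNReal.ofReal p)
    (by rwa [← ENNReal.ofReal_one, ENNReal.ofReal_le_ofReal_iff (by linarith)]) R
  exact (hC f).trans_lt (ENNReal.mul_lt_top ENNReal.coe_lt_top hf)

theorem lintegral_ball_sub_average_le (f : Fun n) (c : EuclideanSpace ℝ (Fin n)) {r : ℝ}
    (hr : 0 < r) : ∫⁻ x in Metric.ball c r, ‖f x - ⨍ y in Metric.ball c r, f y‖ₑ ≤
      volume (Metric.ball c r) * bmoNorm n f := by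
  have h : ⨍⁻ x in Metric.ball c r, ‖f x - ⨍ y in Metric.ball c r, f y‖ₑ ∂volume ≤ bmoNorm n f :=
    le_iSup_of_le (f := fun c => ⨆ (r : ℝ) (_ : 0 < r), ⨍⁻ x in Metric.ball c r,
      ‖f x - ⨍ y in Metric.ball c r, f y‖ₑ ∂volume) c (le_iSup_of_le r (le_iSup_of_le hr le_rfl))
  rw [setLAverage_eq, ENNReal.div_le_iff (Metric.measure_ball_pos _ _ hr).ne'
    measure_ball_lt_top.ne, mul_comm] at h
  exact h

theorem locallyIntegrable_of_bmoNorm {f : Fun n} (hf : bmoNorm n f < ⊤) :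
    LocallyIntegrable f volume := locallyIntegrable_of_ball fun R => by
  rcases le_or_gt R 0 with hR | hR
  · simp [Metric.ball_eq_empty.2 hR]
  have h1 := lintegral_ball_sub_average_le f (0 : EuclideanSpace ℝ (Fin n)) hR
  set m := ⨍ y in Metric.ball (0 : EuclideanSpace ℝ (Fin n)) R, f y
  calc ∫⁻ x in Metric.ball 0 R, ‖f x‖ₑ ≤ ∫⁻ x in Metric.ball 0 R, (‖f x - m‖ₑ + ‖m‖ₑ) :=
        lintegral_mono fun x => by simpa using enorm_add_le (f x - m) m
    _ = (∫⁻ x in Metric.ball 0 R, ‖f x - m‖ₑ) +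
        ‖m‖ₑ * volume (Metric.ball (0 : EuclideanSpace ℝ (Fin n)) R) := by
        rw [lintegral_add_right _ measurable_const, setLIntegral_const]
    _ < ⊤ := ENNReal.add_lt_top.2 ⟨h1.trans_lt (ENNReal.mul_lt_top measure_ball_lt_top hf),
        ENNReal.mul_lt_top enorm_lt_top measure_ball_lt_top⟩

theorem locallyIntegrable_of_h1Norm {b K : ℝ} {f : Fun n} (hf : h1Norm n b K f < ⊤) :
    LocallyIntegrable f volume := by
  by_contra h
  simp [h1Norm, h] at hf

end Embeddings

/-! ### Pairing with bounded functions of bounded support -/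

section Pairing

variable {n : ℕ}

/-- Bounded measurable functions of bounded support. -/
structure IsTest (a : EuclideanSpace ℝ (Fin n) → ℂ) : Prop where
  measurable : Measurable a
  bounded : ∃ M : ℝ, ∀ x, ‖a x‖ ≤ M
  support : ∃ R : ℝ, ∀ x, x ∉ Metric.ball 0 R → a x = 0

theorem IsTest.integrable_mul {a f : EuclideanSpace ℝ (Fin n) → ℂ} (ha : IsTest a)
    (hf : LocallyIntegrable f volume) : Integrable (fun x => f x * a x) := by
  obtain ⟨M, hM⟩ := ha.bounded
  obtain ⟨R, hR⟩ := ha.support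
  have h1 : IntegrableOn f (Metric.ball 0 R) volume :=
    (hf.integrableOn_isCompact (isCompact_closedBall 0 R)).mono_set Metric.ball_subset_closedBall
  have h2 : IntegrableOn (fun x => f x * a x) (Metric.ball 0 R) volume :=
    h1.mul_bdd ha.measurable.aestronglyMeasurable (Eventually.of_forall hM)
  exact (integrableOn_iff_integrable_of_support_subset fun x hx => by
    by_contra hx'
    exact hx (by simp [hR x hx'])).1 h2

theorem IsTest.integrable {a : EuclideanSpace ℝ (Fin n) → ℂ} (ha : IsTest a) : Integrable a := by
  simpa using ha.integrable_mul (f := fun _ => 1) (locallyIntegrable_const _)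

/-- The integral is linear in f on the subspace of locally integrable functions, and is extended
algebraically to all of `Fun n` because the lower bound needs total functionals. The extension is
arbitrary, which is harmless: outside of that subspace the norms in use are infinite. -/
theorem exists_pairing {a : EuclideanSpace ℝ (Fin n) → ℂ} (ha : IsTest a) :
    ∃ ℓ : Fun n →ₗ[ℂ] ℂ, ∀ f : Fun n, LocallyIntegrable f volume → ℓ f = ∫ x, f x * a x := by
  let D : Submodule ℂ (Fun n) :=
    { carrier := {f | LocallyIntegrable f volume}
      add_mem' := fun {f g} hf hg => (hf.add hg).congr (AEEqFun.coeFn_add f g).symm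
      zero_mem' := (locallyIntegrable_zero).congr AEEqFun.coeFn_zero.symm
      smul_mem' := fun c f hf => (hf.smul c).congr (AEEqFun.coeFn_smul c f).symm }
  let L : D →ₗ[ℂ] ℂ :=
    { toFun := fun f => ∫ x, (f : Fun n) x * a x
      map_add' := fun f g => by
        rw [← integral_add (ha.integrable_mul f.2) (ha.integrable_mul g.2)]
        refine integral_congr_ae ?_
        filter_upwards [AEEqFun.coeFn_add (f : Fun n) (g : Fun n)] with x hx
        rw [Submodule.coe_add, hx, Pi.add_apply, add_mul]
      map_smul' := fun c f => by
        rw [RingHom.id_apply, smul_eq_mul, ← integral_const_mul]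
        refine integral_congr_ae ?_
        filter_upwards [AEEqFun.coeFn_smul c (f : Fun n)] with x hx
        rw [Submodule.coe_smul, hx, Pi.smul_apply, smul_eq_mul, mul_assoc] }
  obtain ⟨ℓ, hℓ⟩ := L.exists_extend
  exact ⟨ℓ, fun f hf => LinearMap.congr_fun hℓ (⟨f, hf⟩ : D)⟩

/-- Mean zero makes the pairing vanish on constants, so that it descends to the quotient. -/
theorem exists_pairing_modConst {a : EuclideanSpace ℝ (Fin n) → ℂ} (ha : IsTest a)
    (h0 : ∫ x, a x = 0) : ∃ ℓ : FunModConst n →ₗ[ℂ] ℂ, ∀ f : Fun n, LocallyIntegrable f volume →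
      ℓ ((constants n).mkQ f) = ∫ x, f x * a x := by
  obtain ⟨ℓ, hℓ⟩ := exists_pairing ha
  refine ⟨(constants n).liftQ ℓ ?_, fun f hf => ?_⟩
  · rw [constants, Submodule.span_le, Set.singleton_subset_iff]
    have h1 : ((1 : Fun n) : EuclideanSpace ℝ (Fin n) → ℂ) =ᵐ[volume] fun _ => 1 :=
      AEEqFun.coeFn_one
    show ℓ 1 = 0
    rw [hℓ 1 ((locallyIntegrable_const _).congr h1.symm), ← h0]
    refine integral_congr_ae ?_
    filter_upwards [h1] with x hx
    rw [hx, one_mul]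
  · rw [← hℓ f hf]; rfl

theorem enorm_integral_mul_le_lpNorm {p q : ℝ} (hpq : p.HolderConjugate q) (f : Fun n)
    {a : EuclideanSpace ℝ (Fin n) → ℂ} (ha : Measurable a) :
    ‖∫ x, f x * a x‖ₑ ≤ lpNorm n p f * eLpNorm a (ENNReal.ofReal q) volume := by
  have : (ENNReal.ofReal p).HolderConjugate (ENNReal.ofReal q) := hpq.ennrealOfReal
  refine (enorm_integral_le_lintegral_enorm _).trans ?_
  rw [← eLpNorm_one_eq_lintegral_enorm]
  have h : eLpNorm ((f : EuclideanSpace ℝ (Fin n) → ℂ) • a) 1 volume ≤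
      eLpNorm f (ENNReal.ofReal p) volume * eLpNorm a (ENNReal.ofReal q) volume :=
    eLpNorm_smul_le_mul_eLpNorm ha.aestronglyMeasurable f.aestronglyMeasurable
  exact h

/-- Since a has mean zero, f may be replaced by f minus its mean over the ball that carries a. -/
theorem enorm_integral_mul_le_bmoNorm {f : Fun n} (hf : LocallyIntegrable f volume)
    {a : EuclideanSpace ℝ (Fin n) → ℂ} (ha : IsTest a) (h0 : ∫ x, a x = 0)
    {c : EuclideanSpace ℝ (Fin n)} {r : ℝ} (hr : 0 < r) (hsupp : ∀ x, x ∉ Metric.ball c r → a x = 0)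
    {M : ℝ} (hM : ∀ x, ‖a x‖ ≤ M) :
    ‖∫ x, f x * a x‖ₑ ≤ ENNReal.ofReal M * volume (Metric.ball c r) * bmoNorm n f := by
  set m := ⨍ y in Metric.ball c r, f y
  have e : ∫ x, f x * a x = ∫ x in Metric.ball c r, (f x - m) * a x := by
    rw [setIntegral_eq_integral_of_forall_compl_eq_zero fun x hx => by simp [hsupp x hx]]
    simp_rw [sub_mul]
    rw [integral_sub (ha.integrable_mul hf) (ha.integrable.const_mul m), integral_const_mul, h0]
    simp
  rw [e]
  calc ‖∫ x in Metric.ball c r, (f x - m) * a x‖ₑ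
      ≤ ∫⁻ x in Metric.ball c r, ‖(f x - m) * a x‖ₑ := enorm_integral_le_lintegral_enorm _
    _ ≤ ∫⁻ x in Metric.ball c r, ENNReal.ofReal M * ‖f x - m‖ₑ := lintegral_mono fun x => by
        rw [enorm_mul, mul_comm, ← ofReal_norm (a x)]
        gcongr
        exact hM x
    _ = ENNReal.ofReal M * ∫⁻ x in Metric.ball c r, ‖f x - m‖ₑ :=
        lintegral_const_mul' _ _ ENNReal.ofReal_ne_top
    _ ≤ _ := by
        rw [mul_assoc]
        gcongr
        exact lintegral_ball_sub_average_le f c hr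

end Pairing

/-! ### Decomposition of a continuous function by the size of its values -/

section Tent

/-- The cut-off at height `s * 2 ^ i`. -/
noncomputable def tentCutoff (s : ℝ) (i : ℕ) (t : ℝ) : ℝ := min 1 (max 0 (2 - t / (s * 2 ^ i)))

/-- The partition of unity on the half line subordinate to the dyadic heights `s * 2 ^ i`. -/
noncomputable def tent (s : ℝ) : ℕ → ℝ → ℝ
  | 0, t => tentCutoff s 0 t
  | i + 1, t => tentCutoff s (i + 1) t - tentCutoff s i t

theorem continuous_tentCutoff (s : ℝ) (i : ℕ) : Continuous (tentCutoff s i) := by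
  unfold tentCutoff; fun_prop

theorem continuous_tent (s : ℝ) (i : ℕ) : Continuous (tent s i) := by
  cases i with
  | zero => exact continuous_tentCutoff s 0
  | succ i => exact (continuous_tentCutoff s (i + 1)).sub (continuous_tentCutoff s i)

theorem sum_tent (s : ℝ) (N : ℕ) (t : ℝ) :
    ∑ i ∈ Finset.range (N + 1), tent s i t = tentCutoff s N t := by
  induction N with
  | zero => simp [tent]
  | succ N ih => rw [Finset.sum_range_succ, ih]; simp [tent]

variable {s t : ℝ}

theorem tentCutoff_mono (hs : 0 < s) (ht : 0 ≤ t) (i : ℕ) :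
    tentCutoff s i t ≤ tentCutoff s (i + 1) t := by
  unfold tentCutoff
  gcongr
  · norm_num
  · omega

theorem tent_nonneg (hs : 0 < s) (ht : 0 ≤ t) (i : ℕ) : 0 ≤ tent s i t := by
  cases i with
  | zero => exact le_min zero_le_one (le_max_left _ _)
  | succ i => exact sub_nonneg.2 (tentCutoff_mono hs ht i)

theorem tentCutoff_eq_one (hs : 0 < s) {i : ℕ} (h : t ≤ s * 2 ^ i) : tentCutoff s i t = 1 := by
  have : t / (s * 2 ^ i) ≤ 1 := (div_le_one (by positivity)).2 h
  exact min_eq_left (le_max_of_le_right (by linarith))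

theorem tentCutoff_eq_zero (hs : 0 < s) {i : ℕ} (h : 2 * (s * 2 ^ i) ≤ t) :
    tentCutoff s i t = 0 := by
  have : 2 ≤ t / (s * 2 ^ i) := (le_div_iff₀ (by positivity)).2 h
  unfold tentCutoff
  rw [max_eq_left (by linarith), min_eq_right zero_le_one]

/-- The i-th tent vanishes for t ≥ 2 s 2^i. -/
theorem mul_tent_le (hs : 0 < s) (ht : 0 ≤ t) (i : ℕ) :
    t * tent s i t ≤ 2 * (s * 2 ^ i) * tent s i t := by
  rcases le_or_gt t (2 * (s * 2 ^ i)) with h | h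
  · exact mul_le_mul_of_nonneg_right h (tent_nonneg hs ht i)
  · have : tent s i t = 0 := by
      cases i with
      | zero => exact tentCutoff_eq_zero hs h.le
      | succ i =>
        have h1 := tentCutoff_eq_zero hs h.le
        have h2 := tentCutoff_eq_zero (i := i) (t := t) hs (by
          refine le_trans ?_ h.le
          rw [pow_succ]
          have : 0 < s * 2 ^ i := by positivity
          nlinarith)
        simp [tent, h1, h2]
    simp [this]

/-- A tent of positive index vanishes for t ≤ s 2^(i-1), so its height is at most 2t where it lives.
The tent of index 0 has no lower cutoff, and its height s accounts for the term s^τ. -/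
theorem rpow_mul_tent_le (hs : 0 < s) (ht : 0 ≤ t) {τ : ℝ} (hτ : 0 ≤ τ) (i : ℕ) :
    (s * 2 ^ i) ^ τ * tent s i t ≤ ((2 * t) ^ τ + s ^ τ) * tent s i t := by
  have h0 := tent_nonneg hs ht i
  cases i with
  | zero =>
    refine mul_le_mul_of_nonneg_right ?_ h0
    simp only [pow_zero, mul_one]
    exact le_add_of_nonneg_left (by positivity)
  | succ i =>
    rcases le_or_gt t (s * 2 ^ i) with h | h
    · have h1 := tentCutoff_eq_one hs h
      have h2 := tentCutoff_eq_one (i := i + 1) hs (h.trans (by gcongr <;> simp))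
      simp [tent, h1, h2]
    · refine mul_le_mul_of_nonneg_right ?_ h0
      refine le_add_of_le_of_nonneg (Real.rpow_le_rpow (by positivity) ?_ hτ) (by positivity)
      rw [pow_succ]; linarith

variable {n : ℕ}

/-- The pieces are h times the tents of |h| at the heights t_i = s 2^i, with λ_i = t_i^(-1/(1-θ)).
Then λ_i^(1-θ) = 1/t_i flattens every piece to size at most 2, while λ_i^(-θ) = t_i^τ with τ =
θ/(1-θ) produces 2^τ |h|^(1+τ) + s^τ |h|, whose first term lies in L^p because p (1+τ) = r. Tents
instead of sharp truncations keep the pieces continuous with compact support. -/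
theorem exists_tent_decomposition {p r θ : ℝ} (hp : 1 < p) (hθ₀ : 0 < θ) (hθ₁ : θ < 1)
    (hr : r = p / (1 - θ)) {h : EuclideanSpace ℝ (Fin n) → ℂ} (hc : Continuous h)
    (hs : HasCompactSupport h) (hn : eLpNorm h (ENNReal.ofReal r) volume ≤ 1) :
    ∃ (N : ℕ) (lam : ℕ → ℝ) (a : ℕ → EuclideanSpace ℝ (Fin n) → ℂ), (∀ i, 0 < lam i) ∧
      (∀ i, Continuous (a i)) ∧ (∀ i, HasCompactSupport (a i)) ∧
      (∀ x, h x = ∑ i ∈ Finset.range N, a i x) ∧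
      (∀ ε : ℕ → ℂ, (∀ i, ‖ε i‖ ≤ 1) → ∀ x,
        ‖∑ i ∈ Finset.range N, (ε i * (lam i ^ (1 - θ) : ℝ)) * a i x‖ ≤ 2) ∧
      ∀ ε : ℕ → ℂ, (∀ i, ‖ε i‖ ≤ 1) →
        eLpNorm (fun x => ∑ i ∈ Finset.range N, (ε i * (lam i ^ (-θ) : ℝ)) * a i x)
          (ENNReal.ofReal p) volume ≤ ENNReal.ofReal (2 ^ (θ / (1 - θ)) + 1) := by
  set τ := θ / (1 - θ) with hτ
  have hθ' : 0 < 1 - θ := by linarith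
  have hτ0 : 0 < τ := by positivity
  have hτ1 : 1 + τ = 1 / (1 - θ) := by rw [hτ]; field_simp; ring
  have hmem : MemLp h (ENNReal.ofReal p) volume := hc.memLp_of_hasCompactSupport hs
  -- The lowest height s depends on h and is so small that the contribution s^τ ‖h‖_p of the bottom
  -- layer is at most 1; the final constants do not depend on it.
  obtain ⟨s, hs0, hsn⟩ : ∃ s : ℝ, 0 < s ∧
      ENNReal.ofReal (s ^ τ) * eLpNorm h (ENNReal.ofReal p) volume ≤ 1 := by
    set L := (eLpNorm h (ENNReal.ofReal p) volume).toReal with hL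
    have hL0 : 0 ≤ L := ENNReal.toReal_nonneg
    refine ⟨(1 / (L + 1)) ^ τ⁻¹, by positivity, ?_⟩
    rw [← Real.rpow_mul (by positivity), inv_mul_cancel₀ hτ0.ne', Real.rpow_one,
      ← ENNReal.ofReal_toReal hmem.eLpNorm_ne_top, ← hL, ← ENNReal.ofReal_mul (by positivity),
      ← ENNReal.ofReal_one]
    refine ENNReal.ofReal_le_ofReal ?_
    rw [div_mul_eq_mul_div, one_mul, div_le_one (by positivity)]
    linarith
  obtain ⟨T, hT⟩ := hc.bounded_above_of_compact_support hs
  -- The N-th cutoff is identically 1 on the range of |h|, so finitely many tents sum to 1.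
  obtain ⟨N, hN⟩ : ∃ N : ℕ, T ≤ s * 2 ^ N := by
    obtain ⟨N, hN⟩ := pow_unbounded_of_one_lt (T / s) (one_lt_two (α := ℝ))
    exact ⟨N, by rw [mul_comm, ← div_le_iff₀ hs0]; exact hN.le⟩
  have hsi : ∀ i : ℕ, 0 < s * 2 ^ i := fun i => by positivity
  have hsum : ∀ x, ∑ i ∈ Finset.range (N + 1), tent s i ‖h x‖ = 1 := fun x => by
    rw [sum_tent, tentCutoff_eq_one hs0 ((hT x).trans hN)]
  have hlam1 : ∀ i : ℕ, ((s * 2 ^ i) ^ (-(1 / (1 - θ)))) ^ (1 - θ) = (s * 2 ^ i)⁻¹ := fun i => by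
    rw [← Real.rpow_mul (hsi i).le, ← Real.rpow_neg_one]
    congr 1; field_simp
  have hlam0 : ∀ i : ℕ, ((s * 2 ^ i) ^ (-(1 / (1 - θ)))) ^ (-θ) = (s * 2 ^ i) ^ τ := fun i => by
    rw [← Real.rpow_mul (hsi i).le]
    congr 1; rw [hτ]; field_simp
  refine ⟨N + 1, fun i => (s * 2 ^ i) ^ (-(1 / (1 - θ))), fun i x => h x * tent s i ‖h x‖,
    fun i => by have := hsi i; positivity, fun i => ?_, fun i => hs.mul_right, fun x => ?_,
    fun ε hε x => ?_, fun ε hε => ?_⟩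
  · exact hc.mul (Complex.continuous_ofReal.comp ((continuous_tent s i).comp hc.norm))
  · rw [← Finset.mul_sum, ← Complex.ofReal_sum, hsum]; simp
  · refine (norm_sum_le _ _).trans ?_
    have : ∀ i ∈ Finset.range (N + 1), ‖(ε i * (((s * 2 ^ i) ^ (-(1 / (1 - θ)))) ^ (1 - θ) : ℝ)) *
        (h x * tent s i ‖h x‖)‖ ≤ 2 * tent s i ‖h x‖ := by
      intro i _
      have h0 := tent_nonneg hs0 (norm_nonneg (h x)) i
      have h1 := mul_tent_le hs0 (norm_nonneg (h x)) i
      rw [hlam1, norm_mul, norm_mul, norm_mul, Complex.norm_real, Complex.norm_real,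
        Real.norm_of_nonneg h0, Real.norm_of_nonneg (inv_nonneg.2 (hsi i).le)]
      calc ‖ε i‖ * (s * 2 ^ i)⁻¹ * (‖h x‖ * tent s i ‖h x‖)
          ≤ 1 * (s * 2 ^ i)⁻¹ * (2 * (s * 2 ^ i) * tent s i ‖h x‖) := by
            have := hsi i
            gcongr
            exact hε i
        _ = 2 * tent s i ‖h x‖ := by have := (hsi i).ne'; field_simp
    refine (Finset.sum_le_sum this).trans ?_
    rw [← Finset.mul_sum, hsum, mul_one]
  · have hpt : ∀ x, ‖∑ i ∈ Finset.range (N + 1),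
        (ε i * (((s * 2 ^ i) ^ (-(1 / (1 - θ)))) ^ (-θ) : ℝ)) * (h x * tent s i ‖h x‖)‖ ≤
        2 ^ τ * ‖h x‖ ^ (1 + τ) + s ^ τ * ‖h x‖ := by
      intro x
      refine (norm_sum_le _ _).trans ?_
      have : ∀ i ∈ Finset.range (N + 1), ‖(ε i * (((s * 2 ^ i) ^ (-(1 / (1 - θ)))) ^ (-θ) : ℝ)) *
          (h x * tent s i ‖h x‖)‖ ≤ (((2 * ‖h x‖) ^ τ + s ^ τ) * ‖h x‖) * tent s i ‖h x‖ := by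
        intro i _
        have h0 := tent_nonneg hs0 (norm_nonneg (h x)) i
        have h1 := rpow_mul_tent_le hs0 (norm_nonneg (h x)) hτ0.le i
        have h2 := Real.rpow_nonneg (hsi i).le τ
        rw [hlam0, norm_mul, norm_mul, norm_mul, Complex.norm_real, Complex.norm_real,
          Real.norm_of_nonneg h0, Real.norm_of_nonneg h2]
        calc ‖ε i‖ * (s * 2 ^ i) ^ τ * (‖h x‖ * tent s i ‖h x‖)
            ≤ 1 * (s * 2 ^ i) ^ τ * (‖h x‖ * tent s i ‖h x‖) := by
              gcongr
              exact hε i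
          _ = ‖h x‖ * ((s * 2 ^ i) ^ τ * tent s i ‖h x‖) := by ring
          _ ≤ ‖h x‖ * (((2 * ‖h x‖) ^ τ + s ^ τ) * tent s i ‖h x‖) := by gcongr
          _ = _ := by ring
      refine (Finset.sum_le_sum this).trans (le_of_eq ?_)
      rw [← Finset.mul_sum, hsum, mul_one, Real.mul_rpow zero_le_two (norm_nonneg _),
        Real.rpow_add' (norm_nonneg _) (by positivity), Real.rpow_one]
      ring
    refine (eLpNorm_mono_real hpt).trans ?_
    have hp1 : 1 ≤ ENNReal.ofReal p := by
      rw [← ENNReal.ofReal_one]; exact ENNReal.ofReal_le_ofReal hp.le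
    refine (eLpNorm_add_le (f := fun x => 2 ^ τ * ‖h x‖ ^ (1 + τ)) (g := fun x => s ^ τ * ‖h x‖)
      ?_ ?_ hp1).trans ?_
    · exact (Continuous.aestronglyMeasurable (by fun_prop (disch := positivity)))
    · exact (Continuous.aestronglyMeasurable (by fun_prop))
    rw [ENNReal.ofReal_add (by positivity) zero_le_one, ENNReal.ofReal_one]
    refine add_le_add ?_ ?_
    · have e := eLpNorm_const_smul ((2 : ℝ) ^ τ) (fun x => ‖h x‖ ^ (1 + τ)) (ENNReal.ofReal p)
        (volume : Measure (EuclideanSpace ℝ (Fin n)))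
      have e2 : eLpNorm (fun x => ‖h x‖ ^ (1 + τ)) (ENNReal.ofReal p) volume ≤ 1 := by
        rw [eLpNorm_norm_rpow _ (by positivity), ← ENNReal.ofReal_mul (by positivity), hτ1,
          ← mul_div_assoc, mul_one, ← hr]
        exact ENNReal.rpow_le_one hn (by positivity)
      refine (le_of_eq e).trans ?_
      rw [← ofReal_norm, Real.norm_of_nonneg (by positivity)]
      exact mul_le_of_le_one_right' e2
    · have e := eLpNorm_const_smul (s ^ τ) (fun x => ‖h x‖) (ENNReal.ofReal p)
        (volume : Measure (EuclideanSpace ℝ (Fin n)))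
      refine (le_of_eq e).trans ?_
      rw [← ofReal_norm, Real.norm_of_nonneg (by positivity), eLpNorm_norm]
      exact hsn

end Tent

/-! ### The upper bound for VMO -/

open scoped ZeroAtInfty

section VMO

variable {n : ℕ}

theorem bmoNorm_le_of_ae_bound {f : Fun n} {M : ℝ} (h : ∀ᵐ x, ‖f x‖ ≤ M) :
    bmoNorm n f ≤ ENNReal.ofReal (2 * M) := by
  refine iSup_le fun c => iSup_le fun r => iSup_le fun hr => ?_
  have hb0 := (Metric.measure_ball_pos (volume : Measure (EuclideanSpace ℝ (Fin n))) c hr).ne'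
  have hbt : volume (Metric.ball c r) ≠ ⊤ := measure_ball_lt_top.ne
  have hm : ‖⨍ y in Metric.ball c r, f y‖ ≤ M := by
    rw [setAverage_eq, norm_smul, norm_inv, Real.norm_of_nonneg measureReal_nonneg,
      inv_mul_le_iff₀ (show 0 < volume.real (Metric.ball c r) from ENNReal.toReal_pos hb0 hbt),
      mul_comm]
    exact norm_setIntegral_le_of_norm_le_const_ae hbt.lt_top (ae_restrict_of_ae h)
  rw [setLAverage_eq, ENNReal.div_le_iff hb0 hbt, ← setLIntegral_const]
  refine lintegral_mono_ae (ae_restrict_of_ae (h.mono fun x hx => ?_))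
  rw [← ofReal_norm]
  refine ENNReal.ofReal_le_ofReal ((norm_sub_le _ _).trans (by linarith))

/-- The inclusion of the continuous functions vanishing at infinity into the measurable
functions. -/
noncomputable def zeroAtInftyInclusion (n : ℕ) : C₀(EuclideanSpace ℝ (Fin n), ℂ) →ₗ[ℂ] Fun n where
  toFun u := u.toContinuousMap.toAEEqFun volume
  map_add' _ _ := rfl
  map_smul' _ _ := rfl

theorem coeFn_zeroAtInftyInclusion (u : C₀(EuclideanSpace ℝ (Fin n), ℂ)) :
    zeroAtInftyInclusion n u =ᵐ[volume] u :=
  ContinuousMap.coeFn_toAEEqFun _ _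

theorem norm_apply_le_norm_zeroAtInfty (u : C₀(EuclideanSpace ℝ (Fin n), ℂ))
    (x : EuclideanSpace ℝ (Fin n)) : ‖u x‖ ≤ ‖u‖ := by
  rw [← ZeroAtInftyContinuousMap.norm_toBCF_eq_norm]
  exact u.toBCF.norm_coe_le_norm x

theorem locallyBounded_zeroAtInftyInclusion : LocallyBounded (zeroAtInftyInclusion n) := fun R => by
  refine ⟨(volume (Metric.ball (0 : EuclideanSpace ℝ (Fin n)) R)).toNNReal, fun u => ?_⟩
  rw [ENNReal.coe_toNNReal measure_ball_lt_top.ne, mul_comm, ← setLIntegral_const]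
  refine lintegral_mono_ae (ae_restrict_of_ae ?_)
  filter_upwards [coeFn_zeroAtInftyInclusion u] with x hx
  rw [hx, ← ofReal_norm, ← ofReal_norm]
  exact ENNReal.ofReal_le_ofReal (norm_apply_le_norm_zeroAtInfty u x)

/-- Soft thresholding shrinks |u| by δ and gives zero where |u| ≤ δ. The maximum in the denominator
avoids division by zero. -/
theorem exists_compactlySupported_norm_sub_le (u : C₀(EuclideanSpace ℝ (Fin n), ℂ)) {δ : ℝ}
    (hδ : 0 < δ) : ∃ g : C_c(EuclideanSpace ℝ (Fin n), ℂ), ∀ x, ‖u x - g x‖ ≤ δ := by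
  have hm : ∀ x, 0 < max ‖u x‖ δ := fun x => lt_max_of_lt_right hδ
  have hcont : Continuous fun x => u x * (((max ‖u x‖ δ - δ) / max ‖u x‖ δ : ℝ) : ℂ) := by
    refine u.continuous.mul (Complex.continuous_ofReal.comp ?_)
    exact Continuous.div (by fun_prop) (by fun_prop) fun x => (hm x).ne'
  have hev : ∀ᶠ x in cocompact _, ‖u x‖ < δ := by
    have := u.zero_at_infty'.norm
    rw [norm_zero] at this
    exact this.eventually (gt_mem_nhds hδ)
  obtain ⟨K, hK, hKs⟩ := mem_cocompact.1 hev
  have hsupp : HasCompactSupport fun x =>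
      u x * (((max ‖u x‖ δ - δ) / max ‖u x‖ δ : ℝ) : ℂ) := HasCompactSupport.intro hK fun x hx => by
    have : ‖u x‖ < δ := hKs hx
    rw [max_eq_right this.le]; simp
  refine ⟨⟨⟨_, hcont⟩, hsupp⟩, fun x => ?_⟩
  show ‖u x - u x * (((max ‖u x‖ δ - δ) / max ‖u x‖ δ : ℝ) : ℂ)‖ ≤ δ
  have e : u x - u x * (((max ‖u x‖ δ - δ) / max ‖u x‖ δ : ℝ) : ℂ) =
      u x * ((δ / max ‖u x‖ δ : ℝ) : ℂ) := by
    have : (max ‖u x‖ δ - δ) / max ‖u x‖ δ = 1 - δ / max ‖u x‖ δ := by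
      rw [sub_div, div_self (hm x).ne']
    rw [this]; push_cast; ring
  rw [e, norm_mul, Complex.norm_real, Real.norm_of_nonneg (div_nonneg hδ.le (hm x).le),
    ← mul_div_assoc, div_le_iff₀ (hm x), mul_comm]
  gcongr
  exact le_max_left _ _

/-- C₀ serves as a complete space mapped boundedly into VMO: its elements are uniform limits, hence
BMO limits, of functions in C_c. -/
theorem vmoNorm_zeroAtInftyInclusion_le (u : C₀(EuclideanSpace ℝ (Fin n), ℂ)) :
    vmoNorm n (zeroAtInftyInclusion n u) ≤ (2 : ℝ≥0) * ‖u‖ₑ := by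
  have hcl : ∀ ε : ℝ≥0∞, 0 < ε → ∃ g : C_c(EuclideanSpace ℝ (Fin n), ℂ),
      bmoNorm n (zeroAtInftyInclusion n u - g.toContinuousMap.toAEEqFun volume) < ε := by
    intro ε hε
    obtain ⟨δ, hδ, hδε⟩ : ∃ δ : ℝ, 0 < δ ∧ ENNReal.ofReal (2 * δ) < ε := by
      obtain ⟨δ, hδ0, hδ⟩ := ENNReal.lt_iff_exists_nnreal_btwn.1 hε
      refine ⟨δ / 2, by have : 0 < δ := by exact_mod_cast hδ0
                        positivity, ?_⟩
      rwa [mul_div_cancel₀ _ two_ne_zero, ENNReal.ofReal_coe_nnreal]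
    obtain ⟨g, hg⟩ := exists_compactlySupported_norm_sub_le u hδ
    refine ⟨g, (bmoNorm_le_of_ae_bound ?_).trans_lt hδε⟩
    filter_upwards [AEEqFun.coeFn_sub (zeroAtInftyInclusion n u)
      (g.toContinuousMap.toAEEqFun volume), coeFn_zeroAtInftyInclusion u,
      ContinuousMap.coeFn_toAEEqFun volume g.toContinuousMap] with x h1 h2 h3
    rw [h1, Pi.sub_apply, h2, h3]
    exact hg x
  unfold vmoNorm
  rw [iInf_pos hcl]
  refine (bmoNorm_le_of_ae_bound (M := ‖u‖) ?_).trans_eq ?_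
  · filter_upwards [coeFn_zeroAtInftyInclusion u] with x hx
    rw [hx]
    exact norm_apply_le_norm_zeroAtInfty u x
  · rw [ENNReal.ofReal_mul zero_le_two, ofReal_norm]; simp

/-- The subspace of `L^p` of the classes of continuous functions with compact support. -/
noncomputable def compactlySupportedLp (n : ℕ) (p : ℝ≥0∞) :
    Submodule ℂ (Lp ℂ p (volume : Measure (EuclideanSpace ℝ (Fin n)))) where
  carrier := {f | ∃ g : EuclideanSpace ℝ (Fin n) → ℂ, f =ᵐ[volume] g ∧ HasCompactSupport g ∧
    Continuous g}
  add_mem' := by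
    rintro f f' ⟨g, h1, h2, h3⟩ ⟨g', h1', h2', h3'⟩
    exact ⟨g + g', (Lp.coeFn_add f f').trans (h1.add h1'), h2.add h2', h3.add h3'⟩
  zero_mem' := ⟨0, Lp.coeFn_zero _ _ _, HasCompactSupport.zero, continuous_zero⟩
  smul_mem' := by
    rintro c f ⟨g, h1, h2, h3⟩
    refine ⟨c • g, (Lp.coeFn_smul c f).trans (h1.const_smul c), ?_, h3.const_smul c⟩
    exact h2.comp_left (g := fun z : ℂ => c • z) (smul_zero c)

theorem dense_compactlySupportedLp {p : ℝ≥0∞} (hp : p ≠ ⊤) [Fact (1 ≤ p)] :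
    Dense (compactlySupportedLp n p : Set (Lp ℂ p (volume : Measure (EuclideanSpace ℝ (Fin n))))) :=
  (Lp.dense_hasCompactSupport_contDiff (F := ℂ) hp).mono (by
    rintro f ⟨g, h1, h2, h3⟩
    exact ⟨g, h1, h2, h3.continuous⟩)

theorem coeFn_sum_smul_toLp {ι : Type*} {p : ℝ≥0∞} (I : Finset ι) (c : ι → ℂ)
    {b : ι → EuclideanSpace ℝ (Fin n) → ℂ} (hb : ∀ i, MemLp (b i) p volume) :
    ((∑ i ∈ I, c i • (hb i).toLp : Lp ℂ p volume) : EuclideanSpace ℝ (Fin n) → ℂ) =ᵐ[volume]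
      fun z => ∑ i ∈ I, c i * b i z := by
  classical
  induction I using Finset.induction_on with
  | empty => simpa using! Lp.coeFn_zero ℂ p (volume : Measure (EuclideanSpace ℝ (Fin n)))
  | insert i I hi ih =>
    rw [Finset.sum_insert hi]
    filter_upwards [Lp.coeFn_add (c i • (hb i).toLp) (∑ i ∈ I, c i • (hb i).toLp), ih,
      Lp.coeFn_smul (c i) (hb i).toLp, (hb i).coeFn_toLp] with z h1 h2 h3 h4
    rw [h1, Pi.add_apply, h2, h3, Pi.smul_apply, h4, Finset.sum_insert hi, smul_eq_mul]

theorem zeroAtInfty_sum_smul_apply {ι : Type*} (I : Finset ι) (c : ι → ℂ)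
    (u : ι → C₀(EuclideanSpace ℝ (Fin n), ℂ)) (z : EuclideanSpace ℝ (Fin n)) :
    (∑ i ∈ I, c i • u i) z = ∑ i ∈ I, c i * u i z := by
  classical
  induction I using Finset.induction_on with
  | empty => simp
  | insert i I hi ih =>
    rw [Finset.sum_insert hi, Finset.sum_insert hi, ZeroAtInftyContinuousMap.add_apply, ih]
    rfl

/-- A function in L^r is a series of scalar multiples of functions in C_c of norm at most one. Each
of these has its own tent decomposition and its own λ_i, but the constants are common, so the series
of bounds converges. -/
theorem interpNorm_vmo_le {p r θ : ℝ} (hp : 1 < p) (hθ₀ : 0 < θ) (hθ₁ : θ < 1)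
    (hr : r = p / (1 - θ)) : ∃ C : ℝ≥0, ∀ f : Fun n,
      interpNorm (lpNorm n p) (vmoNorm n) θ f ≤ C * lpNorm n r f := by
  have hθ' : 0 < 1 - θ := by linarith
  have hr1 : 1 < r := by
    rw [hr, lt_div_iff₀ hθ']; linarith
  have : Fact (1 ≤ ENNReal.ofReal p) := ⟨by
    rw [← ENNReal.ofReal_one]; exact ENNReal.ofReal_le_ofReal hp.le⟩
  have : Fact (1 ≤ ENNReal.ofReal r) := ⟨by
    rw [← ENNReal.ofReal_one]; exact ENNReal.ofReal_le_ofReal hr1.le⟩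
  set κ : ℝ := 2 ^ (θ / (1 - θ)) + 1 + 2 with hκ
  have hκ0 : 0 < κ := by positivity
  refine ⟨2 * Real.toNNReal (3 * (κ * 4)), fun f => ?_⟩
  have hC0 : ((2 * Real.toNNReal (3 * (κ * 4)) : ℝ≥0) : ℝ≥0∞) ≠ 0 := by
    have : 0 < Real.toNNReal (3 * (κ * 4)) := Real.toNNReal_pos.2 (by positivity)
    exact_mod_cast (by positivity : (0 : ℝ≥0) < 2 * Real.toNNReal (3 * (κ * 4))).ne'
  rcases eq_top_or_lt_top (lpNorm n r f) with hf | hf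
  · rw [hf, ENNReal.mul_top hC0]; exact le_top
  set f' : Lp ℂ (ENNReal.ofReal r) (volume : Measure (EuclideanSpace ℝ (Fin n))) := ⟨f, hf⟩ with hf'
  obtain ⟨h, a, hD, hn, ha, haS, hhS⟩ := exists_series_of_dense
    (fun c x hx => Submodule.smul_mem _ c hx)
    (dense_compactlySupportedLp (n := n) (ENNReal.ofReal_ne_top (r := r))) f'
  choose g hg hgs hgc using hD
  have hgn : ∀ m, eLpNorm (g m) (ENNReal.ofReal r) volume ≤ 1 := fun m => by
    rw [← eLpNorm_congr_ae (hg m), ← Lp.enorm_def, ← ofReal_norm, ← ENNReal.ofReal_one]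
    exact ENNReal.ofReal_le_ofReal (hn m)
  choose N lam b hlam hbc hbs hbsum hb1 hb0 using fun m =>
    exists_tent_decomposition hp hθ₀ hθ₁ hr (hgc m) (hgs m) (hgn m)
  have hbm : ∀ m i, MemLp (b m i) (ENNReal.ofReal p) volume := fun m i =>
    (hbc m i).memLp_of_hasCompactSupport (hbs m i)
  let x : ℕ → ℕ → Lp ℂ (ENNReal.ofReal p) (volume : Measure (EuclideanSpace ℝ (Fin n))) :=
    fun m i => (a m : ℂ) • (hbm m i).toLp
  let y : ℕ → ℕ → C₀(EuclideanSpace ℝ (Fin n), ℂ) :=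
    fun m i => (a m : ℂ) • ⟨⟨b m i, hbc m i⟩, (hbs m i).is_zero_at_infty⟩
  have key := interpNorm_le_of_series (N₀ := lpNorm n p) (N₁ := vmoNorm n)
    (lpInclusion n (ENNReal.ofReal p)) (zeroAtInftyInclusion n) (lpInclusion n (ENNReal.ofReal r))
    (c := 2) (fun b => by
      rw [lpNorm_lpInclusion]
      exact le_mul_of_one_le_left zero_le (by norm_num)) vmoNorm_zeroAtInftyInclusion_le
    (isClosed_setOf_add_eq (locallyBounded_lpInclusion _) locallyBounded_zeroAtInftyInclusion
      (locallyBounded_lpInclusion _)) hθ₀ hθ₁ (fun m => Finset.range (N m)) lam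
    (fun m i _ => hlam m i) x y ?_ (fun m => a m * κ) (haS.summable.mul_right κ) ?_ ?_
    (fun m => (a m : ℂ) • h m) f' hhS ?_
  · have e : ∑' m, a m * κ = κ * 4 * ‖f'‖ := by
      rw [tsum_mul_right, haS.tsum_eq]; ring
    have e2 : lpNorm n r f = ‖f'‖ₑ := (Lp.enorm_def f').symm
    refine key.trans_eq ?_
    rw [e, e2, ← mul_assoc, ENNReal.ofReal_mul (by positivity), ofReal_norm]
    push_cast
    rw [mul_assoc]; rfl
  · intro m i _
    simp only [x, y, map_smul]
    exact congrArg _ <| AEEqFun.ext ((hbm m i).coeFn_toLp.trans (coeFn_zeroAtInftyInclusion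
      ⟨⟨b m i, hbc m i⟩, (hbs m i).is_zero_at_infty⟩).symm)
  · intro m ε hε
    have e : ∑ i ∈ Finset.range (N m), (ε i * (lam m i ^ (-θ) : ℝ)) • x m i = (a m : ℂ) •
        ∑ i ∈ Finset.range (N m), (ε i * (lam m i ^ (-θ) : ℝ)) • (hbm m i).toLp := by
      simp only [x, Finset.smul_sum]
      exact Finset.sum_congr rfl fun i _ => smul_comm _ _ _
    rw [e, norm_smul, Complex.norm_real, Real.norm_of_nonneg (ha m)]
    refine mul_le_mul_of_nonneg_left ?_ (ha m)
    rw [Lp.norm_def, eLpNorm_congr_ae (coeFn_sum_smul_toLp _ _ (hbm m))]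
    refine (ENNReal.toReal_mono ENNReal.ofReal_ne_top (hb0 m ε hε)).trans ?_
    rw [ENNReal.toReal_ofReal (by positivity)]
    linarith
  · intro m ε hε
    have e : ∑ i ∈ Finset.range (N m), (ε i * (lam m i ^ (1 - θ) : ℝ)) • y m i = (a m : ℂ) •
        ∑ i ∈ Finset.range (N m), (ε i * (lam m i ^ (1 - θ) : ℝ)) •
          (⟨⟨b m i, hbc m i⟩, (hbs m i).is_zero_at_infty⟩ : C₀(EuclideanSpace ℝ (Fin n), ℂ)) := by
      simp only [y, Finset.smul_sum]
      exact Finset.sum_congr rfl fun i _ => smul_comm _ _ _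
    rw [e, norm_smul, Complex.norm_real, Real.norm_of_nonneg (ha m)]
    refine mul_le_mul_of_nonneg_left ?_ (ha m)
    rw [← ZeroAtInftyContinuousMap.norm_toBCF_eq_norm]
    refine (BoundedContinuousFunction.norm_le hκ0.le).2 fun z => ?_
    refine le_trans (le_of_eq ?_) ((hb1 m ε hε z).trans (by
      have : 0 ≤ (2 : ℝ) ^ (θ / (1 - θ)) := by positivity
      linarith))
    congr 1
    exact zeroAtInfty_sum_smul_apply _ _ _ z
  · intro m
    have e : ∑ i ∈ Finset.range (N m), x m i = (a m : ℂ) •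
        ∑ i ∈ Finset.range (N m), (1 : ℂ) • (hbm m i).toLp := by
      simp only [x, Finset.smul_sum, one_smul]
    rw [e, map_smul, map_smul]
    congr 1
    refine AEEqFun.ext ((hg m).trans ?_)
    refine EventuallyEq.trans ?_ (coeFn_sum_smul_toLp _ _ (hbm m)).symm
    exact Eventually.of_forall fun z => by simp [hbsum m z]

end VMO

/-! ### Atomic decomposition over a finite tree of sets -/

section Laminar

variable {X : Type*} [MeasurableSpace X] {μ : Measure X} {𝒟 : Finset (Set X)} {Q₀ : Set X} {D : ℝ}

/-- A finite laminar family of sets with a largest element, in which every other set is contained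
in a strictly larger one of comparable measure. -/
structure IsLaminarTree (μ : Measure X) (𝒟 : Finset (Set X)) (Q₀ : Set X) (D : ℝ) : Prop where
  measurableSet : ∀ Q ∈ 𝒟, MeasurableSet Q
  measure_ne_top : ∀ Q ∈ 𝒟, μ Q ≠ ⊤
  measure_pos : ∀ Q ∈ 𝒟, 0 < μ.real Q
  top_mem : Q₀ ∈ 𝒟
  subset_top : ∀ Q ∈ 𝒟, Q ⊆ Q₀
  laminar : ∀ P ∈ 𝒟, ∀ Q ∈ 𝒟, P ⊆ Q ∨ Q ⊆ P ∨ Disjoint P Q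
  parent : ∀ Q ∈ 𝒟, Q ≠ Q₀ → ∃ P ∈ 𝒟, Q ⊂ P ∧ μ.real P ≤ D * μ.real Q
  one_le : 1 ≤ D

/-- A bounded measurable function supported in `Q₀`, every point of which lies in a set of the
family on which the function is constant. -/
structure IsTreeStep (𝒟 : Finset (Set X)) (Q₀ : Set X) (g : X → ℂ) : Prop where
  measurable : Measurable g
  bounded : ∃ M : ℝ, ∀ x, ‖g x‖ ≤ M
  support : ∀ x, x ∉ Q₀ → g x = 0
  leaf : ∀ x ∈ Q₀, ∃ Q ∈ 𝒟, x ∈ Q ∧ ∀ y ∈ Q, g y = g x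

open Classical in
/-- The sets of the family on which the mean of `|g|` exceeds `2 ^ k`. -/
noncomputable def stopSets (μ : Measure X) (𝒟 : Finset (Set X)) (g : X → ℂ) (k : ℤ) :
    Finset (Set X) := 𝒟.filter fun Q => (2 : ℝ) ^ k * μ.real Q < ∫ x in Q, ‖g x‖ ∂μ

open Classical in
/-- The maximal sets of the family on which the mean of `|g|` exceeds `2 ^ k`. -/
noncomputable def maxStopSets (μ : Measure X) (𝒟 : Finset (Set X)) (g : X → ℂ) (k : ℤ) :
    Finset (Set X) := (stopSets μ 𝒟 g k).filter fun Q => ∀ P ∈ stopSets μ 𝒟 g k, Q ⊆ P → P = Q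

/-- The restriction of `g` to `Q`, minus its mean over `Q`. -/
noncomputable def oscOn (μ : Measure X) (g : X → ℂ) (Q : Set X) : X → ℂ :=
  Q.indicator fun x => g x - ⨍ y in Q, g y ∂μ

open Classical in
/-- The part of the Calderón–Zygmund decomposition of `g` between the heights `2 ^ k` and
`2 ^ (k + 1)` on the maximal set `Q`. -/
noncomputable def treeAtom (μ : Measure X) (𝒟 : Finset (Set X)) (g : X → ℂ) (k : ℤ) (Q : Set X)
    (x : X) : ℂ :=
  oscOn μ g Q x - ∑ P ∈ (maxStopSets μ 𝒟 g (k + 1)).filter (· ⊆ Q), oscOn μ g P x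

variable {g : X → ℂ} {k : ℤ} {P Q : Set X}

theorem mem_stopSets :
    Q ∈ stopSets μ 𝒟 g k ↔ Q ∈ 𝒟 ∧ (2 : ℝ) ^ k * μ.real Q < ∫ x in Q, ‖g x‖ ∂μ := by
  classical
  simp [stopSets]

theorem mem_maxStopSets :
    Q ∈ maxStopSets μ 𝒟 g k ↔ Q ∈ stopSets μ 𝒟 g k ∧ ∀ P ∈ stopSets μ 𝒟 g k, Q ⊆ P → P = Q := by
  classical
  simp [maxStopSets]

theorem mem_tree_of_mem_maxStopSets (h : Q ∈ maxStopSets μ 𝒟 g k) : Q ∈ 𝒟 :=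
  (mem_stopSets.1 (mem_maxStopSets.1 h).1).1

theorem stopSets_succ_subset : stopSets μ 𝒟 g (k + 1) ⊆ stopSets μ 𝒟 g k := fun Q hQ => by
  rw [mem_stopSets] at hQ ⊢
  refine ⟨hQ.1, lt_of_le_of_lt ?_ hQ.2⟩
  gcongr
  · norm_num
  · omega

theorem exists_subset_maxStopSets (h : Q ∈ stopSets μ 𝒟 g k) :
    ∃ P ∈ maxStopSets μ 𝒟 g k, Q ⊆ P := by
  obtain ⟨P, hQP, hP⟩ := (stopSets μ 𝒟 g k).exists_le_maximal h
  exact ⟨P, mem_maxStopSets.2 ⟨hP.prop, fun R hR hPR => (hP.eq_of_le hR hPR).symm⟩, hQP⟩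

theorem IsLaminarTree.eq_of_mem_maxStopSets (hT : IsLaminarTree μ 𝒟 Q₀ D)
    (hP : P ∈ maxStopSets μ 𝒟 g k) (hQ : Q ∈ maxStopSets μ 𝒟 g k) {x : X} (hxP : x ∈ P)
    (hxQ : x ∈ Q) : P = Q := by
  rcases hT.laminar P (mem_tree_of_mem_maxStopSets hP) Q (mem_tree_of_mem_maxStopSets hQ)
    with h | h | h
  · exact ((mem_maxStopSets.1 hP).2 Q (mem_maxStopSets.1 hQ).1 h).symm
  · exact (mem_maxStopSets.1 hQ).2 P (mem_maxStopSets.1 hP).1 h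
  · exact (Set.disjoint_left.1 h hxP hxQ).elim

theorem IsLaminarTree.pairwiseDisjoint (hT : IsLaminarTree μ 𝒟 Q₀ D) :
    (maxStopSets μ 𝒟 g k : Set (Set X)).PairwiseDisjoint id := fun _ hP _ hQ hne =>
  Set.disjoint_left.2 fun _ hxP hxQ => hne (hT.eq_of_mem_maxStopSets hP hQ hxP hxQ)

theorem IsLaminarTree.nonempty (hT : IsLaminarTree μ 𝒟 Q₀ D) (hQ : Q ∈ 𝒟) : Q.Nonempty := by
  rw [Set.nonempty_iff_ne_empty]
  rintro rfl
  simpa using hT.measure_pos _ hQ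

theorem IsTreeStep.integrable (hT : IsLaminarTree μ 𝒟 Q₀ D) (hg : IsTreeStep 𝒟 Q₀ g) :
    Integrable g μ := by
  obtain ⟨M, hM⟩ := hg.bounded
  refine (integrableOn_iff_integrable_of_support_subset (s := Q₀) fun x hx => ?_).1 ?_
  · by_contra h
    exact hx (hg.support x h)
  · exact Measure.integrableOn_of_bounded (M := M) (hT.measure_ne_top _ hT.top_mem)
      hg.measurable.aestronglyMeasurable (Eventually.of_forall hM)

theorem oscOn_of_notMem {x : X} (hx : x ∉ Q) : oscOn μ g Q x = 0 := Set.indicator_of_notMem hx _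

theorem integrable_oscOn (hT : IsLaminarTree μ 𝒟 Q₀ D) (hg : IsTreeStep 𝒟 Q₀ g) (hQ : Q ∈ 𝒟) :
    Integrable (oscOn μ g Q) μ := by
  rw [oscOn, integrable_indicator_iff (hT.measurableSet Q hQ)]
  exact (hg.integrable hT).integrableOn.sub (integrableOn_const (hT.measure_ne_top Q hQ))

theorem integral_oscOn (hT : IsLaminarTree μ 𝒟 Q₀ D) (hg : IsTreeStep 𝒟 Q₀ g) (hQ : Q ∈ 𝒟) :
    ∫ x, oscOn μ g Q x ∂μ = 0 := by
  have := (hT.measure_pos Q hQ).ne'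
  rw [oscOn, integral_indicator (hT.measurableSet Q hQ), integral_sub
    (hg.integrable hT).integrableOn (integrableOn_const (hT.measure_ne_top Q hQ)),
    setIntegral_const, setAverage_eq, smul_smul, mul_inv_cancel₀ this, one_smul, sub_self]

theorem measurable_oscOn (hT : IsLaminarTree μ 𝒟 Q₀ D) (hg : IsTreeStep 𝒟 Q₀ g) (hQ : Q ∈ 𝒟) :
    Measurable (oscOn μ g Q) :=
  (hg.measurable.sub measurable_const).indicator (hT.measurableSet Q hQ)

theorem measurable_treeAtom (hT : IsLaminarTree μ 𝒟 Q₀ D) (hg : IsTreeStep 𝒟 Q₀ g)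
    (hQ : Q ∈ maxStopSets μ 𝒟 g k) : Measurable (treeAtom μ 𝒟 g k Q) := by
  classical
  refine (measurable_oscOn hT hg (mem_tree_of_mem_maxStopSets hQ)).sub
    (Finset.measurable_sum _ fun P hP => measurable_oscOn hT hg
    (mem_tree_of_mem_maxStopSets (Finset.mem_filter.1 hP).1))

theorem integral_treeAtom (hT : IsLaminarTree μ 𝒟 Q₀ D) (hg : IsTreeStep 𝒟 Q₀ g)
    (hQ : Q ∈ maxStopSets μ 𝒟 g k) : ∫ x, treeAtom μ 𝒟 g k Q x ∂μ = 0 := by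
  classical
  have h1 : ∀ P ∈ (maxStopSets μ 𝒟 g (k + 1)).filter (· ⊆ Q), P ∈ 𝒟 := fun P hP =>
    mem_tree_of_mem_maxStopSets (Finset.mem_filter.1 hP).1
  unfold treeAtom
  rw [integral_sub (integrable_oscOn hT hg (mem_tree_of_mem_maxStopSets hQ))
    (integrable_finsetSum _ fun P hP => integrable_oscOn hT hg (h1 P hP)),
    integral_finsetSum _ fun P hP => integrable_oscOn hT hg (h1 P hP),
    integral_oscOn hT hg (mem_tree_of_mem_maxStopSets hQ),
    Finset.sum_eq_zero fun P hP => integral_oscOn hT hg (h1 P hP), sub_zero]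

theorem treeAtom_eq_zero {x : X} (hx : x ∉ Q) : treeAtom μ 𝒟 g k Q x = 0 := by
  classical
  unfold treeAtom
  rw [Finset.sum_eq_zero fun P hP => ?_, sub_zero]
  · exact Set.indicator_of_notMem hx _
  · exact Set.indicator_of_notMem (fun h => hx ((Finset.mem_filter.1 hP).2 h)) _

/-- Every maximal set of level k + 1 lies in exactly one maximal set of level k. Hence the sum over
a level is a difference of consecutive levels, and the sum over all levels telescopes. -/
theorem sum_treeAtom (hT : IsLaminarTree μ 𝒟 Q₀ D) (x : X) :
    ∑ Q ∈ maxStopSets μ 𝒟 g k, treeAtom μ 𝒟 g k Q x =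
      ∑ Q ∈ maxStopSets μ 𝒟 g k, oscOn μ g Q x -
        ∑ Q ∈ maxStopSets μ 𝒟 g (k + 1), oscOn μ g Q x := by
  classical
  unfold treeAtom
  rw [Finset.sum_sub_distrib]
  congr 1
  simp_rw [Finset.sum_filter]
  rw [Finset.sum_comm]
  refine Finset.sum_congr rfl fun P hP => ?_
  obtain ⟨Q, hQ, hPQ⟩ := exists_subset_maxStopSets
    (stopSets_succ_subset (mem_maxStopSets.1 hP).1)
  obtain ⟨z, hz⟩ := hT.nonempty (mem_tree_of_mem_maxStopSets hP)
  rw [Finset.sum_eq_single_of_mem Q hQ fun R hR hRQ => if_neg fun hPR =>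
    hRQ (hT.eq_of_mem_maxStopSets hR hQ (hPR hz) (hPQ hz)), if_pos hPQ]

/-- The parent of a maximal set is not stopped, and its measure exceeds that of the set at most by
the factor D. The top set has no parent, but there the mean of g is zero. -/
theorem norm_average_le (hT : IsLaminarTree μ 𝒟 Q₀ D) (hg : IsTreeStep 𝒟 Q₀ g)
    (h0 : ∫ x, g x ∂μ = 0) (hQ : Q ∈ maxStopSets μ 𝒟 g k) :
    ‖⨍ x in Q, g x ∂μ‖ ≤ D * 2 ^ k := by
  have hD := hT.one_le
  have hQD := mem_tree_of_mem_maxStopSets hQ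
  by_cases hQ0 : Q = Q₀
  · rw [setAverage_eq, hQ0, setIntegral_eq_integral_of_forall_compl_eq_zero hg.support, h0]
    simp only [smul_zero, norm_zero]
    positivity
  · obtain ⟨P, hP, hQP, hPQ⟩ := hT.parent Q hQD hQ0
    have hPs : P ∉ stopSets μ 𝒟 g k := fun h =>
      hQP.ne ((mem_maxStopSets.1 hQ).2 P h hQP.subset).symm
    rw [mem_stopSets] at hPs
    push Not at hPs
    have h1 := hPs hP
    have hpos := hT.measure_pos Q hQD
    rw [setAverage_eq, norm_smul, norm_inv, Real.norm_of_nonneg hpos.le, inv_mul_le_iff₀ hpos]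
    calc ‖∫ x in Q, g x ∂μ‖ ≤ ∫ x in Q, ‖g x‖ ∂μ := norm_integral_le_integral_norm _
      _ ≤ ∫ x in P, ‖g x‖ ∂μ := setIntegral_mono_set (hg.integrable hT).norm.integrableOn
          (Eventually.of_forall fun _ => norm_nonneg _) (LE.le.eventuallyLE hQP.subset)
      _ ≤ 2 ^ k * μ.real P := h1
      _ ≤ 2 ^ k * (D * μ.real Q) := by gcongr
      _ = μ.real Q * (D * 2 ^ k) := by ring

/-- On a stopped set P of the next level the unbounded part g cancels and only the difference of two
means is left. Elsewhere in Q one has |g| ≤ 2^(k+1), since otherwise the set on which g is constant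
around the point would be stopped at level k + 1. -/
theorem norm_treeAtom_le (hT : IsLaminarTree μ 𝒟 Q₀ D) (hg : IsTreeStep 𝒟 Q₀ g)
    (h0 : ∫ x, g x ∂μ = 0) (hQ : Q ∈ maxStopSets μ 𝒟 g k) (x : X) :
    ‖treeAtom μ 𝒟 g k Q x‖ ≤ 3 * D * 2 ^ k := by
  classical
  have hD := hT.one_le
  have h2k : (0 : ℝ) < 2 ^ k := by positivity
  have h2k1 : (2 : ℝ) ^ (k + 1) = 2 ^ k * 2 := zpow_add_one₀ two_ne_zero k
  by_cases hx : x ∉ Q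
  · rw [treeAtom_eq_zero hx, norm_zero]; positivity
  push Not at hx
  have hQa := norm_average_le hT hg h0 hQ
  have hoQ : oscOn μ g Q x = g x - ⨍ y in Q, g y ∂μ := Set.indicator_of_mem hx _
  by_cases hex : ∃ P ∈ (maxStopSets μ 𝒟 g (k + 1)).filter (· ⊆ Q), x ∈ P
  · obtain ⟨P, hP, hxP⟩ := hex
    have hP' := (Finset.mem_filter.1 hP).1
    have hPa := norm_average_le hT hg h0 hP'
    have hoP : oscOn μ g P x = g x - ⨍ y in P, g y ∂μ := Set.indicator_of_mem hxP _
    unfold treeAtom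
    rw [Finset.sum_eq_single_of_mem P hP fun R hR hRP => oscOn_of_notMem (fun hxR =>
      hRP (hT.eq_of_mem_maxStopSets (Finset.mem_filter.1 hR).1 hP' hxR hxP)), hoQ, hoP]
    calc _ = ‖(⨍ y in P, g y ∂μ) - ⨍ y in Q, g y ∂μ‖ := by congr 1; ring
      _ ≤ D * 2 ^ (k + 1) + D * 2 ^ k := (norm_sub_le _ _).trans (add_le_add hPa hQa)
      _ = _ := by rw [h2k1]; ring
  · push Not at hex
    unfold treeAtom
    rw [Finset.sum_eq_zero fun P hP => oscOn_of_notMem (hex P hP), sub_zero, hoQ]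
    have hgx : ‖g x‖ ≤ 2 ^ (k + 1) := by
      by_contra! hlt
      obtain ⟨L, hL, hxL, hLc⟩ := hg.leaf x (hT.subset_top Q (mem_tree_of_mem_maxStopSets hQ) hx)
      have hLs : L ∈ stopSets μ 𝒟 g (k + 1) := by
        rw [mem_stopSets]
        refine ⟨hL, ?_⟩
        rw [setIntegral_congr_fun (g := fun _ => ‖g x‖) (hT.measurableSet L hL)
          fun y hy => by simp only [hLc y hy], setIntegral_const, smul_eq_mul, mul_comm]
        exact mul_lt_mul_of_pos_left hlt (hT.measure_pos L hL)
      obtain ⟨P, hP, hLP⟩ := exists_subset_maxStopSets hLs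
      obtain ⟨R, hR, hPR⟩ := exists_subset_maxStopSets
        (stopSets_succ_subset (mem_maxStopSets.1 hP).1)
      have hRQ := hT.eq_of_mem_maxStopSets hR hQ (hPR (hLP hxL)) hx
      exact hex P (Finset.mem_filter.2 ⟨hP, hRQ ▸ hPR⟩) (hLP hxL)
    calc ‖g x - ⨍ y in Q, g y ∂μ‖ ≤ 2 ^ (k + 1) + D * 2 ^ k :=
          (norm_sub_le _ _).trans (add_le_add hgx hQa)
      _ ≤ 3 * D * 2 ^ k := by rw [h2k1]; nlinarith

/-- On a stopped set the values |g| ≤ 2^k / 2 contribute at most half of 2^k μ(Q), so the set where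
2|g| > 2^k must provide the rest. The maximal sets are disjoint, so these estimates add up; this
plays the part of the weak type bound of the maximal function. -/
theorem mul_sum_measureReal_le (hT : IsLaminarTree μ 𝒟 Q₀ D) (hg : IsTreeStep 𝒟 Q₀ g) :
    2 ^ k * ∑ Q ∈ maxStopSets μ 𝒟 g k, μ.real Q ≤
      2 * ∫ x, {x | 2 ^ k < 2 * ‖g x‖}.indicator (fun x => ‖g x‖) x ∂μ := by
  have hmeas : MeasurableSet {x | (2 : ℝ) ^ k < 2 * ‖g x‖} :=
    measurableSet_lt measurable_const (hg.measurable.norm.const_mul 2)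
  set u : X → ℝ := {x | 2 ^ k < 2 * ‖g x‖}.indicator (fun x => ‖g x‖) with hu
  have hui : Integrable u μ := (hg.integrable hT).norm.indicator hmeas
  have hu0 : ∀ x, 0 ≤ u x := fun x => Set.indicator_nonneg (fun _ _ => norm_nonneg _) x
  have hone : ∀ Q ∈ maxStopSets μ 𝒟 g k, 2 ^ k * μ.real Q ≤ 2 * ∫ x in Q, u x ∂μ := by
    intro Q hQ
    have hQD := mem_tree_of_mem_maxStopSets hQ
    have h1 := (mem_stopSets.1 (mem_maxStopSets.1 hQ).1).2
    have h2 : ∫ x in Q, ‖g x‖ ∂μ ≤ ∫ x in Q, (u x + 2 ^ k / 2) ∂μ := by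
      refine setIntegral_mono_on (hg.integrable hT).norm.integrableOn
        (hui.integrableOn.add (integrableOn_const (hT.measure_ne_top Q hQD)))
        (hT.measurableSet Q hQD) fun x _ => ?_
      by_cases hx : (2 : ℝ) ^ k < 2 * ‖g x‖
      · rw [hu, Set.indicator_of_mem (by exact hx)]
        have : (0 : ℝ) < 2 ^ k := by positivity
        linarith
      · rw [hu, Set.indicator_of_notMem (by exact hx)]
        linarith
    rw [integral_add hui.integrableOn (integrableOn_const (hT.measure_ne_top Q hQD)),
      setIntegral_const, smul_eq_mul] at h2
    linarith
  rw [Finset.mul_sum]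
  refine (Finset.sum_le_sum hone).trans ?_
  rw [← Finset.mul_sum]
  refine mul_le_mul_of_nonneg_left ?_ zero_le_two
  rw [← integral_biUnion_finset _ (fun Q hQ => hT.measurableSet Q (mem_tree_of_mem_maxStopSets hQ))
    hT.pairwiseDisjoint fun Q _ => hui.integrableOn]
  exact setIntegral_le_integral hui (Eventually.of_forall hu0)

/-- A geometric sum is comparable to its largest term, uniformly in the lowest level and in the set
of levels. -/
theorem sum_rpow_height_le (k₀ : ℤ) {s : ℝ} (hs : 0 < s) (T : Finset ℕ) {B : ℝ} (hB : 0 ≤ B)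
    (h : ∀ i ∈ T, (2 : ℝ) ^ (k₀ + i) ≤ B) :
    ∑ i ∈ T, ((2 : ℝ) ^ (k₀ + i)) ^ s ≤ 2 ^ s / (2 ^ s - 1) * B ^ s := by
  have hu : (1 : ℝ) < 2 ^ s := Real.one_lt_rpow one_lt_two hs
  have hu' : (0 : ℝ) < 2 ^ s - 1 := by linarith
  rcases T.eq_empty_or_nonempty with rfl | hT
  · simp only [Finset.sum_empty]; positivity
  have e : ∀ i : ℕ, ((2 : ℝ) ^ (k₀ + i)) ^ s = ((2 : ℝ) ^ k₀) ^ s * ((2 : ℝ) ^ s) ^ i := by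
    intro i
    rw [zpow_add₀ two_ne_zero, Real.mul_rpow (by positivity) (by positivity), zpow_natCast,
      ← Real.rpow_natCast, ← Real.rpow_mul zero_le_two, mul_comm (i : ℝ), Real.rpow_mul zero_le_two,
      Real.rpow_natCast]
  set m := T.max' hT
  calc ∑ i ∈ T, ((2 : ℝ) ^ (k₀ + i)) ^ s
      ≤ ∑ i ∈ Finset.range (m + 1), ((2 : ℝ) ^ (k₀ + i)) ^ s :=
        Finset.sum_le_sum_of_subset_of_nonneg (fun i hi => Finset.mem_range.2
          (Nat.lt_succ_of_le (T.le_max' i hi))) fun i _ _ => by positivity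
    _ = ((2 : ℝ) ^ k₀) ^ s * (((2 : ℝ) ^ s) ^ (m + 1) - 1) / (2 ^ s - 1) := by
        simp_rw [e]
        rw [← Finset.mul_sum, geom_sum_eq hu.ne', mul_div_assoc]
    _ ≤ ((2 : ℝ) ^ k₀) ^ s * (((2 : ℝ) ^ s) ^ (m + 1)) / (2 ^ s - 1) := by
        gcongr; linarith
    _ = 2 ^ s / (2 ^ s - 1) * ((2 : ℝ) ^ (k₀ + m)) ^ s := by rw [e, pow_succ]; ring
    _ ≤ _ := by
        gcongr
        exact h m (T.max'_mem hT)

/-- The weak type bound is multiplied by the height to the power r - 1 and summed over the levels.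
At a point x only the heights below 2|g(x)| occur, and as r > 1 their geometric sum yields |g(x)|^r.
-/
theorem sum_rpow_mul_sum_measureReal_le (hT : IsLaminarTree μ 𝒟 Q₀ D) (hg : IsTreeStep 𝒟 Q₀ g)
    {r : ℝ} (hr : 1 < r) (k₀ : ℤ) (N : ℕ) :
    ∑ i ∈ Finset.range N, ((2 : ℝ) ^ (k₀ + i)) ^ r * ∑ Q ∈ maxStopSets μ 𝒟 g (k₀ + i), μ.real Q ≤
      2 ^ r * (2 ^ (r - 1) / (2 ^ (r - 1) - 1)) * ∫ x, ‖g x‖ ^ r ∂μ := by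
  classical
  have hu : (1 : ℝ) < 2 ^ (r - 1) := Real.one_lt_rpow one_lt_two (by linarith)
  have hmeas : ∀ i : ℕ, MeasurableSet {x | (2 : ℝ) ^ (k₀ + i) < 2 * ‖g x‖} := fun i =>
    measurableSet_lt measurable_const (hg.measurable.norm.const_mul 2)
  set u : ℕ → X → ℝ := fun i =>
    {x | (2 : ℝ) ^ (k₀ + i) < 2 * ‖g x‖}.indicator fun x => ‖g x‖ with hu'
  have hui : ∀ i, Integrable (u i) μ := fun i => (hg.integrable hT).norm.indicator (hmeas i)
  have hgr : Integrable (fun x => ‖g x‖ ^ r) μ := by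
    obtain ⟨M, hM⟩ := hg.bounded
    have h1 : Integrable (fun x => ‖g x‖ * ‖g x‖ ^ (r - 1)) μ :=
      (hg.integrable hT).norm.mul_bdd (c := M ^ (r - 1))
        (hg.measurable.norm.pow_const _).aestronglyMeasurable (Eventually.of_forall fun x => by
        rw [Real.norm_of_nonneg (by positivity)]
        exact Real.rpow_le_rpow (norm_nonneg _) (hM x) (by linarith))
    refine h1.congr (Eventually.of_forall fun x => ?_)
    have := Real.rpow_add_one' (norm_nonneg (g x)) (y := r - 1) (by linarith)
    rw [sub_add_cancel] at this
    simp only [this, mul_comm]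
  have hstep : ∀ i ∈ Finset.range N,
      ((2 : ℝ) ^ (k₀ + i)) ^ r * ∑ Q ∈ maxStopSets μ 𝒟 g (k₀ + i), μ.real Q ≤
        ∫ x, 2 * (((2 : ℝ) ^ (k₀ + i)) ^ (r - 1) * u i x) ∂μ := by
    intro i _
    have h1 := mul_sum_measureReal_le (k := k₀ + i) hT hg
    have h2 : ((2 : ℝ) ^ (k₀ + i)) ^ r = ((2 : ℝ) ^ (k₀ + i)) ^ (r - 1) * 2 ^ (k₀ + i) := by
      rw [← Real.rpow_add_one (by positivity), sub_add_cancel]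
    rw [h2, mul_assoc, integral_const_mul, integral_const_mul]
    calc _ ≤ ((2 : ℝ) ^ (k₀ + i)) ^ (r - 1) * (2 * ∫ x, u i x ∂μ) := by gcongr
      _ = _ := by ring
  refine (Finset.sum_le_sum hstep).trans ?_
  rw [← integral_finsetSum _ fun i _ => ((hui i).const_mul _).const_mul _, ← integral_const_mul]
  refine integral_mono (integrable_finsetSum _ fun i _ => ((hui i).const_mul _).const_mul _)
    (hgr.const_mul _) fun x => ?_
  set T := (Finset.range N).filter fun i : ℕ => (2 : ℝ) ^ (k₀ + i) < 2 * ‖g x‖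
  have h3 := sum_rpow_height_le k₀ (s := r - 1) (by linarith) T (B := 2 * ‖g x‖) (by positivity)
    fun i hi => (Finset.mem_filter.1 hi).2.le
  have h4 : ∑ i ∈ Finset.range N, 2 * (((2 : ℝ) ^ (k₀ + i)) ^ (r - 1) * u i x) =
      2 * ‖g x‖ * ∑ i ∈ T, ((2 : ℝ) ^ (k₀ + i)) ^ (r - 1) := by
    rw [Finset.mul_sum, Finset.sum_filter]
    refine Finset.sum_congr rfl fun i _ => ?_
    by_cases hx : (2 : ℝ) ^ (k₀ + i) < 2 * ‖g x‖
    · have : u i x = ‖g x‖ := Set.indicator_of_mem (by exact hx) _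
      rw [if_pos hx, this]; ring
    · have : u i x = 0 := Set.indicator_of_notMem (by exact hx) _
      rw [if_neg hx, this]; ring
  have h5 : (2 * ‖g x‖) * (2 * ‖g x‖) ^ (r - 1) = 2 ^ r * ‖g x‖ ^ r := by
    rw [mul_comm, ← Real.rpow_add_one' (by positivity) (by linarith), sub_add_cancel,
      Real.mul_rpow zero_le_two (norm_nonneg _)]
  simp only
  rw [h4]
  calc _ ≤ 2 * ‖g x‖ * (2 ^ (r - 1) / (2 ^ (r - 1) - 1) * (2 * ‖g x‖) ^ (r - 1)) := by gcongr
    _ = 2 ^ (r - 1) / (2 ^ (r - 1) - 1) * ((2 * ‖g x‖) * (2 * ‖g x‖) ^ (r - 1)) := by ring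
    _ = _ := by rw [h5]; ring

/-- The atomic decomposition of a step function of mean zero. -/
theorem exists_atoms (μ : Measure X) {r s : ℝ} (hr : 1 < r) (hs : 0 < s) (hD : 1 ≤ D) :
    ∃ C : ℝ, 0 < C ∧ ∀ (𝒟 : Finset (Set X)) (Q₀ : Set X) (g : X → ℂ), IsLaminarTree μ 𝒟 Q₀ D →
      IsTreeStep 𝒟 Q₀ g → ∫ x, g x ∂μ = 0 →
      ∃ (I : Finset (Σ _ : ℕ, Set X)) (ht : (Σ _ : ℕ, Set X) → ℝ) (a : (Σ _ : ℕ, Set X) → X → ℂ),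
        (∀ i, 0 < ht i) ∧ (∀ i ∈ I, i.2 ∈ 𝒟) ∧ (∀ i ∈ I, Measurable (a i)) ∧
        (∀ i ∈ I, ∀ x, ‖a i x‖ ≤ C * ht i) ∧ (∀ i ∈ I, ∀ x, x ∉ i.2 → a i x = 0) ∧
        (∀ i ∈ I, ∫ x, a i x ∂μ = 0) ∧ (∀ x, g x = ∑ i ∈ I, a i x) ∧
        ∑ i ∈ I, ht i ^ r * μ.real i.2 ≤ C * ∫ x, ‖g x‖ ^ r ∂μ ∧
        ∫⁻ x, ENNReal.ofReal ((∑ i ∈ I, ht i ^ (s - 1) * ‖a i x‖) ^ (r / s)) ∂μ ≤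
          ENNReal.ofReal (C * ∫ x, ‖g x‖ ^ r ∂μ) := by
  classical
  have hu : (1 : ℝ) < 2 ^ s := Real.one_lt_rpow one_lt_two hs
  have hu' : (1 : ℝ) < 2 ^ (r - 1) := Real.one_lt_rpow one_lt_two (by linarith)
  set C₁ : ℝ := 2 ^ r * (2 ^ (r - 1) / (2 ^ (r - 1) - 1)) with hC₁
  have hC₁0 : 0 < C₁ := mul_pos (by positivity) (div_pos (by positivity) (by linarith))
  set C₂ : ℝ := 2 ^ s / (2 ^ s - 1) with hC₂
  have hC₂0 : 0 < C₂ := div_pos (by positivity) (by linarith)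
  set C₃ : ℝ := (3 * D * C₂) ^ (r / s) with hC₃
  have hC₃0 : 0 < C₃ := by positivity
  refine ⟨3 * D + C₁ + C₃ * C₁, by positivity, fun 𝒟 Q₀ g hT hg h0 => ?_⟩
  have hgr0 : 0 ≤ ∫ x, ‖g x‖ ^ r ∂μ := integral_nonneg fun x => by positivity
  have hint := hg.integrable hT
  have hQ0pos := hT.measure_pos _ hT.top_mem
  have hgQ₀ : ∫ x in Q₀, ‖g x‖ ∂μ = ∫ x, ‖g x‖ ∂μ :=
    setIntegral_eq_integral_of_forall_compl_eq_zero fun x hx => by rw [hg.support x hx, norm_zero]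
  -- If the integral of |g| vanishes there is no lowest stopping level. Then g is zero everywhere,
  -- because it is constant on sets of positive measure that cover Q₀, and the empty sum suffices.
  rcases (show 0 ≤ ∫ x, ‖g x‖ ∂μ from integral_nonneg fun x => norm_nonneg (g x)).eq_or_lt
    with hz | hG
  · refine ⟨∅, fun _ => 1, fun _ _ => 0, by simp, by simp, by simp, by simp, by simp, by simp,
      fun x => ?_, ?_, ?_⟩
    · rw [Finset.sum_empty]
      by_cases hx : x ∈ Q₀
      · obtain ⟨L, hL, hxL, hLc⟩ := hg.leaf x hx
        have h1 : ∫ y in L, ‖g y‖ ∂μ = μ.real L * ‖g x‖ := by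
          rw [setIntegral_congr_fun (g := fun _ => ‖g x‖) (hT.measurableSet L hL)
            fun y hy => by simp only [hLc y hy], setIntegral_const, smul_eq_mul]
        have h2 : ∫ y in L, ‖g y‖ ∂μ ≤ ∫ y, ‖g y‖ ∂μ :=
          setIntegral_le_integral hint.norm (Eventually.of_forall fun _ => norm_nonneg _)
        rw [h1, ← hz] at h2
        have h3 := hT.measure_pos L hL
        have h4 : ‖g x‖ ≤ 0 := by
          by_contra! h
          have := mul_pos h3 h
          linarith
        exact norm_le_zero_iff.1 h4
      · exact hg.support x hx
    · simp only [Finset.sum_empty]; positivity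
    · simp [Real.zero_rpow (by positivity : r / s ≠ 0)]
  -- The level k₀ is so low that Q₀ itself is stopped. It is then the only maximal set, and as g has
  -- mean zero the telescoping sum starts with g.
  obtain ⟨k₀, hk₀⟩ : ∃ k₀ : ℤ, (2 : ℝ) ^ k₀ * μ.real Q₀ < ∫ x, ‖g x‖ ∂μ := by
    obtain ⟨m, hm⟩ := exists_pow_lt_of_lt_one (div_pos hG hQ0pos) (by norm_num : (1 / 2 : ℝ) < 1)
    refine ⟨-m, ?_⟩
    rw [lt_div_iff₀ hQ0pos] at hm
    simpa using hm
  obtain ⟨M, hM⟩ := hg.bounded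
  -- From the height 2^(k₀+N) ≥ sup |g| on no set is stopped, so the telescoping sum ends with zero.
  obtain ⟨N, hN⟩ : ∃ N : ℕ, M ≤ (2 : ℝ) ^ (k₀ + N) := by
    obtain ⟨N, hN⟩ := pow_unbounded_of_one_lt (M / 2 ^ k₀) (one_lt_two (α := ℝ))
    refine ⟨N, ?_⟩
    rw [zpow_add₀ two_ne_zero, zpow_natCast, mul_comm, ← div_le_iff₀ (by positivity)]
    exact hN.le
  have hbot : ∀ x, ∑ Q ∈ maxStopSets μ 𝒟 g (k₀ + (0 : ℕ)), oscOn μ g Q x = g x := by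
    intro x
    have hQ₀s : Q₀ ∈ stopSets μ 𝒟 g (k₀ + (0 : ℕ)) := by
      rw [mem_stopSets, hgQ₀]
      exact ⟨hT.top_mem, by simpa using hk₀⟩
    have hsing : maxStopSets μ 𝒟 g (k₀ + (0 : ℕ)) = {Q₀} := by
      ext Q
      rw [Finset.mem_singleton]
      constructor
      · intro hQ
        exact ((mem_maxStopSets.1 hQ).2 Q₀ hQ₀s
          (hT.subset_top Q (mem_tree_of_mem_maxStopSets hQ))).symm
      · rintro rfl
        exact mem_maxStopSets.2 ⟨hQ₀s, fun P hP hQP =>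
          (hT.subset_top P (mem_stopSets.1 hP).1).antisymm hQP⟩
    rw [hsing, Finset.sum_singleton]
    by_cases hx : x ∈ Q₀
    · rw [oscOn, Set.indicator_of_mem hx, setAverage_eq,
        setIntegral_eq_integral_of_forall_compl_eq_zero hg.support, h0, smul_zero, sub_zero]
    · rw [oscOn_of_notMem hx, hg.support x hx]
  have htop : ∀ x, ∑ Q ∈ maxStopSets μ 𝒟 g (k₀ + N), oscOn μ g Q x = 0 := by
    intro x
    refine Finset.sum_eq_zero fun Q hQ => ?_
    exfalso
    have hQ' := mem_stopSets.1 (mem_maxStopSets.1 hQ).1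
    have h1 : ∫ x in Q, ‖g x‖ ∂μ ≤ ∫ x in Q, M ∂μ :=
      setIntegral_mono hint.norm.integrableOn (integrableOn_const (hT.measure_ne_top Q hQ'.1)) hM
    rw [setIntegral_const, smul_eq_mul] at h1
    have h2 := hT.measure_pos Q hQ'.1
    have h3 := hQ'.2
    nlinarith
  set I : Finset (Σ _ : ℕ, Set X) :=
    (Finset.range N).sigma fun i => maxStopSets μ 𝒟 g (k₀ + i) with hI
  have hmem : ∀ i ∈ I, i.2 ∈ maxStopSets μ 𝒟 g (k₀ + i.1) := fun i hi => (Finset.mem_sigma.1 hi).2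
  have hmeas : ∑ i ∈ I, ((2 : ℝ) ^ (k₀ + i.1)) ^ r * μ.real i.2 ≤ C₁ * ∫ x, ‖g x‖ ^ r ∂μ := by
    rw [hI, Finset.sum_sigma]
    simp only [← Finset.mul_sum]
    exact sum_rpow_mul_sum_measureReal_le hT hg hr k₀ N
  refine ⟨I, fun i => 2 ^ (k₀ + i.1), fun i => treeAtom μ 𝒟 g (k₀ + i.1) i.2,
    fun i => by positivity, fun i hi => mem_tree_of_mem_maxStopSets (hmem i hi),
    fun i hi => measurable_treeAtom hT hg (hmem i hi),
    fun i hi x => (norm_treeAtom_le hT hg h0 (hmem i hi) x).trans ?_,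
    fun i hi x hx => treeAtom_eq_zero hx, fun i hi => integral_treeAtom hT hg (hmem i hi),
    fun x => ?_, hmeas.trans ?_, ?_⟩
  · have : 0 ≤ C₃ * C₁ := by positivity
    gcongr
    linarith
  · rw [hI, Finset.sum_sigma]
    simp only [sum_treeAtom hT]
    have := Finset.sum_range_sub' (fun i : ℕ => ∑ Q ∈ maxStopSets μ 𝒟 g (k₀ + i), oscOn μ g Q x) N
    rw [hbot, htop, sub_zero] at this
    rw [← this]
    refine Finset.sum_congr rfl fun i _ => ?_
    push_cast
    rw [add_assoc]
  · have : 0 ≤ C₃ * C₁ := by positivity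
    gcongr
    linarith
  -- The sum is estimated at each point by its highest level; raised to the power r / s that becomes
  -- one term of the sum of the r-th powers of the heights. Integration then reduces the claim to
  -- `hmeas`.
  · have hpt : ∀ x, (∑ i ∈ I, ((2 : ℝ) ^ (k₀ + i.1)) ^ (s - 1) *
        ‖treeAtom μ 𝒟 g (k₀ + i.1) i.2 x‖) ^ (r / s) ≤
        ∑ i ∈ I, C₃ * ((2 : ℝ) ^ (k₀ + i.1)) ^ r * i.2.indicator 1 x := by
      intro x
      -- Disjointness of the maximal sets makes c i the indicator of the event that x lies in a set
      -- of level i; T collects these levels.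
      set c : ℕ → ℝ := fun i => ∑ Q ∈ maxStopSets μ 𝒟 g (k₀ + i), Q.indicator (1 : X → ℝ) x with hc
      have hc01 : ∀ i, c i = 0 ∨ c i = 1 := by
        intro i
        by_cases hex : ∃ P ∈ maxStopSets μ 𝒟 g (k₀ + i), x ∈ P
        · obtain ⟨P, hP, hxP⟩ := hex
          right
          simp only [hc]
          rw [Finset.sum_eq_single_of_mem P hP fun R hR hRP => Set.indicator_of_notMem (fun hxR =>
            hRP (hT.eq_of_mem_maxStopSets hR hP hxR hxP)) _, Set.indicator_of_mem hxP, Pi.one_apply]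
        · push Not at hex
          left
          exact Finset.sum_eq_zero fun P hP => Set.indicator_of_notMem (hex P hP) _
      set T := (Finset.range N).filter fun i => c i = 1 with hTdef
      have hcT : ∀ w : ℕ → ℝ, ∑ i ∈ Finset.range N, w i * c i = ∑ i ∈ T, w i := by
        intro w
        rw [hTdef, Finset.sum_filter]
        refine Finset.sum_congr rfl fun i _ => ?_
        rcases hc01 i with h | h <;> simp [h]
      have h1 : ∑ i ∈ I, ((2 : ℝ) ^ (k₀ + i.1)) ^ (s - 1) * ‖treeAtom μ 𝒟 g (k₀ + i.1) i.2 x‖ ≤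
          3 * D * ∑ i ∈ T, ((2 : ℝ) ^ (k₀ + i)) ^ s := by
        have : ∀ i ∈ I, ((2 : ℝ) ^ (k₀ + i.1)) ^ (s - 1) * ‖treeAtom μ 𝒟 g (k₀ + i.1) i.2 x‖ ≤
            3 * D * ((2 : ℝ) ^ (k₀ + i.1)) ^ s * i.2.indicator (1 : X → ℝ) x := by
          intro i hi
          by_cases hx : x ∈ i.2
          · rw [Set.indicator_of_mem hx, Pi.one_apply, mul_one]
            calc _ ≤ ((2 : ℝ) ^ (k₀ + i.1)) ^ (s - 1) * (3 * D * 2 ^ (k₀ + i.1)) := by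
                  gcongr
                  exact norm_treeAtom_le hT hg h0 (hmem i hi) x
              _ = 3 * D * (((2 : ℝ) ^ (k₀ + i.1)) ^ (s - 1) * 2 ^ (k₀ + i.1)) := by ring
              _ = _ := by rw [← Real.rpow_add_one (by positivity), sub_add_cancel]
          · rw [treeAtom_eq_zero hx, Set.indicator_of_notMem hx]; simp
        refine (Finset.sum_le_sum this).trans (le_of_eq ?_)
        rw [hI, Finset.sum_sigma]
        simp only [← Finset.mul_sum]
        rw [hcT (fun i => 3 * D * ((2 : ℝ) ^ (k₀ + i)) ^ s), Finset.mul_sum]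
      have h2 : ∑ i ∈ I, C₃ * ((2 : ℝ) ^ (k₀ + i.1)) ^ r * i.2.indicator 1 x =
          C₃ * ∑ i ∈ T, ((2 : ℝ) ^ (k₀ + i)) ^ r := by
        rw [hI, Finset.sum_sigma]
        simp only [← Finset.mul_sum]
        rw [hcT (fun i => C₃ * ((2 : ℝ) ^ (k₀ + i)) ^ r), Finset.mul_sum]
      rw [h2]
      rcases T.eq_empty_or_nonempty with hTe | hTne
      · rw [hTe, Finset.sum_empty, mul_zero] at h1 ⊢
        have h4 : ∑ i ∈ I, ((2 : ℝ) ^ (k₀ + i.1)) ^ (s - 1) *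
            ‖treeAtom μ 𝒟 g (k₀ + i.1) i.2 x‖ = 0 :=
          le_antisymm h1 (Finset.sum_nonneg fun i _ => by positivity)
        rw [h4, Real.zero_rpow (by positivity)]
      · set m := T.max' hTne
        have h3 := sum_rpow_height_le k₀ hs T (B := 2 ^ (k₀ + m)) (by positivity) fun i hi => by
          refine zpow_le_zpow_right₀ one_le_two ?_
          have := T.le_max' i hi
          simp only [m]
          omega
        calc _ ≤ (3 * D * (C₂ * ((2 : ℝ) ^ (k₀ + m)) ^ s)) ^ (r / s) := by
              refine Real.rpow_le_rpow (Finset.sum_nonneg fun i _ => by positivity)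
                (h1.trans ?_) (by positivity)
              gcongr
          _ = C₃ * ((2 : ℝ) ^ (k₀ + m)) ^ r := by
              rw [← mul_assoc, Real.mul_rpow (by positivity) (by positivity), ← Real.rpow_mul
                (by positivity), mul_div_cancel₀ _ hs.ne']
          _ ≤ _ := by
              gcongr
              exact Finset.single_le_sum (f := fun i : ℕ => ((2 : ℝ) ^ (k₀ + i)) ^ r)
                (fun i _ => by positivity) (T.max'_mem hTne)
    calc _ ≤ ∫⁻ x, ∑ i ∈ I, i.2.indicator
            (fun _ => ENNReal.ofReal (C₃ * ((2 : ℝ) ^ (k₀ + i.1)) ^ r)) x ∂μ := by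
          refine lintegral_mono fun x => (ENNReal.ofReal_le_ofReal (hpt x)).trans (le_of_eq ?_)
          rw [ENNReal.ofReal_sum_of_nonneg fun i _ => mul_nonneg (by positivity)
            (Set.indicator_nonneg (fun _ _ => by simp) _)]
          refine Finset.sum_congr rfl fun i _ => ?_
          by_cases hx : x ∈ i.2 <;> simp [hx]
      _ = ∑ i ∈ I, ENNReal.ofReal (C₃ * ((2 : ℝ) ^ (k₀ + i.1)) ^ r) * μ i.2 := by
          have hms : ∀ i ∈ I, MeasurableSet i.2 := fun i hi =>
            hT.measurableSet _ (mem_tree_of_mem_maxStopSets (hmem i hi))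
          rw [lintegral_finsetSum' _ fun i hi =>
            (measurable_const.indicator (hms i hi)).aemeasurable]
          exact Finset.sum_congr rfl fun i hi => lintegral_indicator_const (hms i hi) _
      _ = ENNReal.ofReal (C₃ * ∑ i ∈ I, ((2 : ℝ) ^ (k₀ + i.1)) ^ r * μ.real i.2) := by
          rw [Finset.mul_sum, ENNReal.ofReal_sum_of_nonneg fun i _ => by positivity]
          refine Finset.sum_congr rfl fun i hi => ?_
          rw [← mul_assoc, ENNReal.ofReal_mul (p := C₃ * ((2 : ℝ) ^ (k₀ + i.1)) ^ r)
            (by positivity), measureReal_def, ENNReal.ofReal_toReal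
            (hT.measure_ne_top _ (mem_tree_of_mem_maxStopSets (hmem i hi)))]
      _ ≤ _ := by
          refine ENNReal.ofReal_le_ofReal ?_
          calc _ ≤ C₃ * (C₁ * ∫ x, ‖g x‖ ^ r ∂μ) := by gcongr
            _ = (C₃ * C₁) * ∫ x, ‖g x‖ ^ r ∂μ := by ring
            _ ≤ _ := by
              gcongr
              have : 0 < 3 * D + C₁ := by positivity
              linarith

end Laminar

/-! ### Dyadic cubes and dyadic step functions -/

section Dyadic

variable {n : ℕ} {R : ℝ} {i j N : ℕ} {x y : EuclideanSpace ℝ (Fin n)}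

/-- The side length of the dyadic cubes of level `j` in a cube of side length `2 R`. -/
noncomputable def dyadicSide (R : ℝ) (j : ℕ) : ℝ := 2 * R / 2 ^ j

/-- The index of the dyadic cube of level `j` that contains `x`. -/
noncomputable def dyadicIndex (R : ℝ) (j : ℕ) (x : EuclideanSpace ℝ (Fin n)) : Fin n → ℤ :=
  fun i => ⌊(x i + R) / dyadicSide R j⌋

/-- The dyadic cube of level `j` that contains `x`. -/
def dyadicCell (R : ℝ) (j : ℕ) (x : EuclideanSpace ℝ (Fin n)) : Set (EuclideanSpace ℝ (Fin n)) :=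
  {y | dyadicIndex R j y = dyadicIndex R j x}

/-- The half-open cube of side length `2 R` centred at the origin. -/
def dyadicCube (n : ℕ) (R : ℝ) : Set (EuclideanSpace ℝ (Fin n)) := {x | dyadicIndex R 0 x = 0}

theorem dyadicSide_pos (hR : 0 < R) : 0 < dyadicSide R j := by unfold dyadicSide; positivity

theorem dyadicSide_zero : dyadicSide R 0 = 2 * R := by simp [dyadicSide]

theorem dyadicIndex_eq_of_le (hij : i ≤ j) (h : dyadicIndex R j x = dyadicIndex R j y) :
    dyadicIndex R i x = dyadicIndex R i y := by
  induction j, hij using Nat.le_induction with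
  | base => exact h
  | succ j _ ih =>
    refine ih (funext fun l => ?_)
    have key : ∀ z : EuclideanSpace ℝ (Fin n),
        dyadicIndex R j z l = dyadicIndex R (j + 1) z l / (2 : ℕ) := fun z => by
      rw [dyadicIndex, dyadicIndex, ← Int.floor_div_natCast, dyadicSide, dyadicSide, pow_succ,
        div_div_eq_mul_div, div_div_eq_mul_div]
      congr 1
      push_cast
      rw [div_div, ← mul_assoc, mul_div_mul_right _ _ two_ne_zero]
    rw [key, key, h]

theorem mem_dyadicCell_iff (hR : 0 < R) : y ∈ dyadicCell R j x ↔ ∀ i,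
    -R + dyadicSide R j * dyadicIndex R j x i ≤ y i ∧
      y i < -R + dyadicSide R j * dyadicIndex R j x i + dyadicSide R j := by
  have hs := dyadicSide_pos (j := j) hR
  rw [dyadicCell, Set.mem_ofPred_eq, funext_iff]
  refine forall_congr' fun i => ?_
  rw [dyadicIndex, Int.floor_eq_iff, le_div_iff₀ hs, div_lt_iff₀ hs]
  constructor <;> rintro ⟨h1, h2⟩ <;> constructor <;> linarith

theorem mem_dyadicCell_self : x ∈ dyadicCell R j x := rfl

theorem dyadicCube_eq_cell (hx : x ∈ dyadicCube n R) : dyadicCell R 0 x = dyadicCube n R := by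
  rw [dyadicCell, dyadicCube, show dyadicIndex R 0 x = 0 from hx]

theorem mem_dyadicCube_iff (hR : 0 < R) :
    x ∈ dyadicCube n R ↔ ∀ i, -R ≤ x i ∧ x i < R := by
  rw [dyadicCube, Set.mem_ofPred_eq, funext_iff]
  refine forall_congr' fun i => ?_
  rw [dyadicIndex, Int.floor_eq_iff, dyadicSide_zero, le_div_iff₀ (by positivity),
    div_lt_iff₀ (by positivity)]
  simp only [Pi.zero_apply, Int.cast_zero]
  constructor <;> rintro ⟨h1, h2⟩ <;> constructor <;> linarith

theorem ball_subset_dyadicCube (hR : 0 < R) :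
    Metric.ball (0 : EuclideanSpace ℝ (Fin n)) R ⊆ dyadicCube n R := fun x hx => by
  rw [mem_dyadicCube_iff hR]
  intro i
  have := (PiLp.norm_apply_le x i).trans_lt (mem_ball_zero_iff.1 hx)
  rw [Real.norm_eq_abs, abs_lt] at this
  exact ⟨this.1.le, this.2⟩

theorem dist_le_of_mem_dyadicCell (hR : 0 < R) (h : y ∈ dyadicCell R j x) :
    dist y x < (n + 1) * dyadicSide R j := by
  have hs := dyadicSide_pos (j := j) hR
  rw [dist_eq_norm, EuclideanSpace.norm_eq, Real.sqrt_lt' (by positivity)]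
  have h2 := (mem_dyadicCell_iff hR).1 h
  have h3 := (mem_dyadicCell_iff hR).1 (mem_dyadicCell_self (R := R) (j := j) (x := x))
  calc ∑ i, ‖(y - x) i‖ ^ 2 ≤ ∑ _i : Fin n, dyadicSide R j ^ 2 := by
        refine Finset.sum_le_sum fun i _ => ?_
        refine pow_le_pow_left₀ (norm_nonneg _) ?_ 2
        rw [PiLp.sub_apply, Real.norm_eq_abs, abs_le]
        constructor <;> linarith [(h2 i).1, (h2 i).2, (h3 i).1, (h3 i).2]
    _ = n * dyadicSide R j ^ 2 := by simp
    _ < _ := by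
      rw [mul_pow]
      have : (0 : ℝ) ≤ n := n.cast_nonneg
      gcongr
      nlinarith

theorem volume_dyadicCell (hR : 0 < R) :
    volume (dyadicCell R j x) = ENNReal.ofReal (dyadicSide R j ^ n) := by
  have hs := dyadicSide_pos (j := j) hR
  have e : dyadicCell R j x = (@WithLp.ofLp 2 (Fin n → ℝ)) ⁻¹' Set.univ.pi fun i =>
      Set.Ico (-R + dyadicSide R j * dyadicIndex R j x i)
        (-R + dyadicSide R j * dyadicIndex R j x i + dyadicSide R j) := by
    ext y
    rw [mem_dyadicCell_iff hR]
    simp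
  rw [e, (PiLp.volume_preserving_ofLp (Fin n)).measure_preimage
    (MeasurableSet.univ_pi fun _ => measurableSet_Ico).nullMeasurableSet, Real.volume_pi_Ico]
  simp [ENNReal.ofReal_pow hs.le]

theorem measureReal_dyadicCell (hR : 0 < R) :
    volume.real (dyadicCell R j x) = dyadicSide R j ^ n := by
  rw [measureReal_def, volume_dyadicCell hR, ENNReal.toReal_ofReal]
  exact pow_nonneg (dyadicSide_pos hR).le _

theorem zero_mem_dyadicCube (hR : 0 < R) : (0 : EuclideanSpace ℝ (Fin n)) ∈ dyadicCube n R :=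
  ball_subset_dyadicCube hR (Metric.mem_ball_self hR)

theorem volume_dyadicCube (hR : 0 < R) :
    volume (dyadicCube n R) = ENNReal.ofReal ((2 * R) ^ n) := by
  rw [← dyadicCube_eq_cell (zero_mem_dyadicCube hR), volume_dyadicCell hR, dyadicSide_zero]

theorem measureReal_dyadicCube (hR : 0 < R) :
    volume.real (dyadicCube n R) = (2 * R) ^ n := by
  rw [measureReal_def, volume_dyadicCube hR, ENNReal.toReal_ofReal (by positivity)]

theorem measurable_dyadicIndex :
    Measurable (dyadicIndex R j : EuclideanSpace ℝ (Fin n) → Fin n → ℤ) := by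
  refine measurable_pi_lambda _ fun i => Int.measurable_floor.comp ?_
  fun_prop

theorem measurableSet_dyadicCell : MeasurableSet (dyadicCell R j x) :=
  measurable_dyadicIndex (measurableSet_singleton _)

theorem measurableSet_dyadicCube : MeasurableSet (dyadicCube n R) :=
  measurable_dyadicIndex (measurableSet_singleton _)

theorem finite_dyadicCells (hR : 0 < R) (N : ℕ) :
    {Q | ∃ j ≤ N, ∃ x ∈ dyadicCube n R, Q = dyadicCell R j x}.Finite := by
  refine ((Set.finite_Iic N).biUnion fun j _ => (Set.finite_Icc (0 : Fin n → ℤ)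
    (fun _ => 2 ^ j)).image fun k => {y | dyadicIndex R j y = k}).subset ?_
  rintro Q ⟨j, hj, x, hx, rfl⟩
  refine Set.mem_biUnion hj ⟨dyadicIndex R j x, ⟨fun i => ?_, fun i => ?_⟩, rfl⟩
  all_goals
    have hs := dyadicSide_pos (j := j) hR
    have h := (mem_dyadicCube_iff hR).1 hx i
  · exact Int.floor_nonneg.2 (div_nonneg (by linarith) hs.le)
  · refine Int.cast_le (R := ℝ).1 ((Int.floor_le _).trans ?_)
    rw [div_le_iff₀ hs, dyadicSide]
    push_cast
    rw [mul_div_cancel₀ _ (by positivity)]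
    linarith

/-- The dyadic subcubes of the cube of side length `2 R` up to level `N`. -/
noncomputable def dyadicTree (n : ℕ) (hR : 0 < R) (N : ℕ) :
    Finset (Set (EuclideanSpace ℝ (Fin n))) := (finite_dyadicCells hR N).toFinset

theorem mem_dyadicTree {hR : 0 < R} {Q : Set (EuclideanSpace ℝ (Fin n))} :
    Q ∈ dyadicTree n hR N ↔ ∃ j ≤ N, ∃ x ∈ dyadicCube n R, Q = dyadicCell R j x := by
  simp [dyadicTree]

theorem dyadicCell_subset_or_disjoint (hij : i ≤ j) :
    dyadicCell R j y ⊆ dyadicCell R i x ∨ Disjoint (dyadicCell R i x) (dyadicCell R j y) := by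
  by_cases h : ∃ z, z ∈ dyadicCell R i x ∧ z ∈ dyadicCell R j y
  · obtain ⟨z, hzi, hzj⟩ := h
    exact Or.inl fun w hw => (dyadicIndex_eq_of_le hij
      ((show _ = _ from hw).trans (show _ = _ from hzj).symm)).trans hzi
  · exact Or.inr (Set.disjoint_left.2 fun z h1 h2 => h ⟨z, h1, h2⟩)

theorem dyadicCell_subset_dyadicCube (hx : x ∈ dyadicCube n R) :
    dyadicCell R j x ⊆ dyadicCube n R := by
  rw [← dyadicCube_eq_cell hx]
  exact fun y hy => dyadicIndex_eq_of_le (Nat.zero_le j) hy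

theorem isLaminarTree_dyadicTree (hn : 1 ≤ n) (hR : 0 < R) (N : ℕ) :
    IsLaminarTree volume (dyadicTree n hR N) (dyadicCube n R) (2 ^ n) where
  measurableSet Q hQ := by
    obtain ⟨j, -, x, -, rfl⟩ := mem_dyadicTree.1 hQ
    exact measurableSet_dyadicCell
  measure_ne_top Q hQ := by
    obtain ⟨j, -, x, -, rfl⟩ := mem_dyadicTree.1 hQ
    rw [volume_dyadicCell hR]
    exact ENNReal.ofReal_ne_top
  measure_pos Q hQ := by
    obtain ⟨j, -, x, -, rfl⟩ := mem_dyadicTree.1 hQ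
    rw [measureReal_dyadicCell hR]
    exact pow_pos (dyadicSide_pos hR) _
  top_mem := mem_dyadicTree.2 ⟨0, Nat.zero_le _, 0, zero_mem_dyadicCube hR,
    (dyadicCube_eq_cell (zero_mem_dyadicCube hR)).symm⟩
  subset_top Q hQ := by
    obtain ⟨j, -, x, hx, rfl⟩ := mem_dyadicTree.1 hQ
    exact dyadicCell_subset_dyadicCube hx
  laminar P hP Q hQ := by
    obtain ⟨j, -, x, -, rfl⟩ := mem_dyadicTree.1 hP
    obtain ⟨i, -, y, -, rfl⟩ := mem_dyadicTree.1 hQ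
    rcases le_total i j with h | h
    · rcases dyadicCell_subset_or_disjoint (x := y) (y := x) (R := R) h with h | h
      · exact Or.inl h
      · exact Or.inr (Or.inr h.symm)
    · exact Or.inr (dyadicCell_subset_or_disjoint h)
  parent Q hQ hne := by
    obtain ⟨j, hj, x, hx, rfl⟩ := mem_dyadicTree.1 hQ
    obtain _ | j := j
    · exact (hne (dyadicCube_eq_cell hx)).elim
    have hs : dyadicSide R j = 2 * dyadicSide R (j + 1) := by
      rw [dyadicSide, dyadicSide, pow_succ]
      field_simp
    have hm : volume.real (dyadicCell R j x) = 2 ^ n * volume.real (dyadicCell R (j + 1) x) := by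
      rw [measureReal_dyadicCell hR, measureReal_dyadicCell hR, hs, mul_pow]
    refine ⟨dyadicCell R j x, mem_dyadicTree.2 ⟨j, by omega, x, hx, rfl⟩,
      ⟨fun y hy => dyadicIndex_eq_of_le (Nat.le_succ j) hy, fun h => ?_⟩, hm.le⟩
    -- Were the cell equal to its parent, it would have 2^n times its own measure. This is where n ≥
    -- 1 enters: for n = 0 the cells of all levels coincide.
    have h1 := measureReal_mono (μ := volume) h (by simp [volume_dyadicCell hR])
    have h2 : (1 : ℝ) < 2 ^ n := one_lt_pow₀ one_lt_two (by omega)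
    have h3 : 0 < volume.real (dyadicCell R (j + 1) x) := by
      rw [measureReal_dyadicCell hR]
      exact pow_pos (dyadicSide_pos hR) _
    rw [hm] at h1
    nlinarith
  one_le := one_le_pow₀ one_le_two

/-- The ball in which a dyadic cube is contained has comparable measure. -/
theorem exists_ball_of_mem_dyadicTree {hR : 0 < R} {Q : Set (EuclideanSpace ℝ (Fin n))}
    (hQ : Q ∈ dyadicTree n hR N) : ∃ c ρ, 0 < ρ ∧ Q ⊆ Metric.ball c ρ ∧
      ρ ^ n ≤ (n + 1) ^ n * volume.real Q := by
  obtain ⟨j, -, x, -, rfl⟩ := mem_dyadicTree.1 hQ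
  have hs := dyadicSide_pos (j := j) hR
  refine ⟨x, (n + 1) * dyadicSide R j, by positivity, fun y hy => dist_le_of_mem_dyadicCell hR hy,
    ?_⟩
  rw [measureReal_dyadicCell hR, mul_pow]

/-- The functions supported in the cube that are constant on the dyadic cubes of level `N`. -/
structure IsDyadicStep (R : ℝ) (N : ℕ) (g : EuclideanSpace ℝ (Fin n) → ℂ) : Prop where
  support : ∀ x, x ∉ dyadicCube n R → g x = 0
  const : ∀ x y, dyadicIndex R N x = dyadicIndex R N y → g x = g y

variable {g h : EuclideanSpace ℝ (Fin n) → ℂ}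

theorem IsDyadicStep.measurable (hg : IsDyadicStep R N g) : Measurable g := by
  have e : g = (fun k => g (Function.invFun (dyadicIndex R N) k)) ∘ dyadicIndex R N := by
    ext x
    exact hg.const _ _ (Function.invFun_eq ⟨x, rfl⟩).symm
  rw [e]
  exact (measurable_of_countable _).comp measurable_dyadicIndex

theorem IsDyadicStep.finite_range (hR : 0 < R) (hg : IsDyadicStep R N g) :
    (Set.range g).Finite := by
  have h1 : (g '' dyadicCube n R).Finite := by
    refine ((finite_dyadicCells hR N).image
      fun Q => g (Classical.epsilon fun y => y ∈ Q)).subset ?_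
    rintro _ ⟨x, hx, rfl⟩
    refine ⟨_, ⟨N, le_rfl, x, hx, rfl⟩, hg.const _ _ ?_⟩
    exact Classical.epsilon_spec (p := fun y => y ∈ dyadicCell R N x) ⟨x, rfl⟩
  refine (h1.insert 0).subset ?_
  rintro _ ⟨x, rfl⟩
  by_cases hx : x ∈ dyadicCube n R
  · exact Or.inr ⟨x, hx, rfl⟩
  · exact Or.inl (hg.support x hx)

theorem IsDyadicStep.bounded (hR : 0 < R) (hg : IsDyadicStep R N g) : ∃ M : ℝ, ∀ x, ‖g x‖ ≤ M := by
  obtain ⟨M, hM⟩ := (hg.finite_range hR).isBounded.exists_norm_le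
  exact ⟨M, fun x => hM _ ⟨x, rfl⟩⟩

theorem IsDyadicStep.isTreeStep (hR : 0 < R) (hg : IsDyadicStep R N g) :
    IsTreeStep (dyadicTree n hR N) (dyadicCube n R) g where
  measurable := hg.measurable
  bounded := hg.bounded hR
  support := hg.support
  leaf x hx := ⟨dyadicCell R N x, mem_dyadicTree.2 ⟨N, le_rfl, x, hx, rfl⟩, rfl,
    fun _ hy => hg.const _ _ hy⟩

theorem IsDyadicStep.comp (hg : IsDyadicStep R N g) {φ : ℂ → ℂ} (hφ : φ 0 = 0) :
    IsDyadicStep R N (fun x => φ (g x)) :=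
  ⟨fun x hx => by rw [hg.support x hx, hφ], fun x y h => by rw [hg.const x y h]⟩

theorem IsDyadicStep.sub (hg : IsDyadicStep R N g) (hh : IsDyadicStep R N h) :
    IsDyadicStep R N (fun x => g x - h x) :=
  ⟨fun x hx => by rw [hg.support x hx, hh.support x hx, sub_zero],
    fun x y e => by rw [hg.const x y e, hh.const x y e]⟩

theorem isDyadicStep_indicator_const (c : ℂ) :
    IsDyadicStep R N ((dyadicCube n R).indicator fun _ => c) := by
  refine ⟨fun x hx => Set.indicator_of_notMem hx _, fun x y h => ?_⟩
  have h0 : x ∈ dyadicCube n R ↔ y ∈ dyadicCube n R := by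
    rw [dyadicCube, Set.mem_ofPred_eq, Set.mem_ofPred_eq, dyadicIndex_eq_of_le (Nat.zero_le N) h]
  by_cases hx : x ∈ dyadicCube n R
  · rw [Set.indicator_of_mem hx, Set.indicator_of_mem (h0.1 hx)]
  · rw [Set.indicator_of_notMem hx, Set.indicator_of_notMem (mt h0.2 hx)]

theorem IsDyadicStep.memLp (hR : 0 < R) (hg : IsDyadicStep R N g) (p : ℝ≥0∞) :
    MemLp g p volume := by
  obtain ⟨M, hM⟩ := hg.bounded hR
  have : IsFiniteMeasure (volume.restrict (dyadicCube n R)) :=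
    ⟨by rw [Measure.restrict_apply_univ, volume_dyadicCube hR]; exact ENNReal.ofReal_lt_top⟩
  have h : MemLp g p (volume.restrict (dyadicCube n R)) :=
    MemLp.of_bound hg.measurable.aestronglyMeasurable M (Eventually.of_forall hM)
  have e : (dyadicCube n R).indicator g = g :=
    Set.indicator_eq_self.2 fun x hx => by_contra fun hx' => hx (hg.support x hx')
  rwa [← memLp_indicator_iff_restrict measurableSet_dyadicCube, e] at h

/-- A continuous function with compact support is uniformly approximated on the cube by step
functions. -/
theorem exists_isDyadicStep_norm_sub_le (hR : 0 < R) (hg : Continuous g) (hgs : HasCompactSupport g)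
    {ε : ℝ} (hε : 0 < ε) : ∃ N s, IsDyadicStep (n := n) R N s ∧
      ∀ x ∈ dyadicCube n R, ‖g x - s x‖ ≤ ε := by
  obtain ⟨δ, hδ, hgδ⟩ := Metric.uniformContinuous_iff.1
    (hgs.uniformContinuous_of_continuous hg) ε hε
  obtain ⟨N, hN⟩ : ∃ N : ℕ, (n + 1) * dyadicSide R N < δ := by
    have : Tendsto (fun N : ℕ => (n + 1) * dyadicSide R N) atTop (𝓝 0) := by
      have h := (tendsto_pow_atTop_nhds_zero_of_lt_one (r := (1 / 2 : ℝ)) (by norm_num)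
        (by norm_num)).const_mul ((n + 1) * (2 * R))
      rw [mul_zero] at h
      refine h.congr fun N => ?_
      rw [dyadicSide, one_div, inv_pow, mul_assoc, div_eq_mul_inv]
    exact (this.eventually_lt_const hδ).exists
  -- The value of g at a sample point of each cell, chosen through an inverse of the index map.
  let s₀ : EuclideanSpace ℝ (Fin n) → ℂ := fun x =>
    g (Function.invFun (dyadicIndex R N) (dyadicIndex R N x))
  have hs : IsDyadicStep R N ((dyadicCube n R).indicator s₀) := by
    refine ⟨fun x hx => Set.indicator_of_notMem hx _, fun x y h => ?_⟩
    have h0 : x ∈ dyadicCube n R ↔ y ∈ dyadicCube n R := by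
      rw [dyadicCube, Set.mem_ofPred_eq, Set.mem_ofPred_eq, dyadicIndex_eq_of_le (Nat.zero_le N) h]
    by_cases hx : x ∈ dyadicCube n R
    · rw [Set.indicator_of_mem hx, Set.indicator_of_mem (h0.1 hx)]
      simp only [s₀, h]
    · rw [Set.indicator_of_notMem hx, Set.indicator_of_notMem (mt h0.2 hx)]
  refine ⟨N, _, hs, fun x hx => ?_⟩
  rw [Set.indicator_of_mem hx, ← dist_eq_norm, dist_comm]
  refine (hgδ ((dist_le_of_mem_dyadicCell (j := N) hR ?_).trans hN)).le
  exact Function.invFun_eq (f := dyadicIndex R N) ⟨x, rfl⟩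

/-- Step functions are dense among the `L^p` functions supported in the cube. -/
theorem exists_isDyadicStep_eLpNorm_sub_le (hR : 0 < R) {p : ℝ≥0∞} (hp1 : 1 ≤ p) (hp : p ≠ ⊤)
    (hg : MemLp g p volume) (hgs : ∀ x, x ∉ dyadicCube n R → g x = 0) {ε : ℝ≥0∞} (hε : ε ≠ 0) :
    ∃ N s, IsDyadicStep (n := n) R N s ∧ eLpNorm (g - s) p volume ≤ ε := by
  obtain ⟨g', hg's, hgg', hg'c, hg'm⟩ := hg.exists_hasCompactSupport_eLpNorm_sub_le hp
    (ENNReal.half_pos hε).ne'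
  set Q := dyadicCube n R
  have hQm : MeasurableSet Q := measurableSet_dyadicCube
  set c := (volume Q) ^ (1 / p.toReal)
  have hc : c ≠ ⊤ := ENNReal.rpow_ne_top_of_nonneg (by positivity)
    (by rw [volume_dyadicCube hR]; exact ENNReal.ofReal_ne_top)
  obtain ⟨δ, hδ0, hδ⟩ : ∃ δ : ℝ, 0 < δ ∧ c * ENNReal.ofReal δ ≤ ε / 2 := by
    obtain ⟨δ, hδ0, hδ⟩ := ENNReal.exists_nnreal_pos_mul_lt (a := c) (b := ε / 2) hc
      (ENNReal.half_pos hε).ne'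
    exact ⟨δ, hδ0, by rw [ENNReal.ofReal_coe_nnreal, mul_comm]; exact hδ.le⟩
  obtain ⟨N, s, hs, hgs'⟩ := exists_isDyadicStep_norm_sub_le hR hg'c hg's hδ0
  refine ⟨N, s, hs, ?_⟩
  have e : g - s = Q.indicator (g - g') + Q.indicator (g' - s) := by
    ext x
    by_cases hx : x ∈ Q
    · simp [hx]
    · simp [hx, hgs x hx, hs.support x hx]
  rw [e]
  refine (eLpNorm_add_le ((hg.sub hg'm).1.indicator hQm)
    ((hg'm.sub (hs.memLp hR p)).1.indicator hQm) hp1).trans ?_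
  rw [← ENNReal.add_halves ε]
  refine add_le_add ((eLpNorm_indicator_le _).trans hgg') ?_
  rw [eLpNorm_indicator_eq_eLpNorm_restrict hQm]
  refine (eLpNorm_le_of_ae_bound (C := δ) ?_).trans ?_
  · exact (ae_restrict_iff' hQm).2 (Eventually.of_forall fun x hx => hgs' x hx)
  · rwa [Measure.restrict_apply_univ, ← one_div]

end Dyadic

/-! ### Duality and density with step functions -/

section DyadicDuality

variable {n : ℕ} {R : ℝ}

theorem volume_dyadicCube_ne_top (hR : 0 < R) : volume (dyadicCube n R) ≠ ⊤ := by
  rw [volume_dyadicCube hR]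
  exact ENNReal.ofReal_ne_top

theorem indicator_dyadicCube_eq_self {g : EuclideanSpace ℝ (Fin n) → ℂ}
    (h : ∀ x, x ∉ dyadicCube n R → g x = 0) : (dyadicCube n R).indicator g = g :=
  Set.indicator_eq_self.2 fun x hx => by_contra fun hx' => hx (h x hx')

theorem memLp_of_bounded_of_support (hR : 0 < R) {g : EuclideanSpace ℝ (Fin n) → ℂ}
    (hg : Measurable g) {M : ℝ} (hM : ∀ x, ‖g x‖ ≤ M) (hs : ∀ x, x ∉ dyadicCube n R → g x = 0)
    (p : ℝ≥0∞) : MemLp g p volume := by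
  have : IsFiniteMeasure (volume.restrict (dyadicCube n R)) :=
    ⟨by rw [Measure.restrict_apply_univ]; exact (volume_dyadicCube_ne_top hR).lt_top⟩
  have h : MemLp g p (volume.restrict (dyadicCube n R)) :=
    MemLp.of_bound hg.aestronglyMeasurable M (Eventually.of_forall hM)
  rwa [← memLp_indicator_iff_restrict measurableSet_dyadicCube, indicator_dyadicCube_eq_self hs]
    at h

/-- A bounded measurable function supported in the cube is the limit almost everywhere of a bounded
sequence of step functions. -/
theorem exists_seq_isDyadicStep (hR : 0 < R) {g : EuclideanSpace ℝ (Fin n) → ℂ}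
    (hg : Measurable g) {M : ℝ} (hM : ∀ x, ‖g x‖ ≤ M) (hs : ∀ x, x ∉ dyadicCube n R → g x = 0) :
    ∃ (N : ℕ → ℕ) (s : ℕ → EuclideanSpace ℝ (Fin n) → ℂ), (∀ m, IsDyadicStep R (N m) (s m)) ∧
      (∀ m x, ‖s m x‖ ≤ M + 1) ∧ ∀ᵐ x, Tendsto (fun m => s m x) atTop (𝓝 (g x)) := by
  have hg1 := memLp_of_bounded_of_support hR hg hM hs 1
  choose N s hstep hsg using fun m : ℕ => exists_isDyadicStep_eLpNorm_sub_le hR le_rfl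
    ENNReal.one_ne_top hg1 hs (ε := ((m : ℝ≥0∞) + 1)⁻¹)
    (ENNReal.inv_ne_zero.2 (by finiteness))
  have hlim : Tendsto (fun m => eLpNorm (s m - g) 1 volume) atTop (𝓝 0) := by
    refine tendsto_of_tendsto_of_tendsto_of_le_of_le tendsto_const_nhds
      (g := fun _ => 0) (h := fun m : ℕ => ((m : ℝ≥0∞) + 1)⁻¹) ?_ (fun _ => zero_le)
      fun m => by rw [eLpNorm_sub_comm]; exact hsg m
    have := ENNReal.tendsto_inv_nat_nhds_zero.comp (tendsto_add_atTop_nat 1)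
    refine this.congr fun m => ?_
    simp
  obtain ⟨k, -, hk⟩ := (tendstoInMeasure_of_tendsto_eLpNorm one_ne_zero
    (fun m => (hstep m).measurable.aestronglyMeasurable) hg.aestronglyMeasurable
    hlim).exists_seq_tendsto_ae
  have hM0 : 0 ≤ M := (norm_nonneg _).trans (hM 0)
  -- Values larger than M + 1 are replaced by zero. The result is again a step function, and at a
  -- point of convergence the truncation is eventually inactive since |g| ≤ M.
  refine ⟨fun m => N (k m), fun m x => if ‖s (k m) x‖ ≤ M + 1 then s (k m) x else 0,
    fun m => (hstep (k m)).comp (φ := fun z => if ‖z‖ ≤ M + 1 then z else 0) (by simp),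
    fun m x => ?_, ?_⟩
  · dsimp only
    split_ifs with h
    · exact h
    · simp; linarith
  · filter_upwards [hk] with x hx
    refine hx.congr' ?_
    filter_upwards [hx.norm.eventually_lt_const (show ‖g x‖ < M + 1 by linarith [hM x])] with m hm
    rw [if_pos hm.le]

/-- An inequality of Hölder type for step functions extends to bounded measurable functions. -/
theorem norm_integral_mul_le_of_isDyadicStep (hR : 0 < R) {q C : ℝ} (hq : 0 < q)
    {u : EuclideanSpace ℝ (Fin n) → ℂ} (hu : IntegrableOn u (dyadicCube n R))
    (h : ∀ N s, IsDyadicStep R N s → ‖∫ x, u x * s x‖ ≤ C * (∫ x, ‖s x‖ ^ q) ^ (1 / q))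
    {g : EuclideanSpace ℝ (Fin n) → ℂ} (hg : Measurable g) {M : ℝ} (hM : ∀ x, ‖g x‖ ≤ M)
    (hs : ∀ x, x ∉ dyadicCube n R → g x = 0) :
    ‖∫ x, u x * g x‖ ≤ C * (∫ x, ‖g x‖ ^ q) ^ (1 / q) := by
  obtain ⟨N, s, hstep, hsM, hlim⟩ := exists_seq_isDyadicStep hR hg hM hs
  set Q := dyadicCube n R
  have hQm : MeasurableSet Q := measurableSet_dyadicCube
  have hM0 : 0 ≤ M := (norm_nonneg _).trans (hM 0)
  have hu' : Integrable (Q.indicator u) volume := (integrable_indicator_iff hQm).2 hu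
  have e : ∀ f : EuclideanSpace ℝ (Fin n) → ℂ, (∀ x, x ∉ Q → f x = 0) →
      (fun x => u x * f x) = fun x => Q.indicator u x * f x := fun f hf => by
    ext x
    by_cases hx : x ∈ Q
    · simp [hx]
    · simp [hf x hx]
  have h1 : Tendsto (fun m => ∫ x, u x * s m x) atTop (𝓝 (∫ x, u x * g x)) := by
    simp_rw [fun m => e (s m) (hstep m).support, e g hs]
    refine tendsto_integral_of_dominated_convergence (fun x => ‖Q.indicator u x‖ * (M + 1))
      (fun m => hu'.aestronglyMeasurable.mul (hstep m).measurable.aestronglyMeasurable)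
      (hu'.norm.mul_const _) (fun m => Eventually.of_forall fun x => ?_) ?_
    · rw [norm_mul]
      exact mul_le_mul_of_nonneg_left (hsM m x) (norm_nonneg _)
    · filter_upwards [hlim] with x hx
      exact hx.const_mul _
  have h2 : Tendsto (fun m => ∫ x, ‖s m x‖ ^ q) atTop (𝓝 (∫ x, ‖g x‖ ^ q)) := by
    refine tendsto_integral_of_dominated_convergence (Q.indicator fun _ => (M + 1) ^ q)
      (fun m => ((hstep m).measurable.norm.pow_const q).aestronglyMeasurable)
      ((integrable_indicator_iff hQm).2 (integrableOn_const (volume_dyadicCube_ne_top hR)))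
      (fun m => Eventually.of_forall fun x => ?_) ?_
    · rw [Real.norm_of_nonneg (by positivity)]
      by_cases hx : x ∈ Q
      · rw [Set.indicator_of_mem hx]
        exact Real.rpow_le_rpow (norm_nonneg _) (hsM m x) hq.le
      · rw [Set.indicator_of_notMem hx, (hstep m).support x hx, norm_zero, Real.zero_rpow hq.ne']
    · filter_upwards [hlim] with x hx
      exact hx.norm.rpow_const (Or.inr hq.le)
  exact le_of_tendsto_of_tendsto' h1.norm
    ((h2.rpow_const (Or.inr (by positivity))).const_mul C) fun m => h _ _ (hstep m)

/-- The converse of Hölder's inequality on a cube, with step functions as test functions. -/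
theorem eLpNorm_le_of_isDyadicStep (hR : 0 < R) {r q C : ℝ} (hrq : r.HolderConjugate q)
    (hC : 0 ≤ C) {u : EuclideanSpace ℝ (Fin n) → ℂ} (hum : Measurable u)
    (hu : IntegrableOn u (dyadicCube n R))
    (h : ∀ N s, IsDyadicStep R N s → ‖∫ x, u x * s x‖ ≤ C * (∫ x, ‖s x‖ ^ q) ^ (1 / q)) :
    eLpNorm u (ENNReal.ofReal r) (volume.restrict (dyadicCube n R)) ≤ ENNReal.ofReal C := by
  set Q := dyadicCube n R
  have hQm : MeasurableSet Q := measurableSet_dyadicCube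
  have hr := hrq.pos
  have hr1 := hrq.lt
  have hq := hrq.symm.pos
  let E : ℕ → Set (EuclideanSpace ℝ (Fin n)) := fun m => Q ∩ {x | ‖u x‖ ≤ m}
  have hE : ∀ m, MeasurableSet (E m) := fun m => hQm.inter (measurableSet_le hum.norm
    measurable_const)
  have hEt : ∀ m, volume (E m) ≠ ⊤ := fun m =>
    ne_top_of_le_ne_top (volume_dyadicCube_ne_top hR) (measure_mono Set.inter_subset_left)
  have key : ∀ m : ℕ, ∫⁻ x in E m, ‖u x‖ₑ ^ r ≤ ENNReal.ofReal C ^ r := by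
    intro m
    -- The extremal function of Hölder's inequality, cut off where |u| > m. The cutoff makes the
    -- integral A finite, so that A ≤ C A^(1/q) may be divided by A^(1/q).
    let g : EuclideanSpace ℝ (Fin n) → ℂ :=
      (E m).indicator fun x => (starRingEnd ℂ) (u x) * ((‖u x‖ ^ (r - 2) : ℝ) : ℂ)
    have hgm : Measurable g := by
      refine Measurable.indicator ?_ (hE m)
      exact (Complex.continuous_conj.measurable.comp hum).mul
        (Complex.measurable_ofReal.comp (hum.norm.pow_const _))
    have hn : ∀ x, ‖(starRingEnd ℂ) (u x) * ((‖u x‖ ^ (r - 2) : ℝ) : ℂ)‖ = ‖u x‖ ^ (r - 1) := by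
      intro x
      rw [norm_mul, RCLike.norm_conj, Complex.norm_real, Real.norm_of_nonneg (by positivity)]
      rcases (norm_nonneg (u x)).eq_or_lt with h0 | h0
      · rw [← h0, zero_mul, Real.zero_rpow (by linarith)]
      · nth_rw 1 [← Real.rpow_one ‖u x‖]
        rw [← Real.rpow_add h0]
        congr 1
        ring
    have hgM : ∀ x, ‖g x‖ ≤ (m : ℝ) ^ (r - 1) := fun x => by
      by_cases hx : x ∈ E m
      · simp only [g]
        rw [Set.indicator_of_mem hx, hn]
        exact Real.rpow_le_rpow (norm_nonneg _) hx.2 (by linarith)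
      · simp only [g]
        rw [Set.indicator_of_notMem hx, norm_zero]
        positivity
    have hgs : ∀ x, x ∉ Q → g x = 0 := fun x hx => Set.indicator_of_notMem (fun h => hx h.1) _
    have h1 := norm_integral_mul_le_of_isDyadicStep hR hq hu h hgm hgM hgs
    have e1 : (fun x => u x * g x) = (E m).indicator fun x => ((‖u x‖ ^ r : ℝ) : ℂ) := by
      ext x
      by_cases hx : x ∈ E m
      · simp only [g]
        rw [Set.indicator_of_mem hx, Set.indicator_of_mem hx, ← mul_assoc, Complex.mul_conj,
          Complex.normSq_eq_norm_sq, ← Complex.ofReal_mul]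
        congr 1
        rcases (norm_nonneg (u x)).eq_or_lt with h0 | h0
        · rw [← h0, Real.zero_rpow hr.ne']
          simp
        · rw [← Real.rpow_natCast, ← Real.rpow_add h0]
          congr 1
          push_cast
          ring
      · simp [g, hx]
    have e2 : (fun x => ‖g x‖ ^ q) = (E m).indicator fun x => ‖u x‖ ^ r := by
      ext x
      by_cases hx : x ∈ E m
      · simp only [g]
        rw [Set.indicator_of_mem hx, Set.indicator_of_mem hx, hn, ← Real.rpow_mul (norm_nonneg _)]
        congr 1
        exact hrq.sub_one_mul_conj
      · simp [g, hx, Real.zero_rpow hq.ne']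
    set A := ∫ x in E m, ‖u x‖ ^ r
    have hA0 : 0 ≤ A := integral_nonneg fun x => by positivity
    have hAC : A ≤ C * A ^ (1 / q) := by
      rw [e1, e2, integral_indicator (hE m), integral_indicator (hE m), integral_complex_ofReal,
        Complex.norm_real, Real.norm_of_nonneg hA0] at h1
      exact h1
    have hAr : A ≤ C ^ r := by
      rcases hA0.eq_or_lt with h0 | h0
      · rw [← h0]; positivity
      · have h3 : A ^ (1 / r) * A ^ (1 / q) = A := by
          rw [← Real.rpow_add h0, one_div, one_div, hrq.inv_add_inv_eq_one, Real.rpow_one]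
        have h4 : A ^ (1 / r) ≤ C := by
          nth_rw 1 [← h3] at hAC
          exact le_of_mul_le_mul_right hAC (by positivity)
        calc A = (A ^ (1 / r)) ^ r := by
              rw [← Real.rpow_mul hA0, one_div, inv_mul_cancel₀ hr.ne', Real.rpow_one]
          _ ≤ _ := Real.rpow_le_rpow (by positivity) h4 hr.le
    have hint : IntegrableOn (fun x => ‖u x‖ ^ r) (E m) := by
      refine Measure.integrableOn_of_bounded (M := (m : ℝ) ^ r) (hEt m)
        (hum.norm.pow_const r).aestronglyMeasurable ((ae_restrict_iff' (hE m)).2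
        (Eventually.of_forall fun x hx => ?_))
      rw [Real.norm_of_nonneg (by positivity)]
      exact Real.rpow_le_rpow (norm_nonneg _) hx.2 hr.le
    calc ∫⁻ x in E m, ‖u x‖ₑ ^ r = ENNReal.ofReal A := by
          rw [ofReal_integral_eq_lintegral_ofReal hint
            (Eventually.of_forall fun x => by positivity)]
          refine lintegral_congr fun x => ?_
          rw [← ENNReal.ofReal_rpow_of_nonneg (norm_nonneg _) hr.le, ofReal_norm]
      _ ≤ ENNReal.ofReal (C ^ r) := ENNReal.ofReal_le_ofReal hAr
      _ = _ := (ENNReal.ofReal_rpow_of_nonneg hC hr.le).symm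
  have hU : ⋃ m, E m = Q := by
    rw [← Set.inter_iUnion, Set.inter_eq_left]
    intro x _
    obtain ⟨m, hm⟩ := exists_nat_ge ‖u x‖
    exact Set.mem_iUnion.2 ⟨m, hm⟩
  have hmono : Monotone E := fun a b hab x hx =>
    ⟨hx.1, (show ‖u x‖ ≤ a from hx.2).trans (Nat.cast_le.2 hab)⟩
  rw [eLpNorm_eq_lintegral_rpow_enorm_toReal (by simpa using hr) ENNReal.ofReal_ne_top,
    ENNReal.toReal_ofReal hr.le, one_div, ENNReal.rpow_inv_le_iff hr, ← hU,
    setLIntegral_iUnion_of_directed _ hmono.directed_le]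
  exact iSup_le key

/-- Step functions of integral zero are dense in `L^p` for `1 < p < ∞`. -/
theorem exists_isDyadicStep_integral_eq_zero (hn : 1 ≤ n) {p : ℝ} (hp : 1 < p)
    {f : EuclideanSpace ℝ (Fin n) → ℂ} (hf : MemLp f (ENNReal.ofReal p) volume) {ε : ℝ}
    (hε : 0 < ε) : ∃ R N s, 0 < R ∧ IsDyadicStep (n := n) R N s ∧ ∫ x, s x = 0 ∧
      eLpNorm (f - s) (ENNReal.ofReal p) volume ≤ ENNReal.ofReal ε := by
  set P := ENNReal.ofReal p
  have hP1 : 1 ≤ P := by simpa [P] using hp.le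
  have hPt : P ≠ ⊤ := ENNReal.ofReal_ne_top
  have hp0 : 0 < p := by linarith
  obtain ⟨g, hgs, hfg, hgc, hgm⟩ := hf.exists_hasCompactSupport_eLpNorm_sub_le hPt
    (ε := ENNReal.ofReal (ε / 4)) (by simpa using hε)
  set m := ‖∫ x, g x‖
  have hd : 0 < 1 - 1 / p := by
    rw [sub_pos, div_lt_one hp0]; exact hp
  obtain ⟨R₀, hR₀⟩ := hgs.isCompact.isBounded.subset_ball (0 : EuclideanSpace ℝ (Fin n))
  -- The mean is removed by subtracting a constant on a cube of volume V, which costs |∫ s| V^(-(1 -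
  -- 1/p)) in L^p. For p > 1 the part of this coming from ∫ g becomes small on large cubes.
  have hlim : Tendsto (fun R : ℝ => m * ((2 * R) ^ n) ^ (-(1 - 1 / p))) atTop (𝓝 (m * 0)) := by
    refine ((tendsto_rpow_neg_atTop hd).comp ?_).const_mul m
    exact (tendsto_pow_atTop (by omega)).comp (tendsto_id.const_mul_atTop two_pos)
  rw [mul_zero] at hlim
  obtain ⟨R, hRm, hR0, hR⟩ := ((hlim.eventually_le_const (show 0 < ε / 4 by positivity)).and
    ((eventually_ge_atTop R₀).and (eventually_gt_atTop 0))).exists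
  have hsupp : ∀ x, x ∉ dyadicCube n R → g x = 0 := fun x hx => by
    by_contra h
    exact hx (ball_subset_dyadicCube hR (Metric.ball_subset_ball hR0
      (hR₀ (subset_tsupport g h))))
  obtain ⟨N, s, hs, hgs'⟩ := exists_isDyadicStep_eLpNorm_sub_le hR hP1 hPt hgm hsupp
    (ε := ENNReal.ofReal (ε / 4)) (by simpa using hε)
  set Q := dyadicCube n R
  have hQm : MeasurableSet Q := measurableSet_dyadicCube
  set V : ℝ := (2 * R) ^ n
  have hV : 0 < V := by positivity
  have hvol : volume Q = ENNReal.ofReal V := volume_dyadicCube hR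
  have hvr : volume.real Q = V := measureReal_dyadicCube hR
  have hsi : Integrable s volume := memLp_one_iff_integrable.1 (hs.memLp hR 1)
  have hgi : Integrable g volume := hgc.integrable_of_hasCompactSupport hgs
  have hints : ‖∫ x, s x‖ ≤ m + ε / 4 * V ^ (1 - 1 / p) := by
    have h1 : ‖∫ x, (g - s) x‖ ≤ ε / 4 * V ^ (1 - 1 / p) := by
      have e : Q.indicator (g - s) = g - s :=
        indicator_dyadicCube_eq_self fun x hx => by simp [hsupp x hx, hs.support x hx]
      have h2 : ‖∫ x, (g - s) x‖ₑ ≤ ENNReal.ofReal (ε / 4 * V ^ (1 - 1 / p)) := by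
        calc ‖∫ x, (g - s) x‖ₑ ≤ eLpNorm (g - s) 1 volume := by
              rw [eLpNorm_one_eq_lintegral_enorm]
              exact enorm_integral_le_lintegral_enorm _
          _ = eLpNorm (g - s) 1 (volume.restrict Q) := by
              rw [← eLpNorm_indicator_eq_eLpNorm_restrict hQm, e]
          _ ≤ eLpNorm (g - s) P (volume.restrict Q) *
              (volume.restrict Q Set.univ) ^ (1 / (1 : ℝ≥0∞).toReal - 1 / P.toReal) :=
              eLpNorm_le_eLpNorm_mul_rpow_measure_univ hP1
                (hgc.measurable.sub hs.measurable).aestronglyMeasurable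
          _ ≤ ENNReal.ofReal (ε / 4) * ENNReal.ofReal V ^ (1 - 1 / p) := by
              rw [Measure.restrict_apply_univ, hvol, ENNReal.toReal_ofReal hp0.le]
              simp only [ENNReal.toReal_one, div_one]
              gcongr
              exact (eLpNorm_restrict_le _ _ _ _).trans hgs'
          _ = _ := by
              rw [ENNReal.ofReal_rpow_of_pos hV, ← ENNReal.ofReal_mul (by positivity)]
      rw [← ofReal_norm] at h2
      exact (ENNReal.ofReal_le_ofReal_iff (by positivity)).1 h2
    have h3 : ∫ x, s x = (∫ x, g x) - ∫ x, (g - s) x := by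
      rw [← integral_sub hgi (hgi.sub hsi)]
      simp
    rw [h3]
    exact (norm_sub_le _ _).trans (by gcongr)
  set c : ℂ := (∫ x, s x) / V
  refine ⟨R, N, fun x => s x - Q.indicator (fun _ => c) x, hR,
    hs.sub (isDyadicStep_indicator_const c), ?_, ?_⟩
  · rw [integral_sub hsi (memLp_one_iff_integrable.1
      ((isDyadicStep_indicator_const (N := N) c).memLp hR 1)), integral_indicator hQm,
      setIntegral_const, hvr, Complex.real_smul, mul_div_cancel₀ _ (by exact_mod_cast hV.ne'),
      sub_self]
  · have e : (f - fun x => s x - Q.indicator (fun _ => c) x) =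
        (f - g) + ((g - s) + Q.indicator fun _ => c) := by
      ext x
      simp only [Pi.sub_apply, Pi.add_apply]
      ring
    rw [e]
    have hci := (isDyadicStep_indicator_const (n := n) (R := R) (N := N) c).memLp hR P
    have hgsm := hgm.sub (hs.memLp hR P)
    have hcn : eLpNorm (Q.indicator fun _ => c) P volume ≤ ENNReal.ofReal (ε / 4 + ε / 4) := by
      rw [eLpNorm_indicator_const hQm (by simpa [P] using hp0) hPt, hvol,
        ENNReal.toReal_ofReal hp0.le, ENNReal.ofReal_rpow_of_pos hV, ← ofReal_norm,
        ← ENNReal.ofReal_mul (norm_nonneg _)]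
      refine ENNReal.ofReal_le_ofReal ?_
      have h5 : V ^ (1 / p) = V * V ^ (-(1 - 1 / p)) := by
        nth_rw 2 [← Real.rpow_one V]
        rw [← Real.rpow_add hV]
        congr 1
        ring
      calc ‖c‖ * V ^ (1 / p) = ‖∫ x, s x‖ * V ^ (-(1 - 1 / p)) := by
            rw [h5, norm_div, Complex.norm_real, Real.norm_of_nonneg hV.le]
            field_simp
        _ ≤ (m + ε / 4 * V ^ (1 - 1 / p)) * V ^ (-(1 - 1 / p)) := by gcongr
        _ = m * V ^ (-(1 - 1 / p)) + ε / 4 * (V ^ (1 - 1 / p) * V ^ (-(1 - 1 / p))) := by ring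
        _ = m * V ^ (-(1 - 1 / p)) + ε / 4 := by
            rw [← Real.rpow_add hV, add_neg_cancel, Real.rpow_zero, mul_one]
        _ ≤ _ := by gcongr
    calc _ ≤ eLpNorm (f - g) P volume + (eLpNorm (g - s) P volume +
          eLpNorm (Q.indicator fun _ => c) P volume) :=
          (eLpNorm_add_le (hf.sub hgm).1 (hgsm.add hci).1 hP1).trans
            (add_le_add le_rfl (eLpNorm_add_le hgsm.1 hci.1 hP1))
      _ ≤ ENNReal.ofReal (ε / 4) + (ENNReal.ofReal (ε / 4) + ENNReal.ofReal (ε / 4 + ε / 4)) := by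
          gcongr
      _ = ENNReal.ofReal ε := by
          rw [← ENNReal.ofReal_add (by positivity) (by positivity),
            ← ENNReal.ofReal_add (by positivity) (by positivity)]
          congr 1
          ring

end DyadicDuality

/-! ### Atoms with interpolation weights -/

section DyadicAtoms

variable {n : ℕ} {R : ℝ} {N : ℕ}

theorem dyadicCube_subset_ball (hR : 0 < R) :
    dyadicCube n R ⊆ Metric.ball 0 ((n + 1) * (2 * R)) := fun x hx => by
  rw [← dyadicCube_eq_cell (zero_mem_dyadicCube hR)] at hx
  have := dist_le_of_mem_dyadicCell hR hx
  rwa [dyadicSide_zero] at this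

theorem IsDyadicStep.isTest {g : EuclideanSpace ℝ (Fin n) → ℂ} (hR : 0 < R)
    (hg : IsDyadicStep R N g) : IsTest g :=
  ⟨hg.measurable, hg.bounded hR, _, fun x hx => hg.support x fun h => hx
    (dyadicCube_subset_ball hR h)⟩

/-- The atomic decomposition of a step function of integral zero, with the coefficients `lam i` by
which it is deformed along the interpolation scale. -/
theorem exists_dyadic_atoms (hn : 1 ≤ n) {p pθ q r θ : ℝ}
    (hpθ : 1 / pθ = (1 - θ) / p) (hpq : p.HolderConjugate q) (hpr : pθ.HolderConjugate r) :
    ∃ C : ℝ, 0 < C ∧ ∀ (R : ℝ) (N : ℕ) (g : EuclideanSpace ℝ (Fin n) → ℂ), 0 < R →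
      IsDyadicStep R N g → ∫ x, g x = 0 → eLpNorm g (ENNReal.ofReal r) volume ≤ 1 →
      ∃ (I : Finset (Σ _ : ℕ, Set (EuclideanSpace ℝ (Fin n))))
        (lam H ρ : (Σ _ : ℕ, Set (EuclideanSpace ℝ (Fin n))) → ℝ)
        (c : (Σ _ : ℕ, Set (EuclideanSpace ℝ (Fin n))) → EuclideanSpace ℝ (Fin n))
        (a : (Σ _ : ℕ, Set (EuclideanSpace ℝ (Fin n))) → EuclideanSpace ℝ (Fin n) → ℂ),
        (∀ i, 0 < lam i) ∧ (∀ i, 0 < H i) ∧ (∀ i, 0 < ρ i) ∧ (∀ i, IsTest (a i)) ∧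
        (∀ i, ∫ x, a i x = 0) ∧ (∀ i x, ‖a i x‖ ≤ H i) ∧
        (∀ i x, x ∉ Metric.ball (c i) (ρ i) → a i x = 0) ∧ (∀ x, g x = ∑ i ∈ I, a i x) ∧
        ∑ i ∈ I, lam i ^ (1 - θ) * (H i * ρ i ^ n) ≤ C ∧
        ∀ ε : (Σ _ : ℕ, Set (EuclideanSpace ℝ (Fin n))) → ℂ, (∀ i, ‖ε i‖ ≤ 1) →
          eLpNorm (fun x => ∑ i ∈ I, (ε i * (lam i ^ (-θ) : ℝ)) * a i x) (ENNReal.ofReal q) volume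
            ≤ ENNReal.ofReal C := by
  classical
  have hp0 := hpq.pos
  have hq0 := hpq.symm.pos
  have hr1 := hpr.symm.lt
  have hr0 := hpr.symm.pos
  have hiq : q⁻¹ = 1 - p⁻¹ := by linarith [hpq.inv_add_inv_eq_one]
  have hir : r⁻¹ = 1 - (1 - θ) * p⁻¹ := by
    have := hpr.inv_add_inv_eq_one
    rw [← one_div pθ, hpθ, div_eq_mul_inv] at this
    linarith
  -- With s = r/q the exponent r/s is q. The exponents satisfy 1/r = 1/q + θ/p, so λ = height^(r/p)
  -- gives λ^(-θ) = height^(s-1) and λ^(1-θ) = height^(r-1): exactly the two sums that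
  -- `exists_atoms` controls.
  obtain ⟨C₁, hC₁, hC₁'⟩ := exists_atoms (volume : Measure (EuclideanSpace ℝ (Fin n))) hr1
    (s := r / q) (D := 2 ^ n) (by positivity) (one_le_pow₀ one_le_two)
  have hrq : r / (r / q) = q := by field_simp
  have e1 : r / p * -θ = r / q - 1 := by
    have : r * (r⁻¹ - q⁻¹) = r * (θ * p⁻¹) := by rw [hiq, hir]; ring
    rw [mul_sub, mul_inv_cancel₀ hr0.ne'] at this
    rw [div_eq_mul_inv, div_eq_mul_inv]
    linarith
  have e2 : r / p * (1 - θ) = r - 1 := by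
    have : r * r⁻¹ = r * (1 - (1 - θ) * p⁻¹) := by rw [hir]
    rw [mul_inv_cancel₀ hr0.ne'] at this
    rw [div_eq_mul_inv]
    linarith
  rw [hrq] at hC₁'
  refine ⟨C₁ * (n + 1) ^ n * C₁ + C₁ ^ (1 / q), by positivity, fun R N g hR hg h0 hg1 => ?_⟩
  have hgr : ∫ x, ‖g x‖ ^ r ≤ 1 := by
    have hm := hg.memLp hR (ENNReal.ofReal r)
    rw [hm.eLpNorm_eq_integral_rpow_norm (by simpa using hr0) ENNReal.ofReal_ne_top,
      ENNReal.toReal_ofReal hr0.le, ← ENNReal.ofReal_one,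
      ENNReal.ofReal_le_ofReal_iff zero_le_one] at hg1
    have h1 : 0 ≤ ∫ x, ‖g x‖ ^ r := integral_nonneg fun x => by positivity
    calc _ = ((∫ x, ‖g x‖ ^ r) ^ r⁻¹) ^ r := by
          rw [← Real.rpow_mul h1, inv_mul_cancel₀ hr0.ne', Real.rpow_one]
      _ ≤ 1 := Real.rpow_le_one (by positivity) hg1 hr0.le
  obtain ⟨I, ht, a, hht, hmem, ham, haH, hasupp, ha0, hsum, hI1, hI2⟩ :=
    hC₁' _ _ g (isLaminarTree_dyadicTree hn hR N) (hg.isTreeStep hR) h0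
  choose! c ρ hρ hball hvol using fun i (hi : i ∈ I) => exists_ball_of_mem_dyadicTree (hmem i hi)
  have hsm : ∀ {f : (Σ _ : ℕ, Set (EuclideanSpace ℝ (Fin n))) → ℂ}
      {F : (Σ _ : ℕ, Set (EuclideanSpace ℝ (Fin n))) → EuclideanSpace ℝ (Fin n) → ℂ}
      (x : EuclideanSpace ℝ (Fin n)), ∑ i ∈ I, f i * (if i ∈ I then F i else 0) x =
        ∑ i ∈ I, f i * F i x := fun x =>
    Finset.sum_congr rfl fun i hi => by rw [if_pos hi]
  -- The atoms are known only for indices in I. Outside of I, radius 1 and the zero atom make the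
  -- required properties hold for all indices.
  refine ⟨I, fun i => ht i ^ (r / p), fun i => C₁ * ht i, fun i => if i ∈ I then ρ i else 1, c,
    fun i => if i ∈ I then a i else 0, fun i => Real.rpow_pos_of_pos (hht i) _,
    fun i => mul_pos hC₁ (hht i), fun i => ?_, fun i => ?_, fun i => ?_, fun i x => ?_,
    fun i x hx => ?_, fun x => ?_, ?_, fun ε hε => ?_⟩
  · dsimp only
    split_ifs with hi
    · exact hρ i hi
    · exact one_pos
  · dsimp only
    split_ifs with hi
    · refine ⟨ham i hi, ⟨_, haH i hi⟩, _, fun x hx => hasupp i hi x fun h => hx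
        (dyadicCube_subset_ball hR ((isLaminarTree_dyadicTree hn hR N).subset_top _ (hmem i hi) h))⟩
    · exact ⟨measurable_zero, ⟨0, by simp⟩, 0, by simp⟩
  · dsimp only
    split_ifs with hi
    · exact ha0 i hi
    · simp
  · dsimp only
    split_ifs with hi
    · exact haH i hi x
    · simpa using (mul_pos hC₁ (hht i)).le
  · dsimp only at hx ⊢
    split_ifs at hx ⊢ with hi
    · exact hasupp i hi x fun h => hx (hball i hi h)
    · rfl
  · simpa using (hsum x).trans (by simpa using (hsm (f := fun _ => 1) (F := a) x).symm)
  · calc _ ≤ ∑ i ∈ I, C₁ * (n + 1) ^ n * (ht i ^ r * volume.real i.2) := by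
          refine Finset.sum_le_sum fun i hi => ?_
          dsimp only
          rw [if_pos hi, ← Real.rpow_mul (hht i).le, e2]
          have h1 : ht i ^ r = ht i ^ (r - 1) * ht i := by
            nth_rw 3 [← Real.rpow_one (ht i)]
            rw [← Real.rpow_add (hht i), sub_add_cancel]
          have h2 : 0 < ht i ^ (r - 1) := Real.rpow_pos_of_pos (hht i) _
          calc ht i ^ (r - 1) * (C₁ * ht i * ρ i ^ n)
              ≤ ht i ^ (r - 1) * (C₁ * ht i * ((n + 1) ^ n * volume.real i.2)) :=
                mul_le_mul_of_nonneg_left (mul_le_mul_of_nonneg_left (hvol i hi)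
                  (mul_pos hC₁ (hht i)).le) h2.le
            _ = _ := by rw [h1]; ring
      _ ≤ C₁ * (n + 1) ^ n * (C₁ * 1) := by
          rw [← Finset.mul_sum]
          exact mul_le_mul_of_nonneg_left (hI1.trans (by gcongr)) (by positivity)
      _ ≤ _ := by
          have : 0 < C₁ ^ (1 / q) := by positivity
          rw [mul_one]
          linarith
  · rw [eLpNorm_eq_lintegral_rpow_enorm_toReal (by simpa using hq0) ENNReal.ofReal_ne_top,
      ENNReal.toReal_ofReal hq0.le]
    have hle : ∫⁻ x, ‖∑ i ∈ I, (ε i * ((ht i ^ (r / p)) ^ (-θ) : ℝ)) *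
        (if i ∈ I then a i else 0) x‖ₑ ^ q ≤ ENNReal.ofReal C₁ := by
      refine (lintegral_mono fun x => ?_).trans (hI2.trans (ENNReal.ofReal_le_ofReal
        (mul_le_of_le_one_right hC₁.le hgr)))
      rw [hsm, ← ENNReal.ofReal_rpow_of_nonneg (Finset.sum_nonneg fun i _ => mul_nonneg
        (Real.rpow_nonneg (hht i).le _) (norm_nonneg _)) hq0.le, ← ofReal_norm]
      refine ENNReal.rpow_le_rpow (ENNReal.ofReal_le_ofReal ((norm_sum_le _ _).trans
        (Finset.sum_le_sum fun i hi => ?_))) hq0.le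
      have h2 : 0 < ht i ^ (r / q - 1) := Real.rpow_pos_of_pos (hht i) _
      rw [← Real.rpow_mul (hht i).le, e1, norm_mul, norm_mul, Complex.norm_real,
        Real.norm_of_nonneg h2.le]
      exact mul_le_mul_of_nonneg_right (mul_le_of_le_one_left h2.le (hε i)) (norm_nonneg _)
    calc _ ≤ ENNReal.ofReal C₁ ^ (1 / q) := ENNReal.rpow_le_rpow hle (by positivity)
      _ = ENNReal.ofReal (C₁ ^ (1 / q)) := ENNReal.ofReal_rpow_of_pos hC₁
      _ ≤ _ := ENNReal.ofReal_le_ofReal (le_add_of_nonneg_left (by positivity))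

end DyadicAtoms

/-! ### Pairing step functions with the interpolation space of Lebesgue space and BMO -/

section BMOLower

variable {n : ℕ}

/-- The converse of Hölder's inequality on a cube, in terms of extended norms. -/
theorem eLpNorm_le_of_enorm_integral_le {R : ℝ} (hR : 0 < R) {r q C : ℝ}
    (hrq : r.HolderConjugate q) (hC : 0 ≤ C) {u : EuclideanSpace ℝ (Fin n) → ℂ}
    (hum : Measurable u) (hu : IntegrableOn u (dyadicCube n R))
    (h : ∀ N s, IsDyadicStep R N s →
      ‖∫ x, u x * s x‖ₑ ≤ ENNReal.ofReal C * eLpNorm s (ENNReal.ofReal q) volume) :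
    eLpNorm u (ENNReal.ofReal r) (volume.restrict (dyadicCube n R)) ≤ ENNReal.ofReal C := by
  refine eLpNorm_le_of_isDyadicStep hR hrq hC hum hu fun N s hs => ?_
  have hq := hrq.symm.pos
  have := h N s hs
  rw [(hs.memLp hR _).eLpNorm_eq_integral_rpow_norm (by simpa using hq) ENNReal.ofReal_ne_top,
    ENNReal.toReal_ofReal hq.le, ← ENNReal.ofReal_mul hC, ← ofReal_norm] at this
  rw [one_div]
  exact (ENNReal.ofReal_le_ofReal_iff (mul_nonneg hC (Real.rpow_nonneg
    (integral_nonneg fun x => by positivity) _))).1 this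

/-- A homogeneous bound holds for all functions if it holds for the functions of norm at most
one. -/
theorem enorm_integral_le_of_eLpNorm_le_one {R : ℝ} (hR : 0 < R) {N : ℕ} {q : ℝ} (hq : 0 < q)
    {f g : EuclideanSpace ℝ (Fin n) → ℂ} {A : ℝ≥0∞} (hg : IsDyadicStep R N g)
    (h : ∀ c : ℂ, eLpNorm (fun x => c * g x) (ENNReal.ofReal q) volume ≤ 1 →
      ‖∫ x, f x * (c * g x)‖ₑ ≤ A) :
    ‖∫ x, f x * g x‖ₑ ≤ A * eLpNorm g (ENNReal.ofReal q) volume := by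
  have hm := hg.memLp hR (ENNReal.ofReal q)
  rcases eq_or_ne (eLpNorm g (ENNReal.ofReal q) volume) 0 with h0 | h0
  · rw [eLpNorm_eq_zero_iff hm.1 (by simpa using hq)] at h0
    have : ∫ x, f x * g x = 0 := by
      rw [← integral_zero (EuclideanSpace ℝ (Fin n)) ℂ]
      refine integral_congr_ae ?_
      filter_upwards [h0] with x hx
      simp [hx]
    rw [this, enorm_zero]
    exact zero_le
  · set t := (eLpNorm g (ENNReal.ofReal q) volume).toReal
    have ht : 0 < t := ENNReal.toReal_pos h0 hm.2.ne
    have hte : eLpNorm g (ENNReal.ofReal q) volume = ENNReal.ofReal t :=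
      (ENNReal.ofReal_toReal hm.2.ne).symm
    have hce : ‖((t⁻¹ : ℝ) : ℂ)‖ₑ * ENNReal.ofReal t = 1 := by
      rw [← ofReal_norm, Complex.norm_real, Real.norm_of_nonneg (by positivity),
        ← ENNReal.ofReal_mul (by positivity), inv_mul_cancel₀ ht.ne', ENNReal.ofReal_one]
    have h1 := h ((t⁻¹ : ℝ) : ℂ) (by
      have e : (fun x => ((t⁻¹ : ℝ) : ℂ) * g x) = ((t⁻¹ : ℝ) : ℂ) • g := rfl
      rw [e, eLpNorm_const_smul, hte, hce])
    have e2 : ∫ x, f x * (((t⁻¹ : ℝ) : ℂ) * g x) = ((t⁻¹ : ℝ) : ℂ) * ∫ x, f x * g x := by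
      rw [← integral_const_mul]
      exact integral_congr_ae (Eventually.of_forall fun x => by ring)
    rw [e2, enorm_mul] at h1
    calc ‖∫ x, f x * g x‖ₑ = (‖((t⁻¹ : ℝ) : ℂ)‖ₑ * ENNReal.ofReal t) * ‖∫ x, f x * g x‖ₑ := by
          rw [hce, one_mul]
      _ = (‖((t⁻¹ : ℝ) : ℂ)‖ₑ * ‖∫ x, f x * g x‖ₑ) * ENNReal.ofReal t := by ring
      _ ≤ _ := by rw [hte]; gcongr

theorem IsTest.memLp {a : EuclideanSpace ℝ (Fin n) → ℂ} (ha : IsTest a) (p : ℝ≥0∞) :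
    MemLp a p volume := by
  obtain ⟨M, hM⟩ := ha.bounded
  obtain ⟨S, hS⟩ := ha.support
  exact (memLp_top_of_bound ha.measurable.aestronglyMeasurable M
    (Eventually.of_forall hM)).mono_exponent_of_measure_support_ne_top
      (s := Metric.ball 0 S) hS measure_ball_lt_top.ne le_top

theorem volume_ball_eq_mul (c : EuclideanSpace ℝ (Fin n)) {ρ : ℝ} (hρ : 0 < ρ) :
    volume (Metric.ball c ρ) =
      ENNReal.ofReal (ρ ^ n) * volume (Metric.ball (0 : EuclideanSpace ℝ (Fin n)) 1) := by
  simpa using Measure.addHaar_ball_of_pos volume c hρ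

/-- Representatives of infinite norm satisfy the bound trivially, because C ≠ 0; for the others the
functional is an integral. -/
theorem enorm_pairing_modConst_le {N : Fun n → ℝ≥0∞} {C : ℝ≥0} (hC : C ≠ 0)
    (hN : ∀ f, N f < ⊤ → LocallyIntegrable f volume) {ℓ : FunModConst n →ₗ[ℂ] ℂ}
    {a : EuclideanSpace ℝ (Fin n) → ℂ}
    (hℓ : ∀ f : Fun n, LocallyIntegrable f volume → ℓ ((constants n).mkQ f) = ∫ x, f x * a x)
    (h : ∀ f : Fun n, LocallyIntegrable f volume → ‖∫ x, f x * a x‖ₑ ≤ C * N f)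
    (v : FunModConst n) : ‖ℓ v‖ₑ ≤ C * modConst N v := by
  refine le_mul_modConst hC fun f hf => ?_
  rcases eq_top_or_lt_top (N f) with hf' | hf'
  · rw [hf', ENNReal.mul_top (by exact_mod_cast hC)]
    exact le_top
  · rw [← hf, hℓ f (hN f hf')]
    exact h f (hN f hf')

theorem integral_mul_sum_eq {ι : Type*} (I : Finset ι) (c : ι → ℂ)
    {a : ι → EuclideanSpace ℝ (Fin n) → ℂ} (ha : ∀ i, IsTest (a i))
    {f : EuclideanSpace ℝ (Fin n) → ℂ} (hf : LocallyIntegrable f volume) :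
    ∫ x, f x * ∑ i ∈ I, c i * a i x = ∑ i ∈ I, c i * ∫ x, f x * a i x := by
  simp_rw [Finset.mul_sum, fun x i => mul_left_comm (f x) (c i) (a i x)]
  rw [integral_finsetSum _ fun i _ => ((ha i).integrable_mul hf).const_mul _]
  simp_rw [integral_const_mul]

/-- Pairing with a step function of integral zero is bounded on the interpolation space of `L^p` and
`BMO`. -/
theorem exists_enorm_integral_mul_le_interpNorm_bmo (hn : 1 ≤ n) {p pθ q r θ : ℝ} (hθ₀ : 0 < θ)
    (hθ₁ : θ < 1) (hpθ : 1 / pθ = (1 - θ) / p) (hpq : p.HolderConjugate q)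
    (hpr : pθ.HolderConjugate r) : ∃ C : ℝ≥0, ∀ f : Fun n, LocallyIntegrable f volume →
      ∀ (R : ℝ) (N : ℕ) (g : EuclideanSpace ℝ (Fin n) → ℂ), 0 < R → IsDyadicStep R N g →
      ∫ x, g x = 0 → ‖∫ x, f x * g x‖ₑ ≤ C * interpNorm (modConst (lpNorm n p))
        (modConst (bmoNorm n)) θ ((constants n).mkQ f) * eLpNorm g (ENNReal.ofReal r) volume := by
  obtain ⟨C, hC, hC'⟩ := exists_dyadic_atoms hn hpθ hpq hpr
  set κ := volume (Metric.ball (0 : EuclideanSpace ℝ (Fin n)) 1)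
  have hκ : κ ≠ ⊤ := measure_ball_lt_top.ne
  set K : ℝ≥0 := C.toNNReal * (1 + κ.toNNReal)
  have hK0 : K ≠ 0 := by
    have := Real.toNNReal_pos.2 hC
    positivity
  have hKC : ENNReal.ofReal C ≤ K := by
    rw [ENNReal.ofReal]
    exact_mod_cast le_mul_of_one_le_right zero_le (by simp)
  have hKκ : ENNReal.ofReal C * κ ≤ K := by
    rw [ENNReal.ofReal, ← ENNReal.coe_toNNReal hκ]
    exact_mod_cast mul_le_mul_right (by simp) _
  have hlploc : ∀ f : Fun n, lpNorm n p f < ⊤ → LocallyIntegrable f volume :=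
    fun f => locallyIntegrable_of_lpNorm hpq.lt.le
  have hbmoloc : ∀ f : Fun n, bmoNorm n f < ⊤ → LocallyIntegrable f volume :=
    fun f => locallyIntegrable_of_bmoNorm
  refine ⟨K, fun f hf R N g hR hg h0 => ?_⟩
  -- The atomic decomposition depends on g nonlinearly, through its heights, and is stated for norm
  -- at most one; homogeneity recovers the general case.
  refine enorm_integral_le_of_eLpNorm_le_one hR hpr.symm.pos hg fun c hc => ?_
  obtain ⟨I, lam, H, ρ, c, a, hlam, hH, hρ, hat, ha0, haH, has, hsum, hI1, hI2⟩ :=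
    hC' R N _ hR (hg.comp (φ := fun z => c * z) (mul_zero c)) (by
      rw [integral_const_mul, h0, mul_zero]) hc
  choose ℓ hℓ using fun i => exists_pairing_modConst (hat i) (ha0 i)
  have hℓs : ∀ (t : (Σ _ : ℕ, Set (EuclideanSpace ℝ (Fin n))) → ℂ) (f : Fun n),
      LocallyIntegrable f volume → (∑ i ∈ I, t i • ℓ i) ((constants n).mkQ f) =
        ∫ x, f x * ∑ i ∈ I, t i * a i x := fun t f hf => by
    rw [integral_mul_sum_eq I t hat hf, LinearMap.sum_apply]
    exact Finset.sum_congr rfl fun i _ => by rw [LinearMap.smul_apply, hℓ i f hf, smul_eq_mul]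
  have happ : ∀ (t : (Σ _ : ℕ, Set (EuclideanSpace ℝ (Fin n))) → ℂ) (v : FunModConst n),
      ∑ i ∈ I, t i * ℓ i v = (∑ i ∈ I, t i • ℓ i) v := fun t v => by
    rw [LinearMap.sum_apply]; rfl
  have hbmo : ∀ i (f : Fun n), LocallyIntegrable f volume → ‖∫ x, f x * a i x‖ₑ ≤
      ENNReal.ofReal (H i * ρ i ^ n) * κ * bmoNorm n f := fun i f hf => by
    refine (enorm_integral_mul_le_bmoNorm hf (hat i) (ha0 i) (hρ i) (has i) (haH i)).trans_eq ?_
    rw [volume_ball_eq_mul _ (hρ i), ← mul_assoc, ← ENNReal.ofReal_mul (hH i).le]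
  have key := enorm_sum_apply_le_interpNorm (N₀ := modConst (lpNorm n p))
    (N₁ := modConst (bmoNorm n)) hθ₀ hθ₁ I lam (fun i _ => hlam i) ℓ (fun i _ => ?_) K hK0
    (fun ε hε v => ?_) (fun ε hε v => ?_) ((constants n).mkQ f)
  · refine le_of_eq_of_le ?_ key
    have h1 := (hℓs (fun _ => 1) f hf).symm
    simp only [one_mul, one_smul, LinearMap.sum_apply] at h1
    rw [← h1]
    simp_rw [hsum]
  -- A crude bound for a single functional, required only qualitatively. The summand 1 keeps A
  -- nonzero.
  · set A : ℝ≥0 := (eLpNorm (a i) (ENNReal.ofReal q) volume).toNNReal +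
      (ENNReal.ofReal (H i * ρ i ^ n) * κ).toNNReal + 1
    have hA : (A : ℝ≥0∞) = eLpNorm (a i) (ENNReal.ofReal q) volume +
        ENNReal.ofReal (H i * ρ i ^ n) * κ + 1 := by
      rw [ENNReal.coe_add, ENNReal.coe_add, ENNReal.coe_toNNReal ((hat i).memLp _).2.ne,
        ENNReal.coe_toNNReal (ENNReal.mul_ne_top ENNReal.ofReal_ne_top hκ), ENNReal.coe_one]
    refine ⟨A, fun v => ⟨enorm_pairing_modConst_le (by positivity) hlploc (hℓ i) (fun f _ => ?_) v,
      enorm_pairing_modConst_le (by positivity) hbmoloc (hℓ i) (fun f hf => ?_) v⟩⟩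
    · refine (enorm_integral_mul_le_lpNorm hpq f (hat i).measurable).trans ?_
      rw [mul_comm, hA, add_assoc]
      gcongr
      exact le_self_add
    · refine (hbmo i f hf).trans ?_
      rw [hA, add_right_comm]
      gcongr
      exact le_add_self
  · rw [happ]
    refine enorm_pairing_modConst_le hK0 hlploc (hℓs _) (fun f _ => ?_) v
    refine (enorm_integral_mul_le_lpNorm hpq f (Finset.measurable_sum _ fun i _ =>
      measurable_const.mul (hat i).measurable)).trans ?_
    rw [mul_comm]
    gcongr
    exact (hI2 ε hε).trans hKC
  · rw [happ]
    refine enorm_pairing_modConst_le hK0 hbmoloc (hℓs _) (fun f hf => ?_) v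
    rw [integral_mul_sum_eq I _ hat hf]
    calc _ ≤ ∑ i ∈ I, ENNReal.ofReal (lam i ^ (1 - θ) * (H i * ρ i ^ n)) * (κ * bmoNorm n f) := by
          refine (enorm_sum_le _ _).trans (Finset.sum_le_sum fun i _ => ?_)
          have h2 : 0 < lam i ^ (1 - θ) := Real.rpow_pos_of_pos (hlam i) _
          rw [enorm_mul, ENNReal.ofReal_mul h2.le, mul_assoc, ← mul_assoc _ κ]
          gcongr
          · rw [← ofReal_norm, norm_mul, Complex.norm_real, Real.norm_of_nonneg h2.le]
            exact ENNReal.ofReal_le_ofReal (mul_le_of_le_one_left h2.le (hε i))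
          · exact hbmo i f hf
      _ = ENNReal.ofReal (∑ i ∈ I, lam i ^ (1 - θ) * (H i * ρ i ^ n)) * (κ * bmoNorm n f) := by
          rw [← Finset.sum_mul, ENNReal.ofReal_sum_of_nonneg fun i _ => ?_]
          have := hlam i
          have := hH i
          have := hρ i
          positivity
      _ ≤ ENNReal.ofReal C * (κ * bmoNorm n f) := by gcongr
      _ ≤ _ := by rw [← mul_assoc]; gcongr

end BMOLower

/-! ### From oscillation on cubes to a function in Lebesgue space modulo constants -/

section BMOConverse

variable {n : ℕ} {R : ℝ}

/-- Fatou's lemma along the cubes exhausting the space, with constants that converge as well. -/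
theorem eLpNorm_le_of_eLpNorm_dyadicCube_le {p : ℝ≥0∞} {A : ℝ≥0∞}
    {f : EuclideanSpace ℝ (Fin n) → ℂ} (hf : Measurable f) (c : ℕ → ℂ) {c' : ℂ}
    (hc : Tendsto c atTop (𝓝 c'))
    (h : ∀ k : ℕ, eLpNorm (fun x => f x - c k) p
      (volume.restrict (dyadicCube n ((k : ℝ) + 1))) ≤ A) :
    eLpNorm (fun x => f x - c') p volume ≤ A := by
  have hlim := Lp.eLpNorm_lim_le_liminf_eLpNorm (p := p) (μ := volume)
    (f := fun k : ℕ => (dyadicCube n ((k : ℝ) + 1)).indicator fun x => f x - c k)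
    (fun k => ((hf.sub measurable_const).indicator measurableSet_dyadicCube).aestronglyMeasurable)
    (fun x => f x - c') (Eventually.of_forall fun x => ?_)
  · refine hlim.trans (liminf_le_of_le (by isBoundedDefault) fun b hb => ?_)
    obtain ⟨k, hk⟩ := hb.exists
    refine hk.trans ?_
    rw [eLpNorm_indicator_eq_eLpNorm_restrict measurableSet_dyadicCube]
    exact h k
  · refine (tendsto_const_nhds.sub hc).congr' ?_
    obtain ⟨k₀, hk₀⟩ := exists_nat_gt ‖x‖
    filter_upwards [eventually_ge_atTop k₀] with k hk
    have h1 : (k₀ : ℝ) ≤ k := Nat.cast_le.2 hk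
    rw [Set.indicator_of_mem (ball_subset_dyadicCube (by positivity)
      (mem_ball_zero_iff.2 (by linarith)))]

theorem eLpNorm_const_dyadicCube (hR : 0 < R) {p : ℝ} (hp : 0 < p) (c : ℂ) :
    eLpNorm (fun _ => c) (ENNReal.ofReal p) (volume.restrict (dyadicCube n R)) =
      ENNReal.ofReal (‖c‖ * ((2 * R) ^ n) ^ (1 / p)) := by
  rw [eLpNorm_const' _ (by simpa using hp) ENNReal.ofReal_ne_top, Measure.restrict_apply_univ,
    volume_dyadicCube hR, ENNReal.toReal_ofReal hp.le, ENNReal.ofReal_rpow_of_pos (by positivity),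
    ← ofReal_norm, ENNReal.ofReal_mul (norm_nonneg _)]

/-- If the oscillation of `f` over all large cubes is bounded in `L^p`, then `f` differs from a
function in `L^p` by a constant. -/
theorem exists_eLpNorm_sub_const_le (hn : 1 ≤ n) {p A : ℝ} (hp : 1 ≤ p) (hA : 0 ≤ A)
    {f : EuclideanSpace ℝ (Fin n) → ℂ} (hf : Measurable f) (c : ℕ → ℂ)
    (h : ∀ k : ℕ, eLpNorm (fun x => f x - c k) (ENNReal.ofReal p)
      (volume.restrict (dyadicCube n ((k : ℝ) + 1))) ≤ ENNReal.ofReal A) :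
    ∃ c' : ℂ, eLpNorm (fun x => f x - c') (ENNReal.ofReal p) volume ≤ ENNReal.ofReal A := by
  have hp0 : 0 < p := by linarith
  have hsub : ∀ {k m : ℕ}, k ≤ m → dyadicCube n ((k : ℝ) + 1) ⊆ dyadicCube n ((m : ℝ) + 1) :=
    fun {k m} hkm x hx => by
      have h1 : (k : ℝ) ≤ m := Nat.cast_le.2 hkm
      rw [mem_dyadicCube_iff (by positivity)] at hx ⊢
      exact fun i => ⟨by linarith [(hx i).1], by linarith [(hx i).2]⟩
  have hV : ∀ k : ℕ, 0 < ((2 * ((k : ℝ) + 1)) ^ n) ^ (1 / p) := fun k => by positivity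
  -- Both constants approximate f on the smaller cube of index N, so their difference has L^p norm
  -- at most 2A there. The volume of that cube tends to infinity because n ≥ 1, which forces the
  -- constants to be Cauchy.
  have key : ∀ N k m : ℕ, N ≤ k → N ≤ m →
      dist (c k) (c m) ≤ 2 * A * ((2 * ((N : ℝ) + 1)) ^ n) ^ (-(1 / p)) := by
    intro N k m hk hm
    have hN : (0 : ℝ) < (N : ℝ) + 1 := by positivity
    have h1 : eLpNorm (fun _ => c k - c m) (ENNReal.ofReal p)
        (volume.restrict (dyadicCube n ((N : ℝ) + 1))) ≤ ENNReal.ofReal (A + A) := by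
      have e : (fun _ : EuclideanSpace ℝ (Fin n) => c k - c m) =
          (fun x => f x - c m) - fun x => f x - c k := by
        ext x
        simp
      rw [e, ENNReal.ofReal_add hA hA]
      refine (eLpNorm_sub_le (hf.sub measurable_const).aestronglyMeasurable
        (hf.sub measurable_const).aestronglyMeasurable (by simpa using hp)).trans (add_le_add ?_ ?_)
      · exact (eLpNorm_mono_measure _ (Measure.restrict_mono (hsub hm) le_rfl)).trans (h m)
      · exact (eLpNorm_mono_measure _ (Measure.restrict_mono (hsub hk) le_rfl)).trans (h k)
    rw [eLpNorm_const_dyadicCube hN hp0, ENNReal.ofReal_le_ofReal_iff (by positivity)] at h1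
    rw [dist_eq_norm, Real.rpow_neg (by positivity), ← div_eq_mul_inv, le_div_iff₀ (hV N)]
    linarith
  have hlim : Tendsto (fun N : ℕ => 2 * A * ((2 * ((N : ℝ) + 1)) ^ n) ^ (-(1 / p))) atTop
      (𝓝 0) := by
    have h1 : Tendsto (fun N : ℕ => (2 * ((N : ℝ) + 1)) ^ n) atTop atTop :=
      (tendsto_pow_atTop (by omega)).comp ((tendsto_atTop_add_const_right _ _
        tendsto_natCast_atTop_atTop).const_mul_atTop two_pos)
    simpa using ((tendsto_rpow_neg_atTop (show 0 < 1 / p by positivity)).comp h1).const_mul (2 * A)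
  have hcs : CauchySeq c := cauchySeq_of_le_tendsto_0 _ (fun k m N hk hm => key N k m hk hm) hlim
  obtain ⟨c', hc'⟩ := cauchySeq_tendsto_of_complete hcs
  exact ⟨c', eLpNorm_le_of_eLpNorm_dyadicCube_le hf c hc' h⟩

/-- Subtracting the mean over the cube at most doubles the norm of a step function. -/
theorem IsDyadicStep.eLpNorm_sub_mean_le {N : ℕ} (hR : 0 < R) {g : EuclideanSpace ℝ (Fin n) → ℂ}
    (hg : IsDyadicStep R N g) {p : ℝ} (hp : 1 ≤ p) :
    eLpNorm (fun x => g x - (dyadicCube n R).indicator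
      (fun _ => (∫ y, g y) / ((2 * R) ^ n : ℝ)) x) (ENNReal.ofReal p) volume ≤
      2 * eLpNorm g (ENNReal.ofReal p) volume := by
  have hp0 : 0 < p := by linarith
  have hP : 1 ≤ ENNReal.ofReal p := by simpa using hp
  set Q := dyadicCube n R
  have hQm : MeasurableSet Q := measurableSet_dyadicCube
  have hvol : volume Q = ENNReal.ofReal ((2 * R) ^ n) := volume_dyadicCube hR
  set V := ENNReal.ofReal ((2 * R) ^ n)
  have hV0 : V ≠ 0 := by simp only [V, ne_eq, ENNReal.ofReal_eq_zero, not_le]; positivity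
  have hVt : V ≠ ⊤ := ENNReal.ofReal_ne_top
  have h1 : ‖∫ y, g y‖ₑ ≤ eLpNorm g (ENNReal.ofReal p) volume * V ^ (1 - 1 / p) := by
    calc ‖∫ y, g y‖ₑ ≤ eLpNorm g 1 volume := by
          rw [eLpNorm_one_eq_lintegral_enorm]
          exact enorm_integral_le_lintegral_enorm _
      _ = eLpNorm g 1 (volume.restrict Q) := by
          rw [← eLpNorm_indicator_eq_eLpNorm_restrict hQm,
            indicator_dyadicCube_eq_self hg.support]
      _ ≤ eLpNorm g (ENNReal.ofReal p) (volume.restrict Q) *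
          (volume.restrict Q Set.univ) ^ (1 / (1 : ℝ≥0∞).toReal - 1 / (ENNReal.ofReal p).toReal) :=
          eLpNorm_le_eLpNorm_mul_rpow_measure_univ hP hg.measurable.aestronglyMeasurable
      _ ≤ _ := by
          rw [Measure.restrict_apply_univ, hvol, ENNReal.toReal_ofReal hp0.le]
          simp only [ENNReal.toReal_one, div_one]
          gcongr
          exact Measure.restrict_le_self
  refine (eLpNorm_sub_le hg.measurable.aestronglyMeasurable
    (measurable_const.indicator hQm).aestronglyMeasurable hP).trans ?_
  rw [two_mul (eLpNorm g _ _)]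
  refine add_le_add le_rfl ?_
  rw [eLpNorm_indicator_const hQm (by simpa using hp0) ENNReal.ofReal_ne_top, hvol,
    ENNReal.toReal_ofReal hp0.le, div_eq_mul_inv, enorm_mul]
  have h2 : ‖((((2 * R) ^ n : ℝ) : ℂ))⁻¹‖ₑ = V⁻¹ := by
    rw [enorm_inv (by exact_mod_cast (by positivity : (2 * R) ^ n ≠ 0)), ← ofReal_norm,
      Complex.norm_real, Real.norm_of_nonneg (by positivity)]
  rw [h2]
  calc _ ≤ eLpNorm g (ENNReal.ofReal p) volume * V ^ (1 - 1 / p) * V⁻¹ * V ^ (1 / p) := by gcongr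
    _ = eLpNorm g (ENNReal.ofReal p) volume * (V ^ (1 - 1 / p) * V ^ (1 / p) * V⁻¹) := by ring
    _ = _ := by
      rw [← ENNReal.rpow_add _ _ hV0 hVt, sub_add_cancel, ENNReal.rpow_one,
        ENNReal.mul_inv_cancel hV0 hVt, mul_one]

/-- The interpolation space of `L^p` and `BMO` is contained in an `L^p` space. -/
theorem modConst_lpNorm_le_interpNorm_bmo (hn : 1 ≤ n) {p pθ q r θ : ℝ} (hθ₀ : 0 < θ)
    (hθ₁ : θ < 1) (hpθ : 1 / pθ = (1 - θ) / p) (hpq : p.HolderConjugate q)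
    (hpr : pθ.HolderConjugate r) : ∃ C : ℝ≥0, ∀ v : FunModConst n,
      modConst (lpNorm n pθ) v ≤
        C * interpNorm (modConst (lpNorm n p)) (modConst (bmoNorm n)) θ v := by
  obtain ⟨C, hC⟩ := exists_enorm_integral_mul_le_interpNorm_bmo hn hθ₀ hθ₁ hpθ hpq hpr
  refine ⟨2 * C + 1, fun v => ?_⟩
  set L := interpNorm (modConst (lpNorm n p)) (modConst (bmoNorm n)) θ v with hL
  have hC0 : ((2 * C + 1 : ℝ≥0) : ℝ≥0∞) ≠ 0 := by exact_mod_cast (by positivity : 2 * C + 1 ≠ 0)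
  rcases eq_top_or_lt_top L with hv | hv
  · rw [hv, ENNReal.mul_top hC0]
    exact le_top
  -- The representative is a sum of an L^p and a BMO function, since finiteness of the interpolation
  -- norm puts v into the sum of the spaces.
  obtain ⟨f, rfl, hf⟩ : ∃ f : Fun n, (constants n).mkQ f = v ∧ LocallyIntegrable f volume := by
    have h1 := sumNorm_lt_top_of_interpNorm_lt_top hθ₀ hθ₁ hv
    simp only [sumNorm, iInf_lt_top, ENNReal.add_lt_top, modConst] at h1
    obtain ⟨_, _, rfl, ⟨f₀, rfl, h₀⟩, f₁, rfl, h₁⟩ := h1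
    refine ⟨f₀ + f₁, map_add _ _ _, ?_⟩
    refine ((locallyIntegrable_of_lpNorm hpq.lt.le h₀).add
      (locallyIntegrable_of_bmoNorm h₁)).congr ?_
    exact (AEEqFun.coeFn_add f₀ f₁).symm
  set A : ℝ := (2 * C * L).toReal
  have hAe : ENNReal.ofReal A = 2 * C * L := ENNReal.ofReal_toReal (by finiteness)
  have hfm : Measurable f := f.stronglyMeasurable.measurable
  have hcube : ∀ R : ℝ, 0 < R → eLpNorm (fun x => f x - (∫ y in dyadicCube n R, f y) /
      ((2 * R) ^ n : ℝ)) (ENNReal.ofReal pθ) (volume.restrict (dyadicCube n R)) ≤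
        ENNReal.ofReal A := by
    intro R hR
    set Q := dyadicCube n R
    have hQm : MeasurableSet Q := measurableSet_dyadicCube
    have hfQ : IntegrableOn f Q := (hf.integrableOn_isCompact
      (isCompact_closedBall (0 : EuclideanSpace ℝ (Fin n)) ((n + 1) * (2 * R)))).mono_set
        ((dyadicCube_subset_ball hR).trans Metric.ball_subset_closedBall)
    refine eLpNorm_le_of_enorm_integral_le hR hpr ENNReal.toReal_nonneg
      (hfm.sub measurable_const) (hfQ.sub (integrableOn_const (volume_dyadicCube_ne_top hR)))
      fun N s hs => ?_
    have hsi : Integrable s := (hs.isTest hR).integrable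
    have hfs : Integrable fun x => f x * s x := (hs.isTest hR).integrable_mul hf
    have hstep := hs.sub (isDyadicStep_indicator_const (n := n) (R := R) (N := N)
      ((∫ y, s y) / ((2 * R) ^ n : ℝ)))
    have hVc : (((2 * R) ^ n : ℝ) : ℂ) ≠ 0 := by exact_mod_cast (by positivity : (2 * R) ^ n ≠ 0)
    -- Removing the mean over the cube is a symmetric operation, so it can be moved from f to s; the
    -- new test function is a step function of integral zero.
    have e1 : ∫ x, (f x - (∫ y in Q, f y) / ((2 * R) ^ n : ℝ)) * s x =
        ∫ x, f x * (s x - Q.indicator (fun _ => (∫ y, s y) / ((2 * R) ^ n : ℝ)) x) := by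
      simp_rw [sub_mul, mul_sub]
      have e2 : (fun x => f x * Q.indicator (fun _ => (∫ y, s y) / (((2 * R) ^ n : ℝ) : ℂ)) x) =
          Q.indicator fun x => f x * ((∫ y, s y) / (((2 * R) ^ n : ℝ) : ℂ)) := by
        ext x
        by_cases hx : x ∈ Q <;> simp [hx]
      rw [integral_sub hfs (hsi.const_mul _), integral_const_mul, integral_sub hfs, e2,
        integral_indicator hQm, integral_mul_const]
      · ring
      · rw [e2, integrable_indicator_iff hQm]
        exact hfQ.mul_const _
    rw [e1]
    refine (hC f hf R N _ hR hstep ?_).trans ?_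
    · rw [integral_sub hsi ((isDyadicStep_indicator_const (N := N) _).isTest hR).integrable,
        integral_indicator hQm, setIntegral_const, measureReal_dyadicCube hR, Complex.real_smul,
        mul_div_cancel₀ _ hVc, sub_self]
    · rw [hAe, ← hL]
      calc _ ≤ C * L * (2 * eLpNorm s (ENNReal.ofReal r) volume) := by
            gcongr
            exact hs.eLpNorm_sub_mean_le hR hpr.symm.lt.le
        _ = _ := by ring
  obtain ⟨c', hc'⟩ := exists_eLpNorm_sub_const_le hn hpr.lt.le ENNReal.toReal_nonneg hfm _
    fun k : ℕ => hcube ((k : ℝ) + 1) (by positivity)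
  have hmk : (constants n).mkQ (f - c' • 1) = (constants n).mkQ f := by
    rw [map_sub, sub_eq_self, Submodule.mkQ_apply, Submodule.Quotient.mk_eq_zero]
    exact Submodule.smul_mem _ _ (Submodule.mem_span_singleton_self _)
  rw [← hmk]
  refine (modConst_mkQ_le _ _).trans ?_
  have e3 : lpNorm n pθ (f - c' • 1) = eLpNorm (fun x => f x - c') (ENNReal.ofReal pθ) volume := by
    refine eLpNorm_congr_ae ?_
    filter_upwards [AEEqFun.coeFn_sub f (c' • 1), AEEqFun.coeFn_smul c' (1 : Fun n),
      AEEqFun.coeFn_one (α := EuclideanSpace ℝ (Fin n)) (β := ℂ) (μ := volume)] with x h1 h2 h3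
    rw [h1, Pi.sub_apply, h2, Pi.smul_apply, h3]
    simp
  rw [e3]
  refine hc'.trans ?_
  rw [hAe]
  gcongr
  push_cast
  exact le_self_add

end BMOConverse

/-! ### The grand maximal function: domination of L¹ and decay for atoms -/

section Hardy

variable {n : ℕ} {b K : ℝ}

theorem enorm_integral_le_grandMaximal {f : Fun n} {φ : EuclideanSpace ℝ (Fin n) → ℂ}
    (hφ : φ ∈ testFunctions n K) {t : ℝ} (ht : 0 < t) {x y : EuclideanSpace ℝ (Fin n)}
    (hy : dist y x < b * t) :
    ‖∫ w, f w * (((t ^ n)⁻¹ : ℝ) • φ (t⁻¹ • (y - w)))‖ₑ ≤ grandMaximal n b K f x :=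
  le_iSup₂_of_le φ hφ (le_iSup₂_of_le t ht (le_iSup₂_of_le y hy le_rfl))

theorem exists_bump_mem_testFunctions (n : ℕ) (hK : 0 < K)
    (ψ : ContDiffBump (0 : EuclideanSpace ℝ (Fin n))) (hψ : ψ.rOut < 1) :
    ∃ δ : ℝ, 0 < δ ∧ (fun x => ((δ * ψ x : ℝ) : ℂ)) ∈ testFunctions n K := by
  have hc : ContDiff ℝ ∞ ψ := ψ.contDiff
  obtain ⟨M, hM⟩ := (ψ.hasCompactSupport.fderiv (𝕜 := ℝ)).exists_bound_of_continuous
    (hc.continuous_fderiv (by simp))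
  have hM0 : 0 ≤ M := (norm_nonneg _).trans (hM 0)
  have hδ : 0 < K / (M + 1) := by positivity
  refine ⟨K / (M + 1), hδ, ?_, ?_, fun x => ?_⟩
  · exact Complex.ofRealCLM.contDiff.comp (contDiff_const.mul hc)
  · refine (closure_mono fun x hx => ?_).trans (ψ.tsupport_eq.subset.trans
      (Metric.closedBall_subset_ball hψ))
    rw [Function.mem_support] at hx ⊢
    exact fun h => hx (by simp [h])
  · have h1 : HasFDerivAt (fun x => ((K / (M + 1) * ψ x : ℝ) : ℂ))
        (Complex.ofRealCLM.comp ((K / (M + 1)) • fderiv ℝ ψ x)) x :=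
      Complex.ofRealCLM.hasFDerivAt.comp x
        (((hc.differentiable (by simp)) x).hasFDerivAt.const_mul _)
    rw [h1.fderiv]
    refine (ContinuousLinearMap.opNorm_comp_le _ _).trans ?_
    rw [Complex.ofRealCLM_norm, one_mul, norm_smul, Real.norm_of_nonneg hδ.le]
    calc K / (M + 1) * ‖fderiv ℝ ψ x‖ ≤ K / (M + 1) * (M + 1) := by
          gcongr
          exact (hM x).trans (by linarith)
      _ = K := div_mul_cancel₀ _ (by positivity)

/-- The `L¹` norm is controlled by the norm of `H¹`. -/
theorem exists_lintegral_enorm_le_h1Norm (n : ℕ) (hb : 0 < b) (hK : 0 < K) :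
    ∃ C : ℝ≥0, C ≠ 0 ∧ ∀ f : Fun n, ∫⁻ x, ‖f x‖ₑ ≤ C * h1Norm n b K f := by
  let ψ : ContDiffBump (0 : EuclideanSpace ℝ (Fin n)) := ⟨1 / 4, 1 / 2, by norm_num, by norm_num⟩
  obtain ⟨δ, hδ, hφ⟩ := exists_bump_mem_testFunctions n hK ψ (show (1 / 2 : ℝ) < 1 by norm_num)
  set I := ∫ x, ψ x
  have hI : 0 < I := ψ.integral_pos
  have hC : 0 < (δ * I)⁻¹ := by positivity
  have hC' : Real.toNNReal (δ * I)⁻¹ ≠ 0 := (Real.toNNReal_pos.2 hC).ne'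
  refine ⟨Real.toNNReal (δ * I)⁻¹, hC', fun f => ?_⟩
  by_cases hf : LocallyIntegrable f volume
  swap
  · simp only [h1Norm, hf, iInf_false]
    rw [ENNReal.mul_top (by exact_mod_cast hC')]
    exact le_top
  simp only [h1Norm, hf, iInf_true]
  rw [← lintegral_const_mul' _ _ ENNReal.coe_ne_top]
  let t : ℕ → ℝ := fun k => 1 / ((k : ℝ) + 1)
  have ht : ∀ k, 0 < t k := fun k => by positivity
  have htl : Tendsto t atTop (𝓝 0) := tendsto_one_div_add_atTop_nhds_zero_nat
  -- These are the dilates of the single profile ψ, so that their convolutions with f are, up to the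
  -- fixed factor δ I, the averages in the maximal function taken at y = x.
  let Ψ : ℕ → ContDiffBump (0 : EuclideanSpace ℝ (Fin n)) := fun k =>
    ⟨t k / 4, t k / 2, by linarith [ht k], by linarith [ht k]⟩
  have hΨ : ∀ k x, Ψ k x = ψ ((t k)⁻¹ • x) := fun k x => by
    have e1 : (Ψ k).rOut / (Ψ k).rIn = ψ.rOut / ψ.rIn := by
      have := (ht k).ne'
      change t k / 2 / (t k / 4) = (1 / 2) / (1 / 4)
      field_simp
    have e2 : (Ψ k).rIn⁻¹ = ψ.rIn⁻¹ * (t k)⁻¹ := by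
      change (t k / 4)⁻¹ = (1 / 4)⁻¹ * (t k)⁻¹
      rw [← mul_inv]
      congr 1
      ring
    rw [ContDiffBump.apply, ContDiffBump.apply, e1, e2, sub_zero, sub_zero, smul_smul]
  have hΨI : ∀ k, ∫ x, Ψ k x = t k ^ n * I := fun k => by
    simp_rw [hΨ]
    rw [Measure.integral_comp_inv_smul_of_nonneg volume (fun x => ψ x) (ht k).le]
    simp [I]
  -- Lebesgue differentiation: the normalised averages converge to f almost everywhere.
  have hconv := ContDiffBump.ae_convolution_tendsto_right_of_locallyIntegrable (φ := Ψ) (l := atTop)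
    (μ := volume) (K := 2) (g := f) (by simpa using htl.div_const 2)
    (Eventually.of_forall fun k => by change t k / 2 ≤ 2 * (t k / 4); linarith) hf
  refine lintegral_mono_ae ?_
  filter_upwards [hconv] with x hx
  have e : ∀ k, ((δ * I : ℝ) : ℂ) * (convolution ((Ψ k).normed volume) f
      (ContinuousLinearMap.lsmul ℝ ℝ) volume) x =
      ∫ w, f w * (((t k ^ n)⁻¹ : ℝ) • ((δ * ψ ((t k)⁻¹ • (x - w)) : ℝ) : ℂ)) := fun k => by
    rw [convolution_eq_swap, ← integral_const_mul]
    refine integral_congr_ae (Eventually.of_forall fun w => ?_)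
    have := (ht k).ne'
    simp only [ContinuousLinearMap.lsmul_apply, ContDiffBump.normed_def, hΨI, Complex.real_smul]
    rw [hΨ]
    rw [← mul_assoc, ← Complex.ofReal_mul, mul_comm (f w), ← Complex.ofReal_mul]
    congr 2
    field_simp
  have hle : ‖((δ * I : ℝ) : ℂ) * f x‖ₑ ≤ grandMaximal n b K f x := by
    refine le_of_tendsto' (hx.const_mul ((δ * I : ℝ) : ℂ)).enorm fun k => ?_
    rw [e]
    exact enorm_integral_le_grandMaximal hφ (ht k) (by rw [dist_self]; exact mul_pos hb (ht k))
  calc ‖f x‖ₑ = ((δ * I)⁻¹).toNNReal * ‖((δ * I : ℝ) : ℂ) * f x‖ₑ := by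
        rw [enorm_mul, ← mul_assoc, ← ofReal_norm ((δ * I : ℝ) : ℂ), Complex.norm_real,
          Real.norm_of_nonneg (by positivity)]
        change _ = ENNReal.ofReal _ * ENNReal.ofReal _ * _
        rw [← ENNReal.ofReal_mul hC.le, inv_mul_cancel₀ (by positivity), ENNReal.ofReal_one,
          one_mul]
    _ ≤ _ := by gcongr

theorem norm_sub_le_of_mem_testFunctions {φ : EuclideanSpace ℝ (Fin n) → ℂ}
    (hφ : φ ∈ testFunctions n K) (x y : EuclideanSpace ℝ (Fin n)) :
    ‖φ x - φ y‖ ≤ K * ‖x - y‖ :=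
  convex_univ.norm_image_sub_le_of_norm_fderiv_le
    (fun z _ => (hφ.1.differentiable (by simp)) z) (fun z _ => hφ.2.2 z) (Set.mem_univ _)
    (Set.mem_univ _)

theorem eq_zero_of_mem_testFunctions {φ : EuclideanSpace ℝ (Fin n) → ℂ}
    (hφ : φ ∈ testFunctions n K) {x : EuclideanSpace ℝ (Fin n)} (hx : 1 ≤ ‖x‖) : φ x = 0 := by
  by_contra h
  have := hφ.2.1 (subset_tsupport φ h)
  rw [mem_ball_zero_iff] at this
  linarith

/-- For n ≥ 1 there is a unit vector; φ vanishes there, and its distance to any point of the unit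
ball is at most 2. In dimension zero the gradient condition would give no bound. -/
theorem norm_le_of_mem_testFunctions (hn : 1 ≤ n) (hK : 0 < K)
    {φ : EuclideanSpace ℝ (Fin n) → ℂ} (hφ : φ ∈ testFunctions n K)
    (x : EuclideanSpace ℝ (Fin n)) : ‖φ x‖ ≤ 2 * K := by
  rcases le_or_gt 1 ‖x‖ with hx | hx
  · rw [eq_zero_of_mem_testFunctions hφ hx, norm_zero]
    positivity
  · have : Nonempty (Fin n) := ⟨⟨0, hn⟩⟩
    obtain ⟨e, he⟩ := exists_norm_eq (EuclideanSpace ℝ (Fin n)) zero_le_one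
    have h1 := norm_sub_le_of_mem_testFunctions hφ x e
    rw [eq_zero_of_mem_testFunctions hφ he.ge, sub_zero] at h1
    refine h1.trans ?_
    have := norm_sub_le x e
    nlinarith

/-- The means of an atom decay like `|x| ^ (-n - 1)`. -/
theorem exists_norm_integral_mul_testFunction_le (hn : 1 ≤ n) (hb : 0 < b) (hK : 0 < K) :
    ∃ C : ℝ, 0 < C ∧ ∀ (a : EuclideanSpace ℝ (Fin n) → ℂ) (c : EuclideanSpace ℝ (Fin n))
      (ρ M : ℝ), 0 < ρ → IsTest a → ∫ x, a x = 0 → (∀ x, ‖a x‖ ≤ M) →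
      (∀ x, x ∉ Metric.ball c ρ → a x = 0) → ∀ φ ∈ testFunctions n K, ∀ t : ℝ, 0 < t →
      ∀ x y, dist y x < b * t → ‖∫ w, a w * (((t ^ n)⁻¹ : ℝ) • φ (t⁻¹ • (y - w)))‖ ≤
        C * M * (1 + ‖ρ⁻¹ • (x - c)‖) ^ (-((n : ℝ) + 1)) := by
  set κ := volume.real (Metric.ball (0 : EuclideanSpace ℝ (Fin n)) 1)
  have hκ : 0 < κ := by
    exact ENNReal.toReal_pos (Metric.measure_ball_pos _ _ one_pos).ne' measure_ball_lt_top.ne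
  have hvol : ∀ (z : EuclideanSpace ℝ (Fin n)) {s : ℝ}, 0 < s →
      volume.real (Metric.ball z s) = s ^ n * κ := fun z s hs => by
    rw [measureReal_def, volume_ball_eq_mul z hs, ENNReal.toReal_mul,
      ENNReal.toReal_ofReal (by positivity), ← measureReal_def]
  refine ⟨2 * K * κ * 3 ^ (n + 1) + K * κ * (4 * (b + 1)) ^ (n + 1), by positivity,
    fun a c ρ M hρ hat ha0 hM hs φ hφ t ht x y hy => ?_⟩
  have hM0 : 0 ≤ M := (norm_nonneg _).trans (hM 0)
  set d := ‖x - c‖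
  have hd0 : 0 ≤ d := norm_nonneg _
  have hdn : ‖ρ⁻¹ • (x - c)‖ = d / ρ := by
    rw [norm_smul, Real.norm_of_nonneg (by positivity), inv_mul_eq_div]
  rw [hdn]
  set u := 1 + d / ρ
  have hu : 0 < u := by positivity
  have hpow : u ^ (-((n : ℝ) + 1)) = (u ^ (n + 1))⁻¹ := by
    rw [Real.rpow_neg hu.le]
    congr 1
    exact_mod_cast Real.rpow_natCast u (n + 1)
  rw [hpow, ← div_eq_mul_inv, le_div_iff₀ (by positivity)]
  have hφ0 : ∀ w, w ∉ Metric.ball y t → φ (t⁻¹ • (y - w)) = 0 := fun w hw => by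
    refine eq_zero_of_mem_testFunctions hφ ?_
    rw [Metric.mem_ball, not_lt, dist_comm, dist_eq_norm] at hw
    rw [norm_smul, Real.norm_of_nonneg (by positivity), inv_mul_eq_div, le_div_iff₀ ht, one_mul]
    exact hw
  have htn : 0 < (t ^ n)⁻¹ := by positivity
  -- Near the ball of the atom the bounds on a and φ suffice. Far away, either t is so small that
  -- the supports are disjoint, or cancellation gains a factor ρ / t.
  rcases le_or_gt d (2 * ρ) with hd | hd
  · have h1 : ‖∫ w, a w * (((t ^ n)⁻¹ : ℝ) • φ (t⁻¹ • (y - w)))‖ ≤ 2 * K * κ * M := by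
      rw [← setIntegral_eq_integral_of_forall_compl_eq_zero (s := Metric.ball y t)
        fun w hw => by rw [hφ0 w hw, smul_zero, mul_zero]]
      refine (norm_setIntegral_le_of_norm_le_const (C := M * ((t ^ n)⁻¹ * (2 * K)))
        measure_ball_lt_top fun w _ => ?_).trans (le_of_eq ?_)
      · rw [norm_mul, norm_smul, Real.norm_of_nonneg htn.le]
        have := norm_le_of_mem_testFunctions hn hK hφ (t⁻¹ • (y - w))
        gcongr
        exact hM w
      · rw [hvol y ht]
        field_simp
    have hu3 : u ≤ 3 := by
      have : d / ρ ≤ 2 := (div_le_iff₀ hρ).2 hd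
      simp only [u]
      linarith
    calc _ ≤ 2 * K * κ * M * 3 ^ (n + 1) := by gcongr
      _ = 2 * K * κ * 3 ^ (n + 1) * M := by ring
      _ ≤ _ := by gcongr; exact le_add_of_nonneg_right (by positivity)
  · rcases le_or_gt (2 * (b + 1) * t) d with htd | htd
    · have h0 : ∫ w, a w * (((t ^ n)⁻¹ : ℝ) • φ (t⁻¹ • (y - w))) = 0 := by
        rw [← integral_zero (EuclideanSpace ℝ (Fin n)) ℂ]
        refine integral_congr_ae (Eventually.of_forall fun w => ?_)
        dsimp only
        by_cases hw : w ∈ Metric.ball c ρ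
        · rw [hφ0 w, smul_zero, mul_zero]
          intro hw'
          have h3 : d ≤ dist x y + dist y w + dist w c := by
            simp only [d]
            rw [← dist_eq_norm]
            exact dist_triangle4 _ _ _ _
          rw [Metric.mem_ball] at hw hw'
          rw [dist_comm x y, dist_comm y w] at h3
          nlinarith
        · rw [hs w hw, zero_mul]
      rw [h0, norm_zero, zero_mul]
      positivity
    -- As a has mean zero, the value of the test function at the centre c can be subtracted; the
    -- Lipschitz bound then yields K ρ / t on the ball.
    · have e : ∫ w, a w * (((t ^ n)⁻¹ : ℝ) • φ (t⁻¹ • (y - w))) =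
          ∫ w, a w * (((t ^ n)⁻¹ : ℝ) • (φ (t⁻¹ • (y - w)) - φ (t⁻¹ • (y - c)))) := by
        simp_rw [smul_sub ((t ^ n)⁻¹), mul_sub]
        rw [integral_sub, integral_mul_const, ha0, zero_mul, sub_zero]
        · have hcont : Continuous fun w => ((t ^ n)⁻¹ : ℝ) • φ (t⁻¹ • (y - w)) := by
            have := hφ.1.continuous
            fun_prop
          simp_rw [mul_comm (a _)]
          exact hat.integrable_mul hcont.locallyIntegrable
        · exact hat.integrable.mul_const _
      have h1 : ‖∫ w, a w * (((t ^ n)⁻¹ : ℝ) • φ (t⁻¹ • (y - w)))‖ ≤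
          K * κ * M * (ρ / t) ^ (n + 1) := by
        rw [e, ← setIntegral_eq_integral_of_forall_compl_eq_zero (s := Metric.ball c ρ)
          fun w hw => by rw [hs w hw, zero_mul]]
        refine (norm_setIntegral_le_of_norm_le_const (C := M * ((t ^ n)⁻¹ * (K * (ρ / t))))
          measure_ball_lt_top fun w hw => ?_).trans (le_of_eq ?_)
        · rw [norm_mul, norm_smul, Real.norm_of_nonneg htn.le]
          have h2 := norm_sub_le_of_mem_testFunctions hφ (t⁻¹ • (y - w)) (t⁻¹ • (y - c))
          rw [← smul_sub, sub_sub_sub_cancel_left, norm_smul, Real.norm_of_nonneg (by positivity),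
            inv_mul_eq_div, norm_sub_rev c w] at h2
          have h3 : ‖w - c‖ ≤ ρ := (mem_ball_iff_norm.1 hw).le
          gcongr
          · exact hM w
          · refine h2.trans ?_
            gcongr
        · rw [hvol c hρ, div_pow]
          field_simp
          ring
      -- Here d > 2ρ gives u ≤ 2d/ρ, and d < 2(b+1)t turns the powers of ρ/t into decay in u.
      have hut : ρ / t * u ≤ 4 * (b + 1) := by
        have : u ≤ 2 * (d / ρ) := by
          have : 1 ≤ d / ρ := (one_le_div₀ hρ).2 (by linarith)
          simp only [u]
          linarith
        calc ρ / t * u ≤ ρ / t * (2 * (d / ρ)) := by gcongr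
          _ = 2 * d / t := by field_simp
          _ ≤ _ := by rw [div_le_iff₀ ht]; linarith
      calc _ ≤ K * κ * M * (ρ / t) ^ (n + 1) * u ^ (n + 1) := by gcongr
        _ = K * κ * M * (ρ / t * u) ^ (n + 1) := by rw [mul_pow]; ring
        _ ≤ K * κ * M * (4 * (b + 1)) ^ (n + 1) := by gcongr
        _ = K * κ * (4 * (b + 1)) ^ (n + 1) * M := by ring
        _ ≤ _ := by gcongr; exact le_add_of_nonneg_left (by positivity)

/-- The integral of the decay of an atom. -/
theorem exists_lintegral_decay_le (n : ℕ) : ∃ C : ℝ≥0, ∀ (c : EuclideanSpace ℝ (Fin n)) (ρ : ℝ),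
    0 < ρ → ∫⁻ x, ENNReal.ofReal ((1 + ‖ρ⁻¹ • (x - c)‖) ^ (-((n : ℝ) + 1))) ≤
      C * ENNReal.ofReal (ρ ^ n) := by
  have hi : Integrable (fun x : EuclideanSpace ℝ (Fin n) => (1 + ‖x‖) ^ (-((n : ℝ) + 1))) volume :=
    integrable_one_add_norm (by simp)
  refine ⟨(∫ x : EuclideanSpace ℝ (Fin n), (1 + ‖x‖) ^ (-((n : ℝ) + 1))).toNNReal,
    fun c ρ hρ => ?_⟩
  have hi' : Integrable (fun x : EuclideanSpace ℝ (Fin n) =>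
      (1 + ‖ρ⁻¹ • x‖) ^ (-((n : ℝ) + 1))) volume := hi.comp_smul (by positivity)
  rw [← ofReal_integral_eq_lintegral_ofReal (hi'.comp_sub_right c)
    (Eventually.of_forall fun x => by positivity),
    integral_sub_right_eq_self (fun x => (1 + ‖ρ⁻¹ • x‖) ^ (-((n : ℝ) + 1))) c,
    Measure.integral_comp_inv_smul_of_nonneg volume
      (fun x => (1 + ‖x‖) ^ (-((n : ℝ) + 1))) hρ.le, smul_eq_mul, mul_comm,
    ENNReal.ofReal_mul (integral_nonneg fun x => by positivity)]
  simp [ENNReal.ofReal]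

end Hardy

/-! ### Summing series with ℓ¹ coefficients -/

section Synthesis

variable {σ : Type*}

theorem summable_norm_lp_one (u : lp (fun _ : σ => ℂ) 1) : Summable fun i => ‖u i‖ := by
  simpa using (lp.memℓp u).summable (by simp)

theorem norm_lp_one (u : lp (fun _ : σ => ℂ) 1) : ‖u‖ = ∑' i, ‖u i‖ := by
  simpa using lp.norm_eq_tsum_rpow (by simp) u

theorem enorm_lp_one (u : lp (fun _ : σ => ℂ) 1) : ‖u‖ₑ = ∑' i, ‖u i‖ₑ := by
  rw [← ofReal_norm, norm_lp_one, ENNReal.ofReal_tsum_of_nonneg (fun _ => norm_nonneg _)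
    (summable_norm_lp_one u)]
  simp_rw [ofReal_norm]

/-- The operator that maps the coefficients `u` to the sum of `u i • A i`. -/
theorem exists_synthesis {E : Type*} [NormedAddCommGroup E] [NormedSpace ℂ E] [CompleteSpace E]
    [DecidableEq σ] (A : σ → E) {C : ℝ} (hA : ∀ i, ‖A i‖ ≤ C) :
    ∃ T : lp (fun _ : σ => ℂ) 1 →L[ℂ] E, (∀ u, HasSum (fun i => u i • A i) (T u)) ∧
      (∀ i z, T (lp.single 1 i z) = z • A i) ∧ ∀ u, ‖T u‖ ≤ C * ‖u‖ := by
  have hn : ∀ (u : lp (fun _ : σ => ℂ) 1) i, ‖u i • A i‖ ≤ ‖u i‖ * C := fun u i => by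
    rw [norm_smul]
    exact mul_le_mul_of_nonneg_left (hA i) (norm_nonneg _)
  have hs : ∀ u : lp (fun _ : σ => ℂ) 1, Summable fun i => u i • A i := fun u =>
    ((summable_norm_lp_one u).mul_right C).of_norm_bounded (hn u)
  have hbound : ∀ u : lp (fun _ : σ => ℂ) 1, ‖∑' i, u i • A i‖ ≤ C * ‖u‖ := fun u => by
    rw [norm_lp_one, mul_comm, ← tsum_mul_right]
    exact tsum_of_norm_bounded ((summable_norm_lp_one u).mul_right C).hasSum (hn u)
  let T : lp (fun _ : σ => ℂ) 1 →ₗ[ℂ] E :=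
    { toFun := fun u => ∑' i, u i • A i
      map_add' := fun u v => by
        rw [← (hs u).tsum_add (hs v)]
        exact tsum_congr fun i => add_smul _ _ _
      map_smul' := fun z u => by
        rw [RingHom.id_apply, ← (hs u).tsum_const_smul]
        exact tsum_congr fun i => smul_assoc z (u i) (A i) }
  refine ⟨T.mkContinuous C hbound, fun u => (hs u).hasSum, fun i z => ?_, hbound⟩
  change ∑' k, (lp.single (E := fun _ : σ => ℂ) 1 i z) k • A k = _
  rw [tsum_eq_single i fun k hk => by
    rw [lp.single_apply_ne (E := fun _ : σ => ℂ) 1 i z hk, zero_smul], lp.single_apply_self]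

/-- Integration against a bounded measurable function. -/
theorem exists_integral_mul_clm {X : Type*} [MeasurableSpace X] {μ : Measure X} {η : X → ℂ}
    (hη : AEStronglyMeasurable η μ) {M : ℝ} (hM : ∀ x, ‖η x‖ ≤ M) :
    ∃ L : Lp ℂ 1 μ →L[ℂ] ℂ, ∀ f : Lp ℂ 1 μ, L f = ∫ x, f x * η x ∂μ := by
  have hi : ∀ f : Lp ℂ 1 μ, Integrable (fun x => f x * η x) μ := fun f =>
    (L1.integrable_coeFn f).mul_bdd hη (Eventually.of_forall hM)
  let L : Lp ℂ 1 μ →ₗ[ℂ] ℂ :=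
    { toFun := fun f => ∫ x, f x * η x ∂μ
      map_add' := fun f g => by
        rw [← integral_add (hi f) (hi g)]
        refine integral_congr_ae ?_
        filter_upwards [Lp.coeFn_add f g] with x hx
        rw [hx, Pi.add_apply, add_mul]
      map_smul' := fun z f => by
        rw [RingHom.id_apply, smul_eq_mul, ← integral_const_mul]
        refine integral_congr_ae ?_
        filter_upwards [Lp.coeFn_smul z f] with x hx
        rw [hx, Pi.smul_apply, smul_eq_mul, mul_assoc] }
  refine ⟨L.mkContinuous M fun f => ?_, fun f => rfl⟩
  rw [L1.norm_eq_integral_norm, ← integral_const_mul]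
  refine norm_integral_le_of_norm_le ((L1.integrable_coeFn f).norm.const_mul M)
    (Eventually.of_forall fun x => ?_)
  rw [norm_mul, mul_comm]
  exact mul_le_mul_of_nonneg_right (hM x) (norm_nonneg _)

end Synthesis

/-! ### Atomic series in H¹ -/

section HardySynthesis

variable {n : ℕ} {b K : ℝ}

/-- The space of coefficients of atomic decompositions is mapped to `H¹`. -/
theorem exists_hardy_synthesis (hn : 1 ≤ n) (hb : 0 < b) (hK : 0 < K) :
    ∃ C : ℝ≥0, ∀ {σ : Type} [Countable σ] [DecidableEq σ]
      (a : σ → EuclideanSpace ℝ (Fin n) → ℂ) (c : σ → EuclideanSpace ℝ (Fin n)) (ρ : σ → ℝ),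
      (∀ i, 0 < ρ i) → (∀ i, IsTest (a i)) → (∀ i, ∫ x, a i x = 0) →
      (∀ i x, ‖a i x‖ ≤ (ρ i ^ n)⁻¹) → (∀ i x, x ∉ Metric.ball (c i) (ρ i) → a i x = 0) →
      ∃ j : lp (fun _ : σ => ℂ) 1 →ₗ[ℂ] Fun n, LocallyBounded j ∧
        (∀ u, h1Norm n b K (j u) ≤ C * ‖u‖ₑ) ∧
        ∀ i z, j (lp.single 1 i z) =ᵐ[volume] fun x => z * a i x := by
  obtain ⟨C₁, hC₁, hC₁'⟩ := exists_norm_integral_mul_testFunction_le hn hb hK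
  obtain ⟨C₂, hC₂⟩ := exists_lintegral_decay_le n
  set κ := volume.real (Metric.ball (0 : EuclideanSpace ℝ (Fin n)) 1)
  refine ⟨C₁.toNNReal * C₂, fun {σ} _ _ a c ρ hρ hat ha0 haM has => ?_⟩
  -- Height ρ^(-n) on a ball of radius ρ bounds the L¹ norm by the volume of the unit ball, so the
  -- series of atoms converges in L¹.
  have hA : ∀ i, ‖((hat i).memLp 1).toLp‖ ≤ κ := fun i => by
    have e : ∫ x, ‖((hat i).memLp 1).toLp (a i) x‖ = ∫ x, ‖a i x‖ :=
      integral_congr_ae (((hat i).memLp 1).coeFn_toLp.fun_comp (‖·‖))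
    rw [L1.norm_eq_integral_norm, e,
      ← setIntegral_eq_integral_of_forall_compl_eq_zero (s := Metric.ball (c i) (ρ i))
      fun x hx => by rw [has i x hx, norm_zero]]
    refine (Real.le_norm_self _).trans ((norm_setIntegral_le_of_norm_le_const
      (C := (ρ i ^ n)⁻¹) measure_ball_lt_top fun x _ => ?_).trans (le_of_eq ?_))
    · rw [norm_norm]
      exact haM i x
    · have := hρ i
      rw [measureReal_def, volume_ball_eq_mul _ (hρ i), ENNReal.toReal_mul,
        ENNReal.toReal_ofReal (by positivity), ← mul_assoc, inv_mul_cancel₀ (by positivity),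
        one_mul]
      rfl
  obtain ⟨T, hT, hTs, hTb⟩ := exists_synthesis (fun i => ((hat i).memLp 1).toLp) hA
  refine ⟨lpInclusion n 1 ∘ₗ T.toLinearMap, fun R => ?_, fun u => ?_, fun i z => ?_⟩
  · obtain ⟨C', hC'⟩ := locallyBounded_lpInclusion (n := n) 1 R
    refine ⟨C' * κ.toNNReal, fun u => (hC' (T u)).trans ?_⟩
    rw [ENNReal.coe_mul, mul_assoc]
    gcongr
    rw [← ofReal_norm, ← ofReal_norm]
    refine (ENNReal.ofReal_le_ofReal (hTb u)).trans_eq ?_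
    rw [ENNReal.ofReal_mul measureReal_nonneg]
    rfl
  · have hint : Integrable (T u) volume := L1.integrable_coeFn _
    have hloc : LocallyIntegrable ((lpInclusion n 1 ∘ₗ T.toLinearMap) u) volume :=
      hint.locallyIntegrable
    simp only [h1Norm, hloc, iInf_true]
    -- Integration against a dilated test function is continuous on L¹ and hence passes through the
    -- series. The resulting majorant is explicitly measurable, so measurability of the grand
    -- maximal function itself is never used.
    have hpt : ∀ x, grandMaximal n b K ((lpInclusion n 1 ∘ₗ T.toLinearMap) u) x ≤
        ∑' i, ‖u i‖ₑ * (ENNReal.ofReal (C₁ * (ρ i ^ n)⁻¹) *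
          ENNReal.ofReal ((1 + ‖(ρ i)⁻¹ • (x - c i)‖) ^ (-((n : ℝ) + 1)))) := by
      intro x
      refine iSup₂_le fun φ hφ => iSup₂_le fun t ht => iSup₂_le fun y hy => ?_
      have hφc := hφ.1.continuous
      have htn : 0 < (t ^ n)⁻¹ := by positivity
      obtain ⟨L, hL⟩ := exists_integral_mul_clm (μ := volume)
        (η := fun w => ((t ^ n)⁻¹ : ℝ) • φ (t⁻¹ • (y - w)))
        (by fun_prop) (M := (t ^ n)⁻¹ * (2 * K)) fun w => by
          rw [norm_smul, Real.norm_of_nonneg htn.le]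
          gcongr
          exact norm_le_of_mem_testFunctions hn hK hφ _
      have h1 : ∫ w, (T u) w * (((t ^ n)⁻¹ : ℝ) • φ (t⁻¹ • (y - w))) =
          ∑' i, u i * ∫ w, a i w * (((t ^ n)⁻¹ : ℝ) • φ (t⁻¹ • (y - w))) := by
        rw [← hL, ← (L.hasSum (hT u)).tsum_eq]
        refine tsum_congr fun i => ?_
        rw [map_smul, smul_eq_mul, hL]
        congr 1
        refine integral_congr_ae ?_
        filter_upwards [((hat i).memLp 1).coeFn_toLp] with w hw
        rw [hw]
      change ‖∫ w, (T u) w * _‖ₑ ≤ _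
      rw [h1]
      refine enorm_tsum_le_tsum_enorm.trans (ENNReal.tsum_le_tsum fun i => ?_)
      have := hρ i
      rw [enorm_mul, ← ENNReal.ofReal_mul (by positivity), ← ofReal_norm (∫ w, _)]
      gcongr
      exact hC₁' (a i) (c i) (ρ i) _ (hρ i) (hat i) (ha0 i) (haM i) (has i) φ hφ t ht x y hy
    have hm : ∀ i, Measurable fun x : EuclideanSpace ℝ (Fin n) =>
        ENNReal.ofReal ((1 + ‖(ρ i)⁻¹ • (x - c i)‖) ^ (-((n : ℝ) + 1))) := fun i =>
      ((((measurable_id.sub_const (c i)).const_smul (ρ i)⁻¹).norm.const_add 1).pow_const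
        _).ennreal_ofReal
    calc _ ≤ ∫⁻ x, ∑' i, ‖u i‖ₑ * (ENNReal.ofReal (C₁ * (ρ i ^ n)⁻¹) *
          ENNReal.ofReal ((1 + ‖(ρ i)⁻¹ • (x - c i)‖) ^ (-((n : ℝ) + 1)))) := lintegral_mono hpt
      _ = ∑' i, ‖u i‖ₑ * (ENNReal.ofReal (C₁ * (ρ i ^ n)⁻¹) *
          ∫⁻ x, ENNReal.ofReal ((1 + ‖(ρ i)⁻¹ • (x - c i)‖) ^ (-((n : ℝ) + 1)))) := by
          rw [lintegral_tsum fun i => (((hm i).const_mul _).const_mul _).aemeasurable]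
          refine tsum_congr fun i => ?_
          rw [lintegral_const_mul _ ((hm i).const_mul _), lintegral_const_mul _ (hm i)]
      _ ≤ ∑' i, ‖u i‖ₑ * ((C₁.toNNReal * C₂ : ℝ≥0) : ℝ≥0∞) := by
          refine ENNReal.tsum_le_tsum fun i => mul_le_mul_right ?_ _
          have := hρ i
          calc _ ≤ ENNReal.ofReal (C₁ * (ρ i ^ n)⁻¹) * (C₂ * ENNReal.ofReal (ρ i ^ n)) :=
                mul_le_mul_right (hC₂ _ _ (hρ i)) _
            _ = ENNReal.ofReal (C₁ * (ρ i ^ n)⁻¹) * ENNReal.ofReal (ρ i ^ n) * C₂ := by ring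
            _ = _ := by
              rw [← ENNReal.ofReal_mul (by positivity), mul_assoc, inv_mul_cancel₀ (by positivity),
                mul_one, ENNReal.coe_mul]
              rfl
      _ = _ := by rw [ENNReal.tsum_mul_right, ← enorm_lp_one, mul_comm]
  · change (T (lp.single 1 i z) : EuclideanSpace ℝ (Fin n) → ℂ) =ᵐ[volume] _
    rw [hTs]
    filter_upwards [Lp.coeFn_smul z ((hat i).memLp 1).toLp, ((hat i).memLp 1).coeFn_toLp]
      with x h1 h2
    rw [h1, Pi.smul_apply, h2, smul_eq_mul]

end HardySynthesis

/-! ### The upper bound for H¹ -/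

section HardyUpper

variable {n : ℕ}

/-- The classes in `L^p` of the step functions of integral zero. -/
def meanZeroStepLp (n : ℕ) (p : ℝ≥0∞) :
    Set (Lp ℂ p (volume : Measure (EuclideanSpace ℝ (Fin n)))) :=
  {F | ∃ (R : ℝ) (N : ℕ) (s : EuclideanSpace ℝ (Fin n) → ℂ), 0 < R ∧ IsDyadicStep R N s ∧
    ∫ x, s x = 0 ∧ F =ᵐ[volume] s}

theorem smul_mem_meanZeroStepLp {p : ℝ≥0∞} (c : ℂ)
    (F : Lp ℂ p (volume : Measure (EuclideanSpace ℝ (Fin n)))) (hF : F ∈ meanZeroStepLp n p) :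
    c • F ∈ meanZeroStepLp n p := by
  obtain ⟨R, N, s, hR, hs, h0, hFs⟩ := hF
  refine ⟨R, N, _, hR, hs.comp (φ := fun z => c * z) (mul_zero c), ?_, ?_⟩
  · rw [integral_const_mul, h0, mul_zero]
  · filter_upwards [Lp.coeFn_smul c F, hFs] with x h1 h2
    rw [h1, Pi.smul_apply, h2, smul_eq_mul]

theorem dense_meanZeroStepLp (hn : 1 ≤ n) {p : ℝ} (hp : 1 < p) [Fact (1 ≤ ENNReal.ofReal p)] :
    Dense (meanZeroStepLp n (ENNReal.ofReal p)) := by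
  rw [Metric.dense_iff]
  intro F ε hε
  obtain ⟨R, N, s, hR, hs, h0, hFs⟩ := exists_isDyadicStep_integral_eq_zero hn hp (Lp.memLp F)
    (half_pos hε)
  refine ⟨(hs.memLp hR _).toLp, ?_, R, N, s, hR, hs, h0, (hs.memLp hR _).coeFn_toLp⟩
  rw [Metric.mem_ball, dist_comm, Lp.dist_def]
  rw [eLpNorm_congr_ae (EventuallyEq.rfl.sub (hs.memLp hR (ENNReal.ofReal p)).coeFn_toLp)]
  refine lt_of_le_of_lt (ENNReal.toReal_mono ENNReal.ofReal_ne_top hFs) ?_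
  rw [ENNReal.toReal_ofReal (by positivity)]
  linarith

/-- An `L^p` space is contained in the interpolation space of an `L^p` space and `H¹`. -/
theorem interpNorm_hardy_le (hn : 1 ≤ n) {p pθ q r θ b K : ℝ} (hθ₀ : 0 < θ)
    (hθ₁ : θ < 1) (hpθ : 1 / pθ = (1 - θ) / p) (hpq : p.HolderConjugate q)
    (hpr : pθ.HolderConjugate r) (hb : 0 < b) (hK : 0 < K) : ∃ C : ℝ≥0, ∀ f : Fun n,
      interpNorm (lpNorm n q) (h1Norm n b K) θ f ≤ C * lpNorm n r f := by
  classical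
  have hq1 := hpq.symm.lt
  have hr1 := hpr.symm.lt
  have : Fact (1 ≤ ENNReal.ofReal q) := ⟨by simpa using hq1.le⟩
  have : Fact (1 ≤ ENNReal.ofReal r) := ⟨by simpa using hr1.le⟩
  obtain ⟨C, hC, hC'⟩ := exists_dyadic_atoms hn hpθ hpq hpr
  obtain ⟨Ch, hCh⟩ := exists_hardy_synthesis hn hb hK
  refine ⟨(1 + Ch) * Real.toNNReal (3 * (C * 4)), fun f => ?_⟩
  have hC0 : (((1 + Ch) * Real.toNNReal (3 * (C * 4)) : ℝ≥0) : ℝ≥0∞) ≠ 0 := by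
    have : 0 < Real.toNNReal (3 * (C * 4)) := Real.toNNReal_pos.2 (by positivity)
    exact_mod_cast (by positivity : 0 < (1 + Ch) * Real.toNNReal (3 * (C * 4))).ne'
  rcases eq_top_or_lt_top (lpNorm n r f) with hf | hf
  · rw [hf, ENNReal.mul_top hC0]; exact le_top
  set f' : Lp ℂ (ENNReal.ofReal r) (volume : Measure (EuclideanSpace ℝ (Fin n))) := ⟨f, hf⟩
  obtain ⟨h, α, hD, hn1, hα, hαS, hhS⟩ := exists_series_of_dense
    (D := meanZeroStepLp n (ENNReal.ofReal r)) (fun c F hF => smul_mem_meanZeroStepLp c F hF)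
    (dense_meanZeroStepLp hn hr1) f'
  choose R N s hR hs hs0 hhs using hD
  have hsn : ∀ m, eLpNorm (s m) (ENNReal.ofReal r) volume ≤ 1 := fun m => by
    rw [← eLpNorm_congr_ae (hhs m), ← Lp.enorm_def, ← ofReal_norm, ← ENNReal.ofReal_one]
    exact ENNReal.ofReal_le_ofReal (hn1 m)
  choose I lam H ρ c a hlam hH hρ hat ha0 haH has hsum hI1 hI2 using fun m =>
    hC' (R m) (N m) (s m) (hR m) (hs m) (hs0 m) (hsn m)
  have hw : ∀ m i, 0 < H m i * ρ m i ^ n := fun m i =>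
    mul_pos (hH m i) (pow_pos (hρ m i) n)
  -- One coefficient space carries the atoms of all terms m. The atoms are divided by H ρ^n, which
  -- bounds them by ρ^(-n), and the factor reappears in the coefficients y. The map j need not be
  -- injective.
  obtain ⟨j, hjb, hjn, hj⟩ := hCh (σ := Σ m, ↥(I m))
    (fun i x => (((H i.1 i.2 * ρ i.1 i.2 ^ n)⁻¹ : ℝ) : ℂ) * a i.1 i.2 x)
    (fun i => c i.1 i.2) (fun i => ρ i.1 i.2) (fun i => hρ _ _)
    (fun i => by
      obtain ⟨M, hM⟩ := (hat i.1 i.2).bounded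
      obtain ⟨S, hS⟩ := (hat i.1 i.2).support
      refine ⟨measurable_const.mul (hat i.1 i.2).measurable,
        ⟨‖(((H i.1 i.2 * ρ i.1 i.2 ^ n)⁻¹ : ℝ) : ℂ)‖ * M, fun x => ?_⟩, S,
        fun x hx => by rw [hS x hx, mul_zero]⟩
      rw [norm_mul]
      exact mul_le_mul_of_nonneg_left (hM x) (norm_nonneg _))
    (fun i => by rw [integral_const_mul, ha0, mul_zero])
    (fun i x => by
      have := hw i.1 i.2
      have := hH i.1 i.2
      rw [norm_mul, Complex.norm_real, Real.norm_of_nonneg (by positivity)]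
      calc _ ≤ (H i.1 i.2 * ρ i.1 i.2 ^ n)⁻¹ * H i.1 i.2 := by
            gcongr
            exact haH _ _ x
        _ = _ := by
          have := hρ i.1 i.2
          field_simp)
    (fun i x hx => by rw [has i.1 i.2 x hx, mul_zero])
  have hbm : ∀ m i, MemLp (a m i) (ENNReal.ofReal q) volume := fun m i => (hat m i).memLp _
  let x : ∀ m, _ → Lp ℂ (ENNReal.ofReal q) (volume : Measure (EuclideanSpace ℝ (Fin n))) :=
    fun m i => (α m : ℂ) • (hbm m i).toLp
  let y : ∀ m, _ → lp (fun _ : Σ m, ↥(I m) => ℂ) 1 := fun m i =>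
    if hi : i ∈ I m then
      lp.single 1 ⟨m, ⟨i, hi⟩⟩ ((α m * (H m i * ρ m i ^ n) : ℝ) : ℂ) else 0
  have key := interpNorm_le_of_series (N₀ := lpNorm n q) (N₁ := h1Norm n b K)
    (lpInclusion n (ENNReal.ofReal q)) j (lpInclusion n (ENNReal.ofReal r))
    (c := 1 + Ch) (fun b => by
      rw [lpNorm_lpInclusion]
      exact le_mul_of_one_le_left zero_le (by simp))
    (fun u => (hjn u).trans (by gcongr; simp))
    (isClosed_setOf_add_eq (locallyBounded_lpInclusion _) hjb
      (locallyBounded_lpInclusion _)) hθ₀ hθ₁ I lam (fun m i _ => hlam m i) x y ?_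
      (fun m => α m * C) (hαS.summable.mul_right C) ?_ ?_
    (fun m => (α m : ℂ) • h m) f' hhS ?_
  · have e : ∑' m, α m * C = C * 4 * ‖f'‖ := by
      rw [tsum_mul_right, hαS.tsum_eq]; ring
    have e2 : lpNorm n r f = ‖f'‖ₑ := (Lp.enorm_def f').symm
    refine key.trans_eq ?_
    rw [e, e2, ← mul_assoc, ENNReal.ofReal_mul (by positivity), ofReal_norm, ENNReal.coe_mul,
      mul_assoc]
    rfl
  · intro m i hi
    simp only [x, y, dif_pos hi]
    refine AEEqFun.ext ?_
    filter_upwards [hj ⟨m, ⟨i, hi⟩⟩ ((α m * (H m i * ρ m i ^ n) : ℝ) : ℂ),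
      Lp.coeFn_smul (α m : ℂ) (hbm m i).toLp, (hbm m i).coeFn_toLp] with z h1 h2 h3
    rw [h1]
    refine h2.trans ?_
    rw [Pi.smul_apply, h3, smul_eq_mul, ← mul_assoc, ← Complex.ofReal_mul,
      mul_assoc, mul_inv_cancel₀ (hw m i).ne', mul_one]
  · intro m ε hε
    have e : ∑ i ∈ I m, (ε i * (lam m i ^ (-θ) : ℝ)) • x m i = (α m : ℂ) •
        ∑ i ∈ I m, (ε i * (lam m i ^ (-θ) : ℝ)) • (hbm m i).toLp := by
      simp only [x, Finset.smul_sum]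
      exact Finset.sum_congr rfl fun i _ => smul_comm _ _ _
    rw [e, norm_smul, Complex.norm_real, Real.norm_of_nonneg (hα m)]
    refine mul_le_mul_of_nonneg_left ?_ (hα m)
    rw [Lp.norm_def, eLpNorm_congr_ae (coeFn_sum_smul_toLp _ _ (hbm m))]
    refine (ENNReal.toReal_mono ENNReal.ofReal_ne_top (hI2 m ε hε)).trans ?_
    rw [ENNReal.toReal_ofReal hC.le]
  · intro m ε hε
    calc _ ≤ ∑ i ∈ I m, α m * (lam m i ^ (1 - θ) * (H m i * ρ m i ^ n)) := by
          refine (norm_sum_le _ _).trans (Finset.sum_le_sum fun i hi => ?_)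
          have h1 : 0 < lam m i ^ (1 - θ) := Real.rpow_pos_of_pos (hlam m i) _
          simp only [y, dif_pos hi]
          rw [norm_smul, lp.norm_single one_pos, norm_mul, Complex.norm_real, Complex.norm_real,
            Real.norm_of_nonneg h1.le, Real.norm_of_nonneg (mul_nonneg (hα m) (hw m i).le)]
          calc _ ≤ 1 * lam m i ^ (1 - θ) * (α m * (H m i * ρ m i ^ n)) :=
                mul_le_mul_of_nonneg_right (mul_le_mul_of_nonneg_right (hε i) h1.le)
                  (mul_nonneg (hα m) (hw m i).le)
            _ = _ := by ring
      _ ≤ α m * C := by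
          rw [← Finset.mul_sum]
          exact mul_le_mul_of_nonneg_left (hI1 m) (hα m)
  · intro m
    have e : ∑ i ∈ I m, x m i = (α m : ℂ) • ∑ i ∈ I m, (1 : ℂ) • (hbm m i).toLp := by
      simp only [x, Finset.smul_sum, one_smul]
    rw [e, map_smul, map_smul]
    congr 1
    refine AEEqFun.ext ((hhs m).trans ?_)
    refine EventuallyEq.trans ?_ (coeFn_sum_smul_toLp _ _ (hbm m)).symm
    exact Eventually.of_forall fun z => by simp [hsum m z]

end HardyUpper

/-! ### The lower bound for H¹ -/

section HardyLower

variable {n : ℕ}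

theorem enorm_pairing_le_lpNorm {p q : ℝ} (hpq : p.HolderConjugate q)
    {a : EuclideanSpace ℝ (Fin n) → ℂ} (ha : Measurable a) {ℓ : Fun n →ₗ[ℂ] ℂ}
    (hℓ : ∀ f : Fun n, LocallyIntegrable f volume → ℓ f = ∫ x, f x * a x) {A : ℝ≥0} (hA : A ≠ 0)
    (h : eLpNorm a (ENNReal.ofReal p) volume ≤ A) (v : Fun n) : ‖ℓ v‖ₑ ≤ A * lpNorm n q v := by
  rcases eq_top_or_lt_top (lpNorm n q v) with hv | hv
  · rw [hv, ENNReal.mul_top (by exact_mod_cast hA)]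
    exact le_top
  · rw [hℓ v (locallyIntegrable_of_lpNorm hpq.symm.lt.le hv), mul_comm]
    exact (enorm_integral_mul_le_lpNorm hpq.symm v ha).trans (by gcongr)

/-- Only the embedding of H¹ in L¹ is used: no cancellation of a is required, in contrast to the
pairing with BMO. -/
theorem enorm_pairing_le_h1Norm {b K : ℝ} {C : ℝ≥0}
    (hC : ∀ f : Fun n, ∫⁻ x, ‖f x‖ₑ ≤ C * h1Norm n b K f)
    {a : EuclideanSpace ℝ (Fin n) → ℂ} {ℓ : Fun n →ₗ[ℂ] ℂ}
    (hℓ : ∀ f : Fun n, LocallyIntegrable f volume → ℓ f = ∫ x, f x * a x) {A B : ℝ≥0} (hA : A ≠ 0)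
    (hB : ∀ x, ‖a x‖ ≤ B) (hBA : B * C ≤ A) (v : Fun n) : ‖ℓ v‖ₑ ≤ A * h1Norm n b K v := by
  rcases eq_top_or_lt_top (h1Norm n b K v) with hv | hv
  · rw [hv, ENNReal.mul_top (by exact_mod_cast hA)]
    exact le_top
  · rw [hℓ v (locallyIntegrable_of_h1Norm hv)]
    calc _ ≤ ∫⁻ x, B * ‖v x‖ₑ := by
          refine (enorm_integral_le_lintegral_enorm _).trans (lintegral_mono fun x => ?_)
          rw [enorm_mul, mul_comm]
          gcongr
          rw [← ofReal_norm, ← ENNReal.ofReal_coe_nnreal]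
          exact ENNReal.ofReal_le_ofReal (hB x)
      _ = B * ∫⁻ x, ‖v x‖ₑ := lintegral_const_mul' _ _ ENNReal.coe_ne_top
      _ ≤ B * (C * h1Norm n b K v) := by gcongr; exact hC v
      _ ≤ _ := by
        rw [← mul_assoc]
        gcongr
        exact_mod_cast hBA

/-- Pairing with a step function is bounded on the interpolation space of `L^p` and `H¹`. -/
theorem exists_enorm_integral_mul_le_interpNorm_hardy {p pθ q θ b K : ℝ} (hθ₀ : 0 < θ)
    (hθ₁ : θ < 1) (hpθ : 1 / pθ = (1 - θ) / p) (hpq : p.HolderConjugate q) (hb : 0 < b)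
    (hK : 0 < K) : ∃ C : ℝ≥0, ∀ f : Fun n, LocallyIntegrable f volume →
      ∀ (R : ℝ) (N : ℕ) (g : EuclideanSpace ℝ (Fin n) → ℂ), 0 < R → IsDyadicStep R N g →
      ‖∫ x, f x * g x‖ₑ ≤ C * interpNorm (lpNorm n q) (h1Norm n b K) θ f *
        eLpNorm g (ENNReal.ofReal pθ) volume := by
  classical
  obtain ⟨C, hC0, hC⟩ := exists_lintegral_enorm_le_h1Norm n hb hK
  have hp := hpq.pos
  have hpθ0 : 0 < pθ := by
    rw [← one_div_pos, hpθ]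
    exact div_pos (by linarith) hp
  have hpe : pθ / p * (1 - θ) = 1 := by
    rw [div_mul_eq_mul_div, mul_div_assoc, ← hpθ, mul_one_div_cancel hpθ0.ne']
  refine ⟨C + 1, fun f hf R N g hR hg => ?_⟩
  refine enorm_integral_le_of_eLpNorm_le_one hR hpθ0 hg fun z hz => ?_
  set G : EuclideanSpace ℝ (Fin n) → ℂ := fun x => z * g x
  have hG : IsDyadicStep R N G := hg.comp (φ := fun w => z * w) (mul_zero z)
  -- A step function has finitely many values. It is split into its level sets, indexed by the
  -- nonzero values w, with λ_w = |w|^(-pθ/p): by `hpe`, λ_w^(1-θ) |w| = 1 and λ_w^(-θ) |w| =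
  -- |w|^(pθ/p), which are bounded in L^∞ and in L^p.
  set I : Finset ℂ := (hG.finite_range hR).toFinset.erase 0
  have hI0 : ∀ w ∈ I, 0 < ‖w‖ := fun w hw => norm_pos_iff.2 (Finset.ne_of_mem_erase hw)
  let a : ℂ → EuclideanSpace ℝ (Fin n) → ℂ := fun w x => if G x = w ∧ w ≠ 0 then w else 0
  have haM : ∀ w x, ‖a w x‖ ≤ ‖w‖ := fun w x => by
    simp only [a]
    split_ifs
    · exact le_rfl
    · simp
  have hat : ∀ w, IsTest (a w) := fun w => by
    refine ⟨?_, ⟨‖w‖, haM w⟩, (n + 1) * (2 * R), fun x hx => if_neg fun h => h.2 ?_⟩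
    · exact Measurable.ite ((hG.measurable (measurableSet_singleton w)).inter
        (MeasurableSet.const _)) measurable_const measurable_const
    · rw [← h.1]
      exact hG.support x fun h => hx (dyadicCube_subset_ball hR h)
  have hsum : ∀ (t : ℂ → ℂ) x, ∑ w ∈ I, t w * a w x = t (G x) * G x := fun t x => by
    by_cases hx : G x = 0
    · rw [hx, mul_zero]
      refine Finset.sum_eq_zero fun w _ => ?_
      have : a w x = 0 := if_neg fun h => h.2 (by rw [← h.1, hx])
      rw [this, mul_zero]
    · rw [Finset.sum_eq_single_of_mem (G x) (Finset.mem_erase.2 ⟨hx, by simp⟩) fun w _ hw => ?_]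
      · have : a (G x) x = G x := if_pos ⟨rfl, hx⟩
        rw [this]
      · have : a w x = 0 := if_neg fun h => hw h.1.symm
        rw [this, mul_zero]
  choose ℓ hℓ using fun w => exists_pairing (hat w)
  have hℓs : ∀ (t : ℂ → ℂ) (v : Fun n), LocallyIntegrable v volume →
      (∑ w ∈ I, t w • ℓ w) v = ∫ x, v x * (t (G x) * G x) := fun t v hv => by
    simp_rw [← hsum]
    rw [integral_mul_sum_eq I t hat hv, LinearMap.sum_apply]
    exact Finset.sum_congr rfl fun w _ => by rw [LinearMap.smul_apply, hℓ w v hv, smul_eq_mul]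
  have happ : ∀ (t : ℂ → ℂ) (v : Fun n), ∑ w ∈ I, t w * ℓ w v = (∑ w ∈ I, t w • ℓ w) v :=
    fun t v => by
    rw [LinearMap.sum_apply]
    rfl
  have hGm : ∀ t : ℂ → ℂ, Measurable fun x => t (G x) * G x := fun t => by
    simp_rw [← hsum]
    exact Finset.measurable_sum I fun w _ => measurable_const.mul (hat w).measurable
  have hK0 : C + 1 ≠ 0 := by positivity
  have key := enorm_sum_apply_le_interpNorm (N₀ := lpNorm n q) (N₁ := h1Norm n b K) hθ₀ hθ₁ I
    (fun w => ‖w‖ ^ (-(pθ / p))) (fun w hw => Real.rpow_pos_of_pos (hI0 w hw) _) ℓ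
    (fun w _ => ?_) (C + 1) hK0 (fun ε hε v => ?_) (fun ε hε v => ?_) f
  · refine le_of_eq_of_le ?_ key
    have h1 := hℓs (fun _ => 1) f hf
    simp only [one_smul, one_mul, LinearMap.sum_apply] at h1
    rw [h1]
  · set A : ℝ≥0 := (eLpNorm (a w) (ENNReal.ofReal p) volume).toNNReal + ‖w‖₊ * C + 1
    refine ⟨A, fun v => ⟨enorm_pairing_le_lpNorm hpq (hat w).measurable (hℓ w) (by positivity) ?_ v,
      enorm_pairing_le_h1Norm hC (hℓ w) (by positivity) (B := ‖w‖₊) (haM w) ?_ v⟩⟩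
    · rw [← ENNReal.coe_toNNReal ((hat w).memLp (ENNReal.ofReal p)).2.ne]
      exact_mod_cast (le_add_right le_self_add)
    · exact (le_add_self).trans le_self_add
  · rw [happ]
    refine enorm_pairing_le_lpNorm hpq (hGm _) (hℓs _) hK0 ?_ v
    have hle : ∀ x, ‖(ε (G x) * ((‖G x‖ ^ (-(pθ / p))) ^ (-θ) : ℝ)) * G x‖ ≤
        ‖G x‖ ^ (pθ / p) := fun x => by
      rcases (norm_nonneg (G x)).eq_or_lt with h0 | h0
      · rw [norm_mul, ← h0, mul_zero]
        positivity
      · rw [norm_mul, norm_mul, Complex.norm_real, Real.norm_of_nonneg (by positivity),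
          ← Real.rpow_mul h0.le]
        calc _ ≤ 1 * ‖G x‖ ^ (-(pθ / p) * -θ) * ‖G x‖ := by gcongr; exact hε _
          _ = ‖G x‖ ^ (-(pθ / p) * -θ) * ‖G x‖ ^ (1 : ℝ) := by rw [one_mul, Real.rpow_one]
          _ = ‖G x‖ ^ (pθ / p) := by
            rw [← Real.rpow_add h0]
            congr 1
            linarith
    refine (eLpNorm_mono_real hle).trans ?_
    rw [eLpNorm_norm_rpow _ (by positivity), ← ENNReal.ofReal_mul hp.le,
      mul_div_cancel₀ _ hp.ne']
    refine (ENNReal.rpow_le_one hz (by positivity)).trans ?_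
    exact_mod_cast le_add_self
  · rw [happ]
    refine enorm_pairing_le_h1Norm hC (hℓs _) hK0 (B := 1) (fun x => ?_) (by simp) v
    rcases (norm_nonneg (G x)).eq_or_lt with h0 | h0
    · rw [norm_mul, ← h0, mul_zero]
      simp
    · rw [norm_mul, norm_mul, Complex.norm_real, Real.norm_of_nonneg (by positivity),
        ← Real.rpow_mul h0.le]
      calc _ ≤ 1 * ‖G x‖ ^ (-(pθ / p) * (1 - θ)) * ‖G x‖ := by gcongr; exact hε _
        _ = 1 := by
          rw [neg_mul, hpe, Real.rpow_neg_one, one_mul, inv_mul_cancel₀ h0.ne']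
        _ ≤ _ := by simp

/-- The interpolation space of an `L^p` space and `H¹` is contained in an `L^p` space. -/
theorem lpNorm_le_interpNorm_hardy {p pθ q r θ b K : ℝ} (hθ₀ : 0 < θ)
    (hθ₁ : θ < 1) (hpθ : 1 / pθ = (1 - θ) / p) (hpq : p.HolderConjugate q)
    (hpr : pθ.HolderConjugate r) (hb : 0 < b) (hK : 0 < K) : ∃ C : ℝ≥0, ∀ f : Fun n,
      lpNorm n r f ≤ C * interpNorm (lpNorm n q) (h1Norm n b K) θ f := by
  obtain ⟨C, hC⟩ := exists_enorm_integral_mul_le_interpNorm_hardy (n := n) hθ₀ hθ₁ hpθ hpq hb hK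
  refine ⟨C + 1, fun f => ?_⟩
  set L := interpNorm (lpNorm n q) (h1Norm n b K) θ f with hL
  have hC0 : ((C + 1 : ℝ≥0) : ℝ≥0∞) ≠ 0 := by exact_mod_cast (by positivity : C + 1 ≠ 0)
  rcases eq_top_or_lt_top L with hv | hv
  · rw [hv, ENNReal.mul_top hC0]
    exact le_top
  have hf : LocallyIntegrable f volume := by
    have h1 := sumNorm_lt_top_of_interpNorm_lt_top hθ₀ hθ₁ hv
    simp only [sumNorm, iInf_lt_top, ENNReal.add_lt_top] at h1
    obtain ⟨f₀, f₁, rfl, h₀, h₁⟩ := h1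
    refine ((locallyIntegrable_of_lpNorm hpq.symm.lt.le h₀).add
      (locallyIntegrable_of_h1Norm h₁)).congr ?_
    exact (AEEqFun.coeFn_add f₀ f₁).symm
  have hA : ENNReal.ofReal (C * L).toReal = C * L := ENNReal.ofReal_toReal (by finiteness)
  have hfm : Measurable f := f.stronglyMeasurable.measurable
  -- Nothing is taken modulo constants for H¹, so the subtracted constants are zero.
  have h := eLpNorm_le_of_eLpNorm_dyadicCube_le (p := ENNReal.ofReal r) (A := C * L) hfm
    (fun _ => 0) tendsto_const_nhds fun k => ?_
  · simp only [sub_zero] at h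
    refine h.trans ?_
    gcongr
    simp
  · simp only [sub_zero]
    rw [← hA]
    have hR : (0 : ℝ) < (k : ℝ) + 1 := by positivity
    refine eLpNorm_le_of_enorm_integral_le hR hpr.symm ENNReal.toReal_nonneg hfm
      ((hf.integrableOn_isCompact (isCompact_closedBall _ _)).mono_set
        ((dyadicCube_subset_ball hR).trans Metric.ball_subset_closedBall)) fun N s hs => ?_
    rw [hA]
    exact hC f hf _ N s hR hs

end HardyLower

/-! ### Passing to functions modulo constants -/

section ModConst

variable {n : ℕ}

theorem modConst_mono {N N' : Fun n → ℝ≥0∞} (h : ∀ f, N f ≤ N' f) (v : FunModConst n) :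
    modConst N v ≤ modConst N' v :=
  iInf₂_mono fun f _ => h f

/-- The interpolation space of `L^p` and `BMO` contains that of `L^p` and `VMO`. -/
theorem interpNorm_bmo_le_interpNorm_vmo (p θ : ℝ) (v : FunModConst n) :
    interpNorm (modConst (lpNorm n p)) (modConst (bmoNorm n)) θ v ≤
      interpNorm (modConst (lpNorm n p)) (modConst (vmoNorm n)) θ v :=
  interpNorm_map_le (T := LinearMap.id) (fun _ => le_rfl)
    (modConst_mono fun _ => le_iInf fun _ => le_rfl) θ v

/-- An `L^p` space is contained in the interpolation space of an `L^p` space and `VMO`. -/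
theorem interpNorm_modConst_vmo_le {p r θ : ℝ} (hp : 1 < p) (hθ₀ : 0 < θ) (hθ₁ : θ < 1)
    (hr : r = p / (1 - θ)) : ∃ C : ℝ≥0, ∀ v : FunModConst n,
      interpNorm (modConst (lpNorm n p)) (modConst (vmoNorm n)) θ v ≤
        C * modConst (lpNorm n r) v := by
  obtain ⟨C, hC⟩ := interpNorm_vmo_le (n := n) hp hθ₀ hθ₁ hr
  refine ⟨C + 1, fun v => le_mul_modConst (by positivity) ?_⟩
  rintro f rfl
  refine (interpNorm_map_le (modConst_mkQ_le _) (modConst_mkQ_le _) θ f).trans ((hC f).trans ?_)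
  gcongr
  simp

end ModConst
end ComplexInterp

/-! ### The interpolation theorem -/

theorem theorem6p35 (n : ℕ) (hn : 1 ≤ n) (p p_θ θ : ℝ) (hp : 1 < p) (hθ₀ : 0 < θ) (hθ₁ : θ < 1)
    (hp_θ : 1 / p_θ = (1 - θ) / p) :
    -- `[L^p, VMO]_θ = L^{p_θ}`
    ComplexInterp.EqUpToEquivNorm
      (ComplexInterp.interpNorm (ComplexInterp.modConst (ComplexInterp.lpNorm n p))
        (ComplexInterp.modConst (ComplexInterp.vmoNorm n)) θ)
      (ComplexInterp.modConst (ComplexInterp.lpNorm n p_θ)) ∧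
    -- `[L^p, BMO]_θ = L^{p_θ}`
    ComplexInterp.EqUpToEquivNorm
      (ComplexInterp.interpNorm (ComplexInterp.modConst (ComplexInterp.lpNorm n p))
        (ComplexInterp.modConst (ComplexInterp.bmoNorm n)) θ)
      (ComplexInterp.modConst (ComplexInterp.lpNorm n p_θ)) ∧
    -- `[L^q, H¹]_θ = L^{q_θ}` for the conjugate exponents `q` of `p` and `q_θ` of `p_θ`
    (∀ q q_θ b K : ℝ, p.HolderConjugate q → p_θ.HolderConjugate q_θ → 1 < b → 0 < K →
      ComplexInterp.EqUpToEquivNorm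
        (ComplexInterp.interpNorm (ComplexInterp.lpNorm n q) (ComplexInterp.h1Norm n b K) θ)
        (ComplexInterp.lpNorm n q_θ)) := by
  have hpos : 0 < 1 - θ := by linarith
  have hpθ : p_θ = p / (1 - θ) := by
    rw [← one_div_one_div p_θ, hp_θ, one_div_div]
  have hpθ1 : 1 < p_θ := by
    rw [hpθ, lt_div_iff₀ hpos]
    linarith
  have hpq := Real.HolderConjugate.conjExponent hp
  have hpr := Real.HolderConjugate.conjExponent hpθ1
  obtain ⟨C₁, h₁⟩ := ComplexInterp.interpNorm_modConst_vmo_le (n := n) hp hθ₀ hθ₁ hpθ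
  obtain ⟨C₂, h₂⟩ := ComplexInterp.modConst_lpNorm_le_interpNorm_bmo hn hθ₀ hθ₁ hp_θ hpq hpr
  -- Both equalities modulo constants use the same two estimates: the upper one for VMO and the
  -- lower one for BMO, linked by the contractive inclusion of VMO in BMO.
  refine ⟨⟨C₁ + C₂, fun v => ⟨(h₁ v).trans ?_, (h₂ v).trans ?_⟩⟩,
    ⟨C₁ + C₂, fun v => ⟨?_, (h₂ v).trans ?_⟩⟩, fun q q_θ b K hq hqθ hb hK => ?_⟩
  · gcongr
    simp
  · gcongr
    · simp
    · exact ComplexInterp.interpNorm_bmo_le_interpNorm_vmo p θ v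
  · refine (ComplexInterp.interpNorm_bmo_le_interpNorm_vmo p θ v).trans ((h₁ v).trans ?_)
    gcongr
    simp
  · gcongr
    simp
  · have hb0 : 0 < b := by linarith
    obtain ⟨C₃, h₃⟩ := ComplexInterp.interpNorm_hardy_le hn hθ₀ hθ₁ hp_θ hq hqθ hb0 hK
    obtain ⟨C₄, h₄⟩ := ComplexInterp.lpNorm_le_interpNorm_hardy (n := n) hθ₀ hθ₁ hp_θ hq hqθ hb0 hK
    refine ⟨C₃ + C₄, fun f => ⟨(h₃ f).trans ?_, (h₄ f).trans ?_⟩⟩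
    · gcongr
      simp
    · gcongr
      simp
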